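/- For $n\ge 0$ let $\mathbb{Z}^{1,n}$ be the lattice with basis $H,E_1,\dots,E_n$ and bilinear form $Q=\langle 1\rangle\oplus n\langle -1\rangle$; for $0\le n\le 8$ it is $(H_2(M_n,\mathbb{Z}),Q_{M_n})$ for the manifold $M_n=\mathbb{CP}^2\# n\overline{\mathbb{CP}^2}$. Identify $\mathrm{Mod}(M_n)=\pi_0(\mathrm{Homeo}^+(M_n))$ with the isometry group $\mathrm{Aut}(\mathbb{Z}^{1,n},Q)=\mathrm{O}(1,n)(\mathbb{Z})$ through its action on homology, and likewise $\mathrm{Mod}(X)=\mathrm{Aut}(H_2(X,\mathbb{Z}),Q_X)$ for $X=\mathbb{CP}^1\times\mathbb{CP}^1$ (whose form is the hyperbolic plane) and for $X=\#k\overline{\mathbb{CP}^2}$ (whose form is $k\langle -1\rangle$). Let $\mathrm{Mod}^+(M_n)=\mathrm{O}^+(1,n)(\mathbb{Z})$ be the subgroup of those elements that preserve each of the two sheets of the hyperboloid $\{v\in H_2(M_n,\mathbb{R}) : Q(v,v)=1\}$. An element $g\in\mathrm{Mod}(M_n)$ is called reducible if there are a manifold $M$, equal to $\mathbb{CP}^1\times\mathbb{CP}^1$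 or to some $M_m$ with $0\le m\le 8$, an integer $k>0$, an isometry $\iota: H_2(M,\mathbb{Z})\oplus H_2(\#k\overline{\mathbb{CP}^2},\mathbb{Z})\to H_2(M_n,\mathbb{Z})$ of intersection forms, and $a\in\mathrm{Mod}(M)$, $b\in\mathrm{Mod}(\#k\overline{\mathbb{CP}^2})$ such that $g=\iota\circ(a\oplus b)\circ\iota^{-1}$; otherwise $g$ is irreducible. For $3\le n\le 8$ let $W_n\le\mathrm{Mod}^+(M_n)$ be the stabilizer in $\mathrm{Mod}(M_n)$ of $K=-3H+E_1+\cdots+E_n$. Its simple reflections are the $n$ reflections $x\mapsto x-\frac{2Q(x,v)}{Q(v,v)}v$ about $v=H-E_1-E_2-E_3,\ E_1-E_2,\ E_2-E_3,\ \dots,\ E_{n-1}-E_n$. A Coxeter element of $W_n$ is a product of these $n$ simple reflections, each taken exactly once, in any order. Theorem. Let $3\le n\le 8$ and let $f\in\mathrm{Mod}^+(M_n)$ be irreducible of odd prime order. Then $f$ is conjugate in $\mathrm{Mod}^+(M_n)$ to a power of a Coxeter element of $W_n$. -/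

import Mathlib

namespace DelPezzo

noncomputable section

/-! ### Lattices and their isometry groups -/

/-- The group `Aut(L, Q)` of isometries of a lattice `L` with bilinear form `Q`. -/
def isometryGroup {L : Type*} [AddCommGroup L] (Q : LinearMap.BilinForm ℤ L) :
    Subgroup (L ≃ₗ[ℤ] L) where
  carrier := {g | ∀ x y, Q (g x) (g y) = Q x y}
  one_mem' := fun _ _ => rfl
  mul_mem' := by
    intro a b ha hb x y
    rw [LinearEquiv.mul_apply, LinearEquiv.mul_apply, ha, hb]
  inv_mem' := by
    intro a ha x y
    have h := ha (a⁻¹ x) (a⁻¹ y)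
    rw [← LinearEquiv.mul_apply, ← LinearEquiv.mul_apply, mul_inv_cancel] at h
    exact h.symm

/-- The Gram matrix `diag(1, -1, …, -1)` in the basis `H, E₁, …, Eₙ`; the index `0` stands for `H`
and the index `i ≥ 1` for `Eᵢ`. -/
def gram (n : ℕ) : Matrix (Fin (n + 1)) (Fin (n + 1)) ℤ :=
  Matrix.diagonal (Fin.cons 1 fun _ => -1)

/-- The lattice `H₂(Mₙ, ℤ) = ℤ^{1,n}` of `Mₙ = ℂℙ² # n ℂℙ²-bar`, in the basis `H, E₁, …, Eₙ`. -/
abbrev H2 (n : ℕ) : Type := Fin (n + 1) → ℤ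

/-- The intersection form of `Mₙ`, i.e. `⟨1⟩ ⊕ n⟨-1⟩`. -/
def intersectionForm (n : ℕ) : LinearMap.BilinForm ℤ (H2 n) :=
  Matrix.toBilin' (gram n)

/-- The intersection form `k⟨-1⟩` on `H₂(# k ℂℙ²-bar, ℤ) = ℤᵏ`. -/
def negForm (k : ℕ) : LinearMap.BilinForm ℤ (Fin k → ℤ) :=
  Matrix.toBilin' (-1 : Matrix (Fin k) (Fin k) ℤ)

/-- The del Pezzo manifolds: `Mₙ` for `0 ≤ n ≤ 8` (with `M₀ = ℂℙ²`), and `ℂℙ¹ × ℂℙ¹`. -/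
inductive Manifold : Type
  | blowup (n : ℕ) (hn : n ≤ 8) : Manifold
  | quadric : Manifold

/-- The second Betti number. -/
def Manifold.b2 : Manifold → ℕ
  | .blowup n _ => n + 1
  | .quadric => 2

/-- The intersection form on `H₂(M, ℤ)` of a del Pezzo manifold `M`; it is the hyperbolic plane
for `ℂℙ¹ × ℂℙ¹`. -/
def Manifold.form : (M : Manifold) → LinearMap.BilinForm ℤ (Fin M.b2 → ℤ)
  | .blowup n _ => intersectionForm n
  | .quadric => Matrix.toBilin' !![0, 1; 1, 0]

/-! ### Mapping class groups -/

/-- `Mod(Mₙ)`, identified with `Aut(H₂(Mₙ, ℤ), Q) = O(1,n)(ℤ)` through the action of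
`π₀(Homeo⁺(Mₙ))` on homology. -/
abbrev Mod (n : ℕ) : Type := isometryGroup (intersectionForm n)

/-- The intersection form on `H₂(Mₙ, ℝ)`. -/
def realForm (n : ℕ) : LinearMap.BilinForm ℝ (Fin (n + 1) → ℝ) :=
  Matrix.toBilin' ((gram n).map (Int.castRingHom ℝ))

/-- The action of a mapping class on `H₂(Mₙ, ℝ)`, by extension of scalars. -/
def realAction {n : ℕ} (g : Mod n) : (Fin (n + 1) → ℝ) →ₗ[ℝ] (Fin (n + 1) → ℝ) :=
  Matrix.toLin' ((LinearMap.toMatrix' (g.1 : H2 n →ₗ[ℤ] H2 n)).map (Int.castRingHom ℝ))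

theorem realAction_one {n : ℕ} : realAction (1 : Mod n) = LinearMap.id := by
  have h : ((1 : Mod n).1 : H2 n →ₗ[ℤ] H2 n) = LinearMap.id := rfl
  rw [realAction, h, LinearMap.toMatrix'_id, Matrix.map_one _ (map_zero _) (map_one _),
    Matrix.toLin'_one]

theorem realAction_mul {n : ℕ} (a b : Mod n) :
    realAction (a * b) = realAction a ∘ₗ realAction b := by
  have h : ((a * b : Mod n).1 : H2 n →ₗ[ℤ] H2 n) =
      (a.1 : H2 n →ₗ[ℤ] H2 n) ∘ₗ (b.1 : H2 n →ₗ[ℤ] H2 n) := rfl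
  rw [realAction, h, LinearMap.toMatrix'_comp, Matrix.map_mul, Matrix.toLin'_mul]
  rfl

/-- The sheet of the hyperboloid `Q(v, v) = 1` in `H₂(Mₙ, ℝ)` on which the `H`-coordinate is
positive. -/
def upperSheet (n : ℕ) : Set (Fin (n + 1) → ℝ) := {v | realForm n v v = 1 ∧ 0 < v 0}

/-- The sheet of the hyperboloid `Q(v, v) = 1` in `H₂(Mₙ, ℝ)` on which the `H`-coordinate is
negative. -/
def lowerSheet (n : ℕ) : Set (Fin (n + 1) → ℝ) := {v | realForm n v v = 1 ∧ v 0 < 0}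

/-- `Mod⁺(Mₙ) = O⁺(1,n)(ℤ)`: the mapping classes preserving each of the two sheets of the
hyperboloid. -/
def ModPlus (n : ℕ) : Subgroup (Mod n) where
  carrier := {g | ∀ v, (realAction g v ∈ upperSheet n ↔ v ∈ upperSheet n) ∧
    (realAction g v ∈ lowerSheet n ↔ v ∈ lowerSheet n)}
  one_mem' := by
    intro v
    rw [realAction_one]
    exact ⟨Iff.rfl, Iff.rfl⟩
  mul_mem' := by
    intro a b ha hb v
    rw [realAction_mul]
    exact ⟨(ha _).1.trans (hb v).1, (ha _).2.trans (hb v).2⟩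
  inv_mem' := by
    intro a ha v
    have h : realAction a (realAction a⁻¹ v) = v := by
      rw [← LinearMap.comp_apply, ← realAction_mul, mul_inv_cancel, realAction_one]
      rfl
    have h' := ha (realAction a⁻¹ v)
    rw [h] at h'
    exact ⟨h'.1.symm, h'.2.symm⟩

/-- A mapping class `g` of `Mₙ` is reducible if, for some del Pezzo manifold `M`, some `k > 0` and
some isometry `ι : H₂(M) ⊕ H₂(# k ℂℙ²-bar) ≅ H₂(Mₙ)`, it is in the image of the inclusion
`Mod(M) × Mod(# k ℂℙ²-bar) → Mod(Mₙ)`, `(a, b) ↦ ι ∘ (a ⊕ b) ∘ ι⁻¹`. Here `Mod(M)` and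
`Mod(# k ℂℙ²-bar)` are again the isometry groups of the intersection forms. -/
def IsReducible {n : ℕ} (g : Mod n) : Prop :=
  ∃ (M : Manifold) (k : ℕ), 0 < k ∧
    ∃ ι : ((Fin M.b2 → ℤ) × (Fin k → ℤ)) ≃ₗ[ℤ] H2 n,
      (∀ x y, intersectionForm n (ι x) (ι y) = M.form x.1 y.1 + negForm k x.2 y.2) ∧
      ∃ (a : isometryGroup M.form) (b : isometryGroup (negForm k)),
        ∀ x, g.1 (ι x) = ι (a.1 x.1, b.1 x.2)

/-- A mapping class is irreducible if it is not reducible. -/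
def IsIrreducible {n : ℕ} (g : Mod n) : Prop := ¬ IsReducible g

/-! ### The Weyl group and its Coxeter elements -/

/-- The hyperplane class. -/
def H (n : ℕ) : H2 n := Pi.single 0 1

/-- The exceptional classes: `E 0, …, E (n - 1)` are `E₁, …, Eₙ`. -/
def E {n : ℕ} (i : Fin n) : H2 n := Pi.single i.succ 1

/-- The canonical class `K = -3H + E₁ + ⋯ + Eₙ`. -/
def canonicalClass (n : ℕ) : H2 n := -(3 : ℤ) • H n + ∑ i, E i

/-- The Weyl group `Wₙ ≤ Mod(Mₙ)`: the stabilizer of the canonical class. -/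
def weylGroup (n : ℕ) : Subgroup (Mod n) where
  carrier := {g | g.1 (canonicalClass n) = canonicalClass n}
  one_mem' := rfl
  mul_mem' := by
    intro a b ha hb
    change a.1 (b.1 (canonicalClass n)) = canonicalClass n
    rw [show b.1 (canonicalClass n) = canonicalClass n from hb]
    exact ha
  inv_mem' := by
    intro a ha
    change a.1.symm (canonicalClass n) = canonicalClass n
    rw [LinearEquiv.symm_apply_eq]
    exact ha.symm

theorem intersectionForm_apply {n : ℕ} (x y : H2 n) :
    intersectionForm n x y = x 0 * y 0 - ∑ i : Fin n, x i.succ * y i.succ := by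
  rw [intersectionForm, Matrix.toBilin'_apply', gram, dotProduct, Fin.sum_univ_succ]
  simp [Matrix.mulVec_diagonal, sub_eq_add_neg]

theorem intersectionForm_comm {n : ℕ} (x y : H2 n) :
    intersectionForm n x y = intersectionForm n y x := by
  simp only [intersectionForm_apply, mul_comm]

/-- The reflection `x ↦ x - (2 Q(x,v) / Q(v,v)) v` about a vector `v` with
`Q(v,v) ∈ {±1, ±2}`, i.e. with `Q(v,v)` dividing `2`. -/
def reflection {n : ℕ} (v : H2 n) (hv : intersectionForm n v v ∣ 2) : Mod n :=
  ⟨Module.reflection (x := v)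
      (f := (2 / intersectionForm n v v) • intersectionForm n v)
      (by simpa using Int.ediv_mul_cancel hv), by
    intro x y
    have h : 2 / intersectionForm n v v * intersectionForm n v v = 2 := Int.ediv_mul_cancel hv
    simp only [Module.reflection_apply, map_sub, map_smul, LinearMap.sub_apply,
      LinearMap.smul_apply, smul_eq_mul]
    rw [intersectionForm_comm x v]
    linear_combination (2 / intersectionForm n v v) * intersectionForm n v x *
      intersectionForm n v y * h⟩

/-- The simple roots of `Wₙ`, for `n ≥ 3`: `H - E₁ - E₂ - E₃` for the index `0`, and
`Eⱼ - Eⱼ₊₁` for the index `j = 1, …, n - 1`. -/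
def simpleRoot {n : ℕ} (hn : 3 ≤ n) (j : Fin n) : H2 n :=
  if (j : ℕ) = 0 then
    H n - E (⟨0, by omega⟩ : Fin n) - E (⟨1, by omega⟩ : Fin n) - E (⟨2, by omega⟩ : Fin n)
  else E (⟨j - 1, by omega⟩ : Fin n) - E j

theorem intersectionForm_H_H (n : ℕ) : intersectionForm n (H n) (H n) = 1 := by
  simp [intersectionForm_apply, H]

theorem intersectionForm_H_E {n : ℕ} (i : Fin n) : intersectionForm n (H n) (E i) = 0 := by
  simp [intersectionForm_apply, H, E]

theorem intersectionForm_E_E {n : ℕ} (i j : Fin n) :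
    intersectionForm n (E i) (E j) = if i = j then -1 else 0 := by
  have h0 : ∀ a : Fin n, (0 : Fin (n + 1)) ≠ a.succ := fun a => (Fin.succ_ne_zero a).symm
  by_cases h : i = j
  · subst h
    simp [intersectionForm_apply, E, Pi.single_apply, h0]
  · simp [intersectionForm_apply, E, Pi.single_apply, h0, h, Ne.symm h]

theorem simpleRoot_self {n : ℕ} (hn : 3 ≤ n) (j : Fin n) :
    intersectionForm n (simpleRoot hn j) (simpleRoot hn j) = -2 := by
  unfold simpleRoot
  split_ifs with h
  · simp only [map_sub, LinearMap.sub_apply, intersectionForm_H_H, intersectionForm_H_E,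
      intersectionForm_comm _ (H n), intersectionForm_E_E, Fin.mk.injEq]
    norm_num
  · have h1 : (⟨j - 1, by omega⟩ : Fin n) ≠ j := by
      intro e
      have := congrArg Fin.val e
      simp only at this
      omega
    simp [intersectionForm_E_E, h1, h1.symm]

/-- The simple reflections of `Wₙ`, for `n ≥ 3`. -/
def simpleReflection {n : ℕ} (hn : 3 ≤ n) (j : Fin n) : Mod n :=
  reflection (simpleRoot hn j) (by rw [simpleRoot_self]; norm_num)

/-- A Coxeter element of `Wₙ` is a product of the `n` simple reflections, each taken once, in any
order. -/
def IsCoxeterElement {n : ℕ} (hn : 3 ≤ n) (w : weylGroup n) : Prop :=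
  ∃ σ : Equiv.Perm (Fin n),
    (w : Mod n) = (List.ofFn fun i => simpleReflection hn (σ i)).prod

end

end DelPezzo

namespace DelPezzo

/-! ### The Lorentzian inequality -/

/-! The proof moves `f` into `Wₙ`, shows that it fixes nothing there but multiples of `K`, and then
classifies the few isometries with that property.

Reducibility is detected by (-1)-vectors. If `f` permutes a nonempty set of (-1)-vectors that are
pairwise orthogonal or equal up to sign, their span splits off as `k⟨-1⟩` with complement of del
Pezzo type, and `f` respects the splitting (`isReducible_of_orthogonal`). The splitting rests on the
transitivity statement `isStandardExceptional`, proved by reflection descent for `n ≤ 8`. Such a set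
exists as soon as some (-1)-vector is orthogonal to a fixed vector of positive norm, because the
complement of that vector is negative definite.

The orbit sum of `H` is a fixed vector `v` of positive norm. Move `v` into the chamber cut out by
the classes `Eᵢ` and `H - Eᵢ - Eⱼ - Eₗ`. Irreducibility keeps `v` off the walls `Eᵢ`, and then `-K`
is the unique characteristic vector of norm `9 - n` in the upper cone minimizing the pairing with
`v` (`anticanonical_nearest`); hence the conjugated `f` fixes `K`. A fixed vector not proportional
to `K` could be moved, modulo `K`, to a nonzero vector of the chamber lying on a wall `Eₘ`. It has
positive norm, which is excluded as before, or it is a multiple of a conic class `H - Eᵢ`; then, the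
order being odd, the components of the singular fibres again give an orthogonal invariant set. So
the fixed lattice is spanned by `K`.

Consequently the sum of the powers of `f` is `x ↦ d Q(x,-K)(-K)` with `d (9 - n) = p`, which leaves
`(n, p) = (4, 5)`, `(6, 3)` or `n = 8`. For `n = 8`, counting fixed points modulo 2 and 3 leaves `p
= 3` or `p = 5`.

In each of these four cases the orbit-sum identity determines `f` up to conjugacy in `Wₙ`: there is
a basis made of orbits of roots or lines, usually together with `-K`, in which both the Gram matrix
and the action of `f` are prescribed (`exists_conj_of_gram`). A suitable power of an explicit
Coxeter element satisfies the same identity by matrix computation, so it is conjugate to `f`. -/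

theorem sum_mul_lt_of_sq_lt {R ι : Type*} [CommRing R] [LinearOrder R] [IsStrictOrderedRing R]
    (s : Finset ι) (x y : ι → R) {a b : R} (ha : 0 < a) (hb : 0 < b)
    (hx : ∑ i ∈ s, x i ^ 2 < a ^ 2) (hy : ∑ i ∈ s, y i ^ 2 ≤ b ^ 2) :
    ∑ i ∈ s, x i * y i < a * b := by
  refine lt_of_pow_lt_pow_left₀ 2 (mul_nonneg ha.le hb.le) ?_
  have h1 := Finset.sum_mul_sq_le_sq_mul_sq s x y
  have h2 : 0 ≤ ∑ i ∈ s, x i ^ 2 := Finset.sum_nonneg fun i _ => sq_nonneg _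
  have hb2 : 0 < b ^ 2 := by positivity
  calc _ ≤ _ := h1
    _ ≤ (∑ i ∈ s, x i ^ 2) * b ^ 2 := by gcongr
    _ < a ^ 2 * b ^ 2 := by gcongr
    _ = _ := by ring

theorem intersectionForm_self {n : ℕ} (x : H2 n) :
    intersectionForm n x x = x 0 ^ 2 - ∑ i : Fin n, x i.succ ^ 2 := by
  simp only [intersectionForm_apply, sq]

/-- Vectors in the positive cone pair positively. -/
theorem intersectionForm_pos {n : ℕ} {x y : H2 n} (hx : 0 < intersectionForm n x x)
    (hx0 : 0 < x 0) (hy : 0 ≤ intersectionForm n y y) (hy0 : 0 < y 0) :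
    0 < intersectionForm n x y := by
  rw [intersectionForm_self] at hx hy
  rw [intersectionForm_apply, sub_pos]
  exact sum_mul_lt_of_sq_lt _ (fun i : Fin n => x i.succ) (fun i : Fin n => y i.succ) hx0 hy0
    (by linarith) (by linarith)

/-- The orthogonal complement of a positive vector is negative definite. -/
theorem eq_zero_of_orthogonal {n : ℕ} {v x : H2 n} (hv : 0 < intersectionForm n v v)
    (hvx : intersectionForm n x v = 0) (hx : 0 ≤ intersectionForm n x x) : x = 0 := by
  rw [intersectionForm_self] at hx hv
  rw [intersectionForm_apply, sub_eq_zero] at hvx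
  have h1 := Finset.sum_mul_sq_le_sq_mul_sq Finset.univ
    (fun i : Fin n => x i.succ) (fun i : Fin n => v i.succ)
  rw [← hvx] at h1
  have h3 : 0 ≤ ∑ i : Fin n, x i.succ ^ 2 := Finset.sum_nonneg fun i _ => sq_nonneg _
  have h4 : 0 ≤ ∑ i : Fin n, v i.succ ^ 2 := Finset.sum_nonneg fun i _ => sq_nonneg _
  have hx0 : x 0 = 0 := by
    by_contra hne
    have h5 : 0 < x 0 ^ 2 := by positivity
    nlinarith
  rw [hx0] at hx
  have h6 : ∑ i : Fin n, x i.succ ^ 2 = 0 := by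
    refine le_antisymm ?_ h3
    linarith
  rw [Finset.sum_eq_zero_iff_of_nonneg fun i _ => sq_nonneg _] at h6
  funext i
  refine Fin.cases hx0 (fun i => ?_) i
  simpa using h6 i (Finset.mem_univ _)

theorem isometry_apply {n : ℕ} (g : Mod n) (x y : H2 n) :
    intersectionForm n (g.1 x) (g.1 y) = intersectionForm n x y := g.2 x y

theorem mul_val_apply {n : ℕ} (g h : Mod n) (x : H2 n) : (g * h).1 x = g.1 (h.1 x) := rfl

theorem one_val_apply {n : ℕ} (x : H2 n) : (1 : Mod n).1 x = x := rfl

theorem inv_val_apply_self {n : ℕ} (g : Mod n) (x : H2 n) : (g⁻¹).1 (g.1 x) = x := by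
  rw [← mul_val_apply, inv_mul_cancel, one_val_apply]

theorem self_val_apply_inv {n : ℕ} (g : Mod n) (x : H2 n) : g.1 ((g⁻¹).1 x) = x := by
  rw [← mul_val_apply, mul_inv_cancel, one_val_apply]

theorem mod_ext {n : ℕ} {g h : Mod n} (H : ∀ x, g.1 x = h.1 x) : g = h :=
  Subtype.ext (LinearEquiv.ext H)

/-! ### The positive cone and `Mod⁺` -/

theorem realForm_apply {n : ℕ} (x y : Fin (n + 1) → ℝ) :
    realForm n x y = x 0 * y 0 - ∑ i : Fin n, x i.succ * y i.succ := by
  have h : (gram n).map (Int.castRingHom ℝ) =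
      Matrix.diagonal (Fin.cons 1 fun _ => -1 : Fin (n + 1) → ℝ) := by
    ext i j
    rw [gram, Matrix.map_apply, Matrix.diagonal_apply, Matrix.diagonal_apply]
    split_ifs
    · refine Fin.cases ?_ (fun i => ?_) i <;> simp
    · simp
  rw [realForm, Matrix.toBilin'_apply', h, dotProduct, Fin.sum_univ_succ]
  simp [Matrix.mulVec_diagonal, sub_eq_add_neg]

theorem realForm_pos {n : ℕ} {x y : Fin (n + 1) → ℝ} (hx : 0 < realForm n x x)
    (hx0 : 0 < x 0) (hy : 0 ≤ realForm n y y) (hy0 : 0 < y 0) :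
    0 < realForm n x y := by
  rw [realForm_apply] at hx hy
  simp only [← sq] at hx hy
  rw [realForm_apply, sub_pos]
  exact sum_mul_lt_of_sq_lt _ (fun i : Fin n => x i.succ) (fun i : Fin n => y i.succ) hx0 hy0
    (by linarith) (by linarith)

theorem realForm_pos_iff {n : ℕ} {x w : Fin (n + 1) → ℝ} (hx : 0 < realForm n x x)
    (hw : 0 < realForm n w w) (hw0 : 0 < w 0) : 0 < realForm n x w ↔ 0 < x 0 := by
  refine ⟨fun h => ?_, fun h => realForm_pos hx h hw.le hw0⟩
  by_contra! hne
  rcases hne.lt_or_eq with hlt | heq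
  · have := realForm_pos (x := -x) (by simpa using hx) (by simpa using hlt) hw.le hw0
    simp only [map_neg, LinearMap.neg_apply] at this
    linarith
  · rw [realForm_apply, heq] at hx
    have : 0 ≤ ∑ i : Fin n, x i.succ * x i.succ :=
      Finset.sum_nonneg fun i _ => mul_self_nonneg _
    linarith

/-- Extension of scalars from `ℤ` to `ℝ`. -/
def toReal {n : ℕ} (x : H2 n) : Fin (n + 1) → ℝ := fun i => (x i : ℝ)

theorem realAction_toReal {n : ℕ} (g : Mod n) (x : H2 n) :
    realAction g (toReal x) = toReal (g.1 x) := by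
  have h : (g.1 x) = Matrix.mulVec (LinearMap.toMatrix' (g.1 : H2 n →ₗ[ℤ] H2 n)) x := by
    rw [← Matrix.toLin'_apply, Matrix.toLin'_toMatrix']
    rfl
  funext i
  rw [realAction, Matrix.toLin'_apply, toReal, h]
  simp [Matrix.mulVec, dotProduct, toReal]

theorem realForm_toReal {n : ℕ} (x y : H2 n) :
    realForm n (toReal x) (toReal y) = (intersectionForm n x y : ℝ) := by
  rw [realForm_apply, intersectionForm_apply]
  simp [toReal]

theorem realForm_realAction {n : ℕ} (g : Mod n) (x y : Fin (n + 1) → ℝ) :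
    realForm n (realAction g x) (realAction g y) = realForm n x y := by
  have hs : ∀ i : Fin (n + 1), (Pi.single i 1 : Fin (n + 1) → ℝ) = toReal (Pi.single i 1) := by
    intro i
    funext j
    by_cases h : j = i
    · subst h; simp [toReal]
    · simp [toReal, h]
  have : (realForm n).compl₁₂ (realAction g) (realAction g) = realForm n := by
    refine LinearMap.ext_basis (Pi.basisFun ℝ _) (Pi.basisFun ℝ _) fun i j => ?_
    rw [LinearMap.compl₁₂_apply, Pi.basisFun_apply, Pi.basisFun_apply, hs, hs,
      realAction_toReal, realAction_toReal, realForm_toReal, realForm_toReal, isometry_apply]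
  exact LinearMap.congr_fun₂ this x y

/-- A single vector of positive norm decides the time orientation: a vector of norm one lies on the
upper sheet exactly when it pairs positively with a given upper vector, and `g` preserves pairings.
-/
theorem mem_ModPlus_of_pos {n : ℕ} {g : Mod n} {w : H2 n} (hw : 0 < intersectionForm n w w)
    (hw0 : 0 < w 0) (hg : 0 < (g.1 w) 0) : g ∈ ModPlus n := by
  have hW : 0 < realForm n (toReal w) (toReal w) := by
    rw [realForm_toReal]; exact_mod_cast hw
  have hgW : 0 < realForm n (realAction g (toReal w)) (realAction g (toReal w)) := by
    rwa [realForm_realAction]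
  have hW0 : 0 < toReal w 0 := by simpa [toReal] using hw0
  have hgW0 : 0 < realAction g (toReal w) 0 := by
    rw [realAction_toReal]; simpa [toReal] using hg
  have key : ∀ v : Fin (n + 1) → ℝ, realForm n v v = 1 →
      (0 < realAction g v 0 ↔ 0 < v 0) := by
    intro v hv
    rw [← realForm_pos_iff (x := realAction g v) (by rw [realForm_realAction, hv]; norm_num)
      hgW hgW0, ← realForm_pos_iff (x := v) (by rw [hv]; norm_num) hW hW0, realForm_realAction]
  intro v
  simp only [upperSheet, lowerSheet, Set.mem_ofPred_eq, realForm_realAction]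
  refine ⟨and_congr_right fun hv => key v hv, and_congr_right fun hv => ?_⟩
  have := key (-v) (by simpa using hv)
  simpa using this

theorem pos_of_mem_ModPlus {n : ℕ} {g : Mod n} (hg : g ∈ ModPlus n) {w : H2 n}
    (hw : 0 < intersectionForm n w w) (hw0 : 0 < w 0) : 0 < (g.1 w) 0 := by
  have hW : 0 < realForm n (toReal w) (toReal w) := by
    rw [realForm_toReal]; exact_mod_cast hw
  have hs := Real.sqrt_pos.2 hW
  set c := (Real.sqrt (realForm n (toReal w) (toReal w)))⁻¹ with hc
  have hc0 : 0 < c := inv_pos.2 hs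
  have hmem : c • toReal w ∈ upperSheet n := by
    refine ⟨?_, ?_⟩
    · have h2 := Real.mul_self_sqrt hW.le
      simp only [map_smul, LinearMap.smul_apply, smul_eq_mul]
      rw [hc, ← mul_assoc, ← mul_inv, h2, inv_mul_cancel₀ hW.ne']
    · simpa [toReal] using mul_pos hc0 (by exact_mod_cast hw0 : (0 : ℝ) < w 0)
  have h := ((hg _).1.2 hmem).2
  rw [map_smul, realAction_toReal] at h
  simpa [toReal, hc0] using h

/-! ### The anticanonical class -/

/-- The anticanonical class `-K = 3H - E₁ - ⋯ - Eₙ`. -/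
def anticanonical (n : ℕ) : H2 n := Fin.cons 3 fun _ => -1

theorem anticanonical_zero (n : ℕ) : anticanonical n 0 = 3 := rfl

theorem anticanonical_succ {n : ℕ} (i : Fin n) : anticanonical n i.succ = -1 := rfl

theorem sum_E_apply_succ {n : ℕ} (i : Fin n) : (∑ j, E j : H2 n) i.succ = 1 := by
  simp [E, Finset.sum_apply, Pi.single_apply]

theorem canonicalClass_eq (n : ℕ) : canonicalClass n = -anticanonical n := by
  funext i
  refine Fin.cases ?_ (fun i => ?_) i
  · have h0 : ∀ a : Fin n, (0 : Fin (n + 1)) ≠ a.succ := fun a => (Fin.succ_ne_zero a).symm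
    simp [canonicalClass, H, E, anticanonical_zero, h0]
  · rw [canonicalClass, Pi.add_apply, sum_E_apply_succ]
    simp [H, anticanonical_succ]

theorem intersectionForm_anticanonical {n : ℕ} (x : H2 n) :
    intersectionForm n x (anticanonical n) = 3 * x 0 + ∑ i : Fin n, x i.succ := by
  simp [intersectionForm_apply, anticanonical_zero, anticanonical_succ]
  ring

theorem intersectionForm_anticanonical_self (n : ℕ) :
    intersectionForm n (anticanonical n) (anticanonical n) = 9 - n := by
  rw [intersectionForm_anticanonical]
  simp [anticanonical_zero, anticanonical_succ]
  ring

theorem mem_weylGroup_iff {n : ℕ} (g : Mod n) :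
    g ∈ weylGroup n ↔ g.1 (anticanonical n) = anticanonical n := by
  change g.1 (canonicalClass n) = canonicalClass n ↔ _
  rw [canonicalClass_eq, map_neg, neg_inj]

theorem mem_ModPlus_of_fixes {n : ℕ} (hn : n ≤ 8) {g : Mod n}
    (hg : g.1 (anticanonical n) = anticanonical n) : g ∈ ModPlus n := by
  refine mem_ModPlus_of_pos (w := anticanonical n) ?_ (by rw [anticanonical_zero]; norm_num)
    (by rw [hg, anticanonical_zero]; norm_num)
  rw [intersectionForm_anticanonical_self]
  omega

theorem intersectionForm_H {n : ℕ} (x : H2 n) : intersectionForm n x (H n) = x 0 := by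
  simp [intersectionForm_apply, H]

theorem intersectionForm_E {n : ℕ} (x : H2 n) (i : Fin n) :
    intersectionForm n x (E i) = -x i.succ := by
  have h0 : ∀ a : Fin n, (0 : Fin (n + 1)) ≠ a.succ := fun a => (Fin.succ_ne_zero a).symm
  simp [intersectionForm_apply, E, Pi.single_apply, h0]

/-! ### Reflections -/

theorem reflection_val_apply {n : ℕ} {v : H2 n} (hv : intersectionForm n v v ∣ 2) (x : H2 n) :
    (reflection v hv).1 x =
      x - ((2 / intersectionForm n v v) * intersectionForm n v x) • v := by
  simp [reflection, Module.reflection_apply]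

theorem reflection_apply_of_neg_one {n : ℕ} {v : H2 n} (hv : intersectionForm n v v ∣ 2)
    (h : intersectionForm n v v = -1) (x : H2 n) :
    (reflection v hv).1 x = x + (2 * intersectionForm n x v) • v := by
  rw [reflection_val_apply, h, intersectionForm_comm x v, sub_eq_add_neg, ← neg_smul]
  norm_num

theorem reflection_apply_of_neg_two {n : ℕ} {v : H2 n} (hv : intersectionForm n v v ∣ 2)
    (h : intersectionForm n v v = -2) (x : H2 n) :
    (reflection v hv).1 x = x + (intersectionForm n x v) • v := by
  rw [reflection_val_apply, h, intersectionForm_comm x v, sub_eq_add_neg, ← neg_smul]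
  norm_num

theorem E_self {n : ℕ} (i : Fin n) : intersectionForm n (E i) (E i) = -1 := by
  simp [intersectionForm_E_E]

/-- The class `H - Eᵢ - Eⱼ - Eₗ`. -/
def cremonaRoot {n : ℕ} (i j l : Fin n) : H2 n := H n - E i - E j - E l

theorem intersectionForm_cremonaRoot {n : ℕ} (x : H2 n) (i j l : Fin n) :
    intersectionForm n x (cremonaRoot i j l) = x 0 + x i.succ + x j.succ + x l.succ := by
  simp only [cremonaRoot, map_sub, intersectionForm_H, intersectionForm_E]
  ring

theorem cremonaRoot_self {n : ℕ} {i j l : Fin n} (hij : i ≠ j) (hil : i ≠ l) (hjl : j ≠ l) :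
    intersectionForm n (cremonaRoot i j l) (cremonaRoot i j l) = -2 := by
  simp only [cremonaRoot, map_sub, LinearMap.sub_apply, intersectionForm_H_H, intersectionForm_H_E,
    intersectionForm_comm _ (H n), intersectionForm_E_E, hij, hil, hjl, hij.symm, hil.symm,
    hjl.symm, if_true, if_false]
  norm_num

/-! ### The fundamental chamber -/

/-- The vector `4H - E₁ - ⋯ - Eₙ`, in the interior of the fundamental chamber. -/
def chamberPoint (n : ℕ) : H2 n := Fin.cons 4 fun _ => -1

theorem intersectionForm_chamberPoint {n : ℕ} (x : H2 n) :
    intersectionForm n x (chamberPoint n) = 4 * x 0 + ∑ i : Fin n, x i.succ := by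
  simp [intersectionForm_apply, chamberPoint]
  ring

theorem chamberPoint_pos {n : ℕ} (hn : n ≤ 8) :
    0 < intersectionForm n (chamberPoint n) (chamberPoint n) := by
  rw [intersectionForm_chamberPoint]
  simp [chamberPoint]
  omega

theorem E_chamberPoint {n : ℕ} (i : Fin n) :
    intersectionForm n (E i) (chamberPoint n) = 1 := by
  rw [intersectionForm_comm, intersectionForm_E]
  rfl

theorem cremonaRoot_chamberPoint {n : ℕ} (i j l : Fin n) :
    intersectionForm n (cremonaRoot i j l) (chamberPoint n) = 1 := by
  rw [intersectionForm_comm, intersectionForm_cremonaRoot]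
  rfl

theorem cremonaRoot_anticanonical {n : ℕ} (i j l : Fin n) :
    intersectionForm n (cremonaRoot i j l) (anticanonical n) = 0 := by
  rw [intersectionForm_comm, intersectionForm_cremonaRoot]
  rfl

theorem E_anticanonical {n : ℕ} (i : Fin n) :
    intersectionForm n (E i) (anticanonical n) = 1 := by
  rw [intersectionForm_comm, intersectionForm_E]
  rfl

/-- The reflection in `Eᵢ`. -/
def reflectionE {n : ℕ} (i : Fin n) : Mod n := reflection (E i) (by rw [E_self]; norm_num)

theorem reflectionE_apply {n : ℕ} (i : Fin n) (x : H2 n) :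
    (reflectionE i).1 x = x + (2 * intersectionForm n x (E i)) • E i :=
  reflection_apply_of_neg_one _ (E_self i) x

/-- The reflection in `H - Eᵢ - Eⱼ - Eₗ`. -/
def reflectionCremona {n : ℕ} {i j l : Fin n} (hij : i ≠ j) (hil : i ≠ l) (hjl : j ≠ l) : Mod n :=
  reflection (cremonaRoot i j l) (by rw [cremonaRoot_self hij hil hjl]; norm_num)

theorem reflectionCremona_apply {n : ℕ} {i j l : Fin n} (hij : i ≠ j) (hil : i ≠ l) (hjl : j ≠ l)
    (x : H2 n) : (reflectionCremona hij hil hjl).1 x =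
      x + (intersectionForm n x (cremonaRoot i j l)) • cremonaRoot i j l :=
  reflection_apply_of_neg_two _ (cremonaRoot_self hij hil hjl) x

theorem reflectionCremona_mem_weylGroup {n : ℕ} {i j l : Fin n} (hij : i ≠ j) (hil : i ≠ l)
    (hjl : j ≠ l) : reflectionCremona hij hil hjl ∈ weylGroup n := by
  rw [mem_weylGroup_iff, reflectionCremona_apply, intersectionForm_comm,
    cremonaRoot_anticanonical, zero_smul, add_zero]

theorem weylGroup_le_ModPlus {n : ℕ} (hn : n ≤ 8) : weylGroup n ≤ ModPlus n := fun g hg =>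
  mem_ModPlus_of_fixes hn ((mem_weylGroup_iff g).1 hg)

theorem reflectionE_mem_ModPlus {n : ℕ} (i : Fin n) : reflectionE i ∈ ModPlus n := by
  have h : (reflectionE i).1 (H n) = H n := by
    rw [reflectionE_apply, intersectionForm_H_E, mul_zero, zero_smul, add_zero]
  refine mem_ModPlus_of_pos (w := H n) ?_ ?_ ?_
  · rw [intersectionForm_H_H]; norm_num
  · simp [H]
  · rw [h]; simp [H]

/-- An orbit of a subgroup of `Mod⁺` in the positive cone has a point closest to
`chamberPoint n`. -/
theorem exists_closest {n : ℕ} (hn : n ≤ 8) {G : Subgroup (Mod n)} (hG : G ≤ ModPlus n) {v : H2 n}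
    (hv : 0 < intersectionForm n v v) (hv0 : 0 < v 0) :
    ∃ g ∈ G, ∀ h ∈ G, intersectionForm n (g.1 v) (chamberPoint n) ≤
      intersectionForm n (h.1 (g.1 v)) (chamberPoint n) := by
  have hpos : ∀ g ∈ G, 0 < intersectionForm n (g.1 v) (chamberPoint n) := fun g hg =>
    intersectionForm_pos (by rwa [isometry_apply]) (pos_of_mem_ModPlus (hG hg) hv hv0)
      (chamberPoint_pos hn).le (by simp [chamberPoint])
  have hne : (Set.range fun g : G =>
      (intersectionForm n (g.1.1 v) (chamberPoint n)).toNat).Nonempty := ⟨_, 1, rfl⟩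
  obtain ⟨g, hg⟩ := Nat.sInf_mem hne
  refine ⟨g.1, g.2, fun h hh => ?_⟩
  have h1 : (intersectionForm n (g.1.1 v) (chamberPoint n)).toNat ≤
      (intersectionForm n ((h * g.1).1 v) (chamberPoint n)).toNat := by
    simp only at hg
    rw [hg]
    exact Nat.sInf_le ⟨⟨h * g.1, G.mul_mem hh g.2⟩, rfl⟩
  have h2 := hpos _ g.2
  have h3 := hpos _ (G.mul_mem hh g.2)
  rw [mul_val_apply] at h1 h3
  omega

/-- At a closest point, reflecting in a Cremona root changes the pairing with `chamberPoint n` by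
the pairing with that root, so minimality makes the latter nonnegative. The roots `Eᵢ - Eⱼ` are
orthogonal to the symmetric `chamberPoint n` and play no role; later estimates order the coordinates
by hand. -/
theorem exists_weylGroup_chamber {n : ℕ} (hn : n ≤ 8) {v : H2 n}
    (hv : 0 < intersectionForm n v v) (hv0 : 0 < v 0) :
    ∃ g ∈ weylGroup n, ∀ i j l : Fin n, i ≠ j → i ≠ l → j ≠ l →
      0 ≤ intersectionForm n (g.1 v) (cremonaRoot i j l) := by
  obtain ⟨g, hg, hmin⟩ := exists_closest hn (weylGroup_le_ModPlus hn) hv hv0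
  refine ⟨g, hg, fun i j l hij hil hjl => ?_⟩
  have := hmin _ (reflectionCremona_mem_weylGroup hij hil hjl)
  rw [reflectionCremona_apply, map_add, map_smul, LinearMap.add_apply, LinearMap.smul_apply,
    cremonaRoot_chamberPoint] at this
  simpa using this

theorem exists_ModPlus_chamber {n : ℕ} (hn : n ≤ 8) {v : H2 n}
    (hv : 0 < intersectionForm n v v) (hv0 : 0 < v 0) :
    ∃ g ∈ ModPlus n, (∀ i j l : Fin n, i ≠ j → i ≠ l → j ≠ l →
      0 ≤ intersectionForm n (g.1 v) (cremonaRoot i j l)) ∧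
      ∀ i : Fin n, 0 ≤ intersectionForm n (g.1 v) (E i) := by
  obtain ⟨g, hg, hmin⟩ := exists_closest hn le_rfl hv hv0
  refine ⟨g, hg, fun i j l hij hil hjl => ?_, fun i => ?_⟩
  · have := hmin _ (weylGroup_le_ModPlus hn (reflectionCremona_mem_weylGroup hij hil hjl))
    rw [reflectionCremona_apply, map_add, map_smul, LinearMap.add_apply, LinearMap.smul_apply,
      cremonaRoot_chamberPoint] at this
    simpa using this
  · have := hmin _ (reflectionE_mem_ModPlus i)
    rw [reflectionE_apply, map_add, map_smul, LinearMap.add_apply, LinearMap.smul_apply,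
      E_chamberPoint] at this
    simpa using this

/-- The three largest values of a function on `Fin n`. -/
theorem exists_three_largest {n : ℕ} (hn : 3 ≤ n) (y : Fin n → ℤ) :
    ∃ i j l : Fin n, i ≠ j ∧ i ≠ l ∧ j ≠ l ∧ y j ≤ y i ∧ y l ≤ y j ∧
      (∀ m, m ≠ i → m ≠ j → y m ≤ y l) ∧
      ∑ m, y m ^ 2 = y i ^ 2 + y j ^ 2 + y l ^ 2 +
        ∑ m ∈ ((Finset.univ.erase i).erase j).erase l, y m ^ 2 ∧
      (((Finset.univ.erase i).erase j).erase l).card = n - 3 := by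
  have hcard : (Finset.univ : Finset (Fin n)).card = n := by simp
  obtain ⟨i, hi, hi'⟩ := Finset.exists_max_image (Finset.univ : Finset (Fin n)) y
    (Finset.card_pos.1 (by omega))
  have hcard1 := Finset.card_erase_of_mem hi
  obtain ⟨j, hj, hj'⟩ := Finset.exists_max_image (Finset.univ.erase i) y
    (Finset.card_pos.1 (by omega))
  have hcard2 := Finset.card_erase_of_mem hj
  obtain ⟨l, hl, hl'⟩ := Finset.exists_max_image ((Finset.univ.erase i).erase j) y
    (Finset.card_pos.1 (by omega))
  have hcard3 := Finset.card_erase_of_mem hl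
  have hji := (Finset.mem_erase.1 hj).1
  have hlj := (Finset.mem_erase.1 hl).1
  have hli := (Finset.mem_erase.1 (Finset.mem_erase.1 hl).2).1
  refine ⟨i, j, l, hji.symm, hli.symm, hlj.symm, hi' _ (Finset.mem_univ _), hj' _ ?_, ?_, ?_, ?_⟩
  · simp [hli]
  · intro m hmi hmj
    exact hl' m (by simp [hmi, hmj])
  · rw [← Finset.add_sum_erase _ _ hi, ← Finset.add_sum_erase _ _ hj,
      ← Finset.add_sum_erase _ _ hl]
    ring
  · omega

theorem exists_three_largest_bound {n : ℕ} (hn : 3 ≤ n) (y : Fin n → ℤ) (hy : ∀ m, 0 ≤ y m) :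
    ∃ i j l : Fin n, i ≠ j ∧ i ≠ l ∧ j ≠ l ∧ y j ≤ y i ∧ y l ≤ y j ∧
      (∀ m, m ≠ i → m ≠ j → y m ≤ y l) ∧
      ∑ m, y m ^ 2 ≤ y i ^ 2 + y j ^ 2 + y l ^ 2 + (n - 3) * y l ^ 2 := by
  obtain ⟨i, j, l, hij, hil, hjl, h1, h2, h3, h4, h5⟩ := exists_three_largest hn y
  refine ⟨i, j, l, hij, hil, hjl, h1, h2, h3, ?_⟩
  rw [h4]
  have := Finset.sum_le_card_nsmul (((Finset.univ.erase i).erase j).erase l)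
    (fun m => y m ^ 2) (y l ^ 2) (fun m hm => by
      simp only [Finset.mem_erase] at hm
      exact pow_le_pow_left₀ (hy m) (h3 m hm.2.2.1 hm.2.1) 2)
  rw [h5, nsmul_eq_mul, Nat.cast_sub hn] at this
  push_cast at this
  linarith

/-- In the fundamental chamber the form is nonnegative, with explicit equality case. -/
theorem chamber_nonneg {n : ℕ} (hn : 3 ≤ n) (hn8 : n ≤ 8) {x : H2 n}
    (h1 : ∀ i j l : Fin n, i ≠ j → i ≠ l → j ≠ l →
      0 ≤ intersectionForm n x (cremonaRoot i j l))
    (h2 : ∀ i : Fin n, 0 ≤ intersectionForm n x (E i)) :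
    0 ≤ x 0 ∧ 0 ≤ intersectionForm n x x ∧ (intersectionForm n x x = 0 →
      ∃ i : Fin n, x = x 0 • (H n - E i)) := by
  obtain ⟨i, j, l, hij, hil, hjl, hji, hlj, hm, hs⟩ := exists_three_largest_bound hn
    (fun i => intersectionForm n x (E i)) h2
  have h3 := h1 i j l hij hil hjl
  have hi := h2 i
  have hj := h2 j
  have hl := h2 l
  simp only [intersectionForm_cremonaRoot, intersectionForm_E] at h1 h2 h3 hm hs hi hj hl hji hlj
  simp only [neg_sq] at hs
  rw [intersectionForm_self]
  set a := -x i.succ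
  set b := -x j.succ
  set c := -x l.succ
  have hi' : x i.succ = -a := by simp [a]
  have hj' : x j.succ = -b := by simp [b]
  have hl' : x l.succ = -c := by simp [c]
  rw [hi', hj', hl'] at hs h3
  have hn' : (n : ℤ) ≤ 8 := by exact_mod_cast hn8
  have hx0 : a + b + c ≤ x 0 := by linarith
  have hsq : (a + b + c) ^ 2 ≤ x 0 ^ 2 := pow_le_pow_left₀ (by linarith) hx0 2
  have hc : ((n : ℤ) - 3) * c ^ 2 ≤ 5 * c ^ 2 := by
    apply mul_le_mul_of_nonneg_right _ (sq_nonneg _)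
    linarith
  have hac : c * c ≤ a * c := mul_le_mul_of_nonneg_right (by linarith) hl
  have hbc : c * c ≤ b * c := mul_le_mul_of_nonneg_right (by linarith) hl
  have hab : c * c ≤ a * b := mul_le_mul (by linarith) (by linarith) hl hi
  -- For `a ≥ b ≥ c ≥ 0` one has `(a + b + c)² - a² - b² - 6c² = 2(ab + ac + bc) - 5c² ≥ ab`. The
  -- coefficient 5 bounds `n - 3`; this is where `n ≤ 8` enters.
  have hle : c * c + a * b - c * c ≤ x 0 ^ 2 - ∑ i : Fin n, x i.succ ^ 2 := by nlinarith
  refine ⟨by linarith, by nlinarith, fun h0 => ⟨i, ?_⟩⟩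
  have hab0 : a * b = 0 := by nlinarith
  have hc0 : c = 0 := by nlinarith
  have hb0 : b = 0 := by
    rcases mul_eq_zero.1 hab0 with h | h <;> linarith
  have hz : ∀ m : Fin n, m ≠ i → x m.succ = 0 := by
    intro m hmi
    by_cases hmj : m = j
    · subst hmj; linarith
    · have := hm m hmi hmj
      have := h2 m
      linarith
  have hxa : x 0 = a := by
    rw [Finset.sum_eq_single i (fun m _ hmi => by rw [hz m hmi]; norm_num) (by simp), hi'] at h0
    nlinarith
  funext m
  have hs0 : ∀ a : Fin n, (0 : Fin (n + 1)) ≠ a.succ := fun a => (Fin.succ_ne_zero a).symm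
  refine Fin.cases ?_ (fun m => ?_) m
  · simp [H, E, hs0]
  · by_cases hmi : m = i
    · subst hmi
      simp [H, E, hi', hxa]
    · rw [hz m hmi]
      simp [H, E, hmi]

/-- The anticanonical class is the only vector of the fundamental chamber with odd coordinates and
norm `9 - n`. -/
theorem eq_anticanonical_of_chamber {n : ℕ} (hn : 3 ≤ n) (hn8 : n ≤ 8) {x : H2 n}
    (h1 : ∀ i j l : Fin n, i ≠ j → i ≠ l → j ≠ l →
      0 ≤ intersectionForm n x (cremonaRoot i j l))
    (h2 : ∀ i : Fin n, 0 ≤ intersectionForm n x (E i)) (hodd : ∀ i, Odd (x i))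
    (hx : intersectionForm n x x = 9 - n) : x = anticanonical n := by
  have h2' : ∀ i : Fin n, 1 ≤ intersectionForm n x (E i) := by
    intro i
    have := h2 i
    have h := hodd i.succ
    rw [intersectionForm_E] at this ⊢
    obtain ⟨k, hk⟩ := h
    omega
  obtain ⟨i, j, l, hij, hil, hjl, hji, hlj, hm, hs⟩ := exists_three_largest_bound hn
    (fun i => intersectionForm n x (E i)) h2
  have h3 := h1 i j l hij hil hjl
  have hi := h2' i
  have hj := h2' j
  have hl := h2' l
  simp only [intersectionForm_cremonaRoot, intersectionForm_E]
    at h1 h2 h2' h3 hm hs hi hj hl hji hlj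
  simp only [neg_sq] at hs
  rw [intersectionForm_self] at hx
  set a := -x i.succ
  set b := -x j.succ
  set c := -x l.succ
  have hi' : x i.succ = -a := by simp [a]
  have hj' : x j.succ = -b := by simp [b]
  have hl' : x l.succ = -c := by simp [c]
  rw [hi', hj', hl'] at hs h3
  have hn' : (n : ℤ) ≤ 8 := by exact_mod_cast hn8
  have hn3 : (3 : ℤ) ≤ n := by exact_mod_cast hn
  have hx0 : a + b + c ≤ x 0 := by linarith
  have hsq : (a + b + c) ^ 2 ≤ x 0 ^ 2 := pow_le_pow_left₀ (by linarith) hx0 2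
  have hc1 : 1 ≤ c * c := by nlinarith
  have hc : ((n : ℤ) - 3) * (c ^ 2 - 1) ≤ 5 * (c ^ 2 - 1) := by
    apply mul_le_mul_of_nonneg_right _ (by nlinarith)
    linarith
  have hac : c * c ≤ a * c := mul_le_mul_of_nonneg_right (by linarith) (by linarith)
  have hbc : c * c ≤ b * c := mul_le_mul_of_nonneg_right (by linarith) (by linarith)
  have hab : c * c ≤ a * b := mul_le_mul (by linarith) (by linarith) (by linarith) (by linarith)
  -- Substituting the norm `9 - n` into `(a + b + c)² ≤ x₀²` and bounding the other squares by `c²`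
  -- gives this. The left side is at least `6c²`, hence `c² ≤ 1`.
  have hab1 : 2 * (a * b) + 2 * (a * c) + 2 * (b * c) ≤ 6 + 5 * (c * c - 1) := by linarith
  have hcc : c * c = 1 := by linarith
  have hc0 : c = 1 := by nlinarith only [hcc, hl]
  rw [hc0] at hab1 hlj
  have ha : a = 1 := by nlinarith only [hab1, hi, hj, hji]
  have hb : b = 1 := by linarith
  have hz : ∀ m : Fin n, x m.succ = -1 := by
    intro m
    have h4 := h2' m
    by_cases hmi : m = i
    · subst hmi; linarith
    by_cases hmj : m = j
    · subst hmj; linarith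
    have := hm m hmi hmj
    linarith
  have hx3 : x 0 = 3 := by
    simp only [hz] at hx
    have h9 : x 0 ^ 2 = 9 := by simp at hx; linarith
    nlinarith only [h9, hx0, hi, hj, hl]
  funext m
  refine Fin.cases ?_ (fun m => ?_) m
  · rw [hx3, anticanonical_zero]
  · rw [hz, anticanonical_succ]

/-! ### Exceptional vectors and orthogonal splittings -/

/-- The sign of an integer, with value `1` at zero. -/
def unitSign (t : ℤ) : ℤ := if t < 0 then -1 else 1

theorem unitSign_mul_self (t : ℤ) : unitSign t * unitSign t = 1 := by
  unfold unitSign; split_ifs <;> norm_num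

theorem unitSign_mul (t : ℤ) : unitSign t * t = |t| := by
  unfold unitSign
  split_ifs with h
  · rw [abs_of_neg h]; ring
  · rw [abs_of_nonneg (not_lt.1 h)]; ring

/-- The new value is `2|x| - s` up to sign, and its absolute value is below `|x|` exactly for `|x| <
s < 3|x|`. This is the common numerical core of the two descents on the `H`-coordinate. -/
theorem natAbs_unitSign_mul_lt {x s : ℤ} (h1 : |x| < s) (h2 : s < 3 * |x|) :
    (x + (|x| - s) * unitSign x).natAbs < x.natAbs := by
  have h : x = |x| * unitSign x := by
    rw [← unitSign_mul, mul_right_comm, unitSign_mul_self, one_mul]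
  unfold unitSign at *
  split_ifs at * <;> omega

/-- A `(-1)`-vector is equivalent to one of the `Eᵢ`, or to `H - E₁ - E₂` when `n = 2`. -/
def IsStandardExceptional {n : ℕ} (e : H2 n) : Prop :=
  (∃ (g : Mod n) (i : Fin n), g.1 e = E i) ∨ (n = 2 ∧ ∃ g : Mod n, g.1 e = H n - ∑ i, E i)

theorem IsStandardExceptional.of_apply {n : ℕ} {e : H2 n} (g : Mod n)
    (h : IsStandardExceptional (g.1 e)) : IsStandardExceptional e := by
  rcases h with ⟨g', i, h⟩ | ⟨h2, g', h⟩
  · exact Or.inl ⟨g' * g, i, h⟩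
  · exact Or.inr ⟨h2, g' * g, h⟩

theorem IsStandardExceptional.of_neg {n : ℕ} {e : H2 n} (he : intersectionForm n e e = -1)
    (h : IsStandardExceptional (-e)) : IsStandardExceptional e := by
  refine IsStandardExceptional.of_apply (reflection e (by rw [he]; norm_num)) ?_
  rw [reflection_apply_of_neg_one _ he, he]
  convert h using 1
  module

theorem isStandardExceptional_of_zero {n : ℕ} {e : H2 n} (he : intersectionForm n e e = -1)
    (h0 : e 0 = 0) : IsStandardExceptional e := by
  rw [intersectionForm_self, h0] at he
  have hsum : ∑ i : Fin n, e i.succ ^ 2 = 1 := by linarith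
  obtain ⟨i, hi⟩ : ∃ i : Fin n, e i.succ ≠ 0 := by
    by_contra! hne
    simp [hne] at hsum
  have hi1 : e i.succ ^ 2 = 1 := by
    have h1 : e i.succ ^ 2 ≤ 1 := by
      rw [← hsum]
      exact Finset.single_le_sum (f := fun i : Fin n => e i.succ ^ 2) (fun _ _ => sq_nonneg _)
        (Finset.mem_univ i)
    have h2 : 0 < e i.succ ^ 2 := by positivity
    omega
  have hrest : ∀ j : Fin n, j ≠ i → e j.succ = 0 := by
    rw [← Finset.add_sum_erase _ _ (Finset.mem_univ i), hi1] at hsum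
    have h3 : ∑ j ∈ Finset.univ.erase i, e (Fin.succ j) ^ 2 = 0 := by linarith
    rw [Finset.sum_eq_zero_iff_of_nonneg fun i _ => sq_nonneg _] at h3
    intro j hj
    simpa using h3 j (by simp [hj])
  have hE : e = e i.succ • E i := by
    have hs0 : ∀ a : Fin n, (0 : Fin (n + 1)) ≠ a.succ := fun a => (Fin.succ_ne_zero a).symm
    funext j
    refine Fin.cases ?_ (fun j => ?_) j
    · simp [h0, E, hs0]
    · by_cases hj : j = i
      · subst hj; simp [E]
      · simp [E, hj, hrest j hj]
  rcases sq_eq_one_iff.1 hi1 with h | h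
  · rw [h, one_smul] at hE
    exact Or.inl ⟨1, i, hE⟩
  · rw [h, neg_one_smul] at hE
    refine Or.inl ⟨reflectionE i, i, ?_⟩
    rw [reflectionE_apply, hE, map_neg, LinearMap.neg_apply, E_self]
    module

/-- Reflect in the root `±H ± Eᵢ ± Eⱼ ± Eₗ` carrying the signs of `e` at its three largest
`E`-coordinates, of absolute values `a, b, c`. With `s = a + b + c`, the norm condition gives `e₀² <
a² + b² + 6c² ≤ s²` and `s² ≤ 3(e₀² + 1) < 9e₀²`, so the `H`-coordinate drops. -/
theorem natAbs_sq_lt_descent {n : ℕ} (hn : 3 ≤ n) (hn8 : n ≤ 8) {e : H2 n}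
    (he : intersectionForm n e e = -1) (h0 : e 0 ≠ 0) :
    ∃ g : Mod n, ((g.1 e) 0).natAbs < (e 0).natAbs := by
  obtain ⟨i, j, l, hij, hil, hjl, hji, hlj, -, hs⟩ := exists_three_largest_bound hn
    (fun i => |e i.succ|) (fun i => abs_nonneg _)
  let r : H2 n := unitSign (e 0) • H n + unitSign (e i.succ) • E i + unitSign (e j.succ) • E j +
    unitSign (e l.succ) • E l
  have hsum3 : |e i.succ| ^ 2 + |e j.succ| ^ 2 + |e l.succ| ^ 2 ≤ ∑ m : Fin n, |e m.succ| ^ 2 := by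
    have := Finset.sum_le_sum_of_subset_of_nonneg (Finset.subset_univ {i, j, l})
      (f := fun m : Fin n => |e m.succ| ^ 2) (fun _ _ _ => sq_nonneg _)
    rw [Finset.sum_insert (by simp [hij, hil]), Finset.sum_insert (by simp [hjl]),
      Finset.sum_singleton] at this
    linarith
  have hQ : ∀ x, intersectionForm n x r = unitSign (e 0) * x 0 - unitSign (e i.succ) * x i.succ -
      unitSign (e j.succ) * x j.succ - unitSign (e l.succ) * x l.succ := by
    intro x
    simp only [r, map_add, map_smul, intersectionForm_H, intersectionForm_E, smul_eq_mul]
    ring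
  have hs0 : ∀ a : Fin n, (0 : Fin (n + 1)) ≠ a.succ := fun a => (Fin.succ_ne_zero a).symm
  have hr0 : r 0 = unitSign (e 0) := by simp [r, H, E, hs0]
  have hr : intersectionForm n r r = -2 := by
    have h1 : r i.succ = unitSign (e i.succ) := by
      simp [r, H, E, hij, hil]
    have h2 : r j.succ = unitSign (e j.succ) := by
      simp [r, H, E, hij.symm, hjl]
    have h3 : r l.succ = unitSign (e l.succ) := by
      simp [r, H, E, hil.symm, hjl.symm]
    rw [hQ, hr0, h1, h2, h3]
    simp only [unitSign_mul_self]
    norm_num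
  refine ⟨reflection r (by rw [hr]; norm_num), ?_⟩
  rw [reflection_apply_of_neg_two _ hr, hQ]
  simp only [unitSign_mul, Pi.add_apply, Pi.smul_apply, smul_eq_mul, hr0]
  rw [intersectionForm_self] at he
  simp only [← sq_abs (e _)] at he
  have hX : 1 ≤ |e 0| := Int.one_le_abs h0
  rw [show |e 0| - |e i.succ| - |e j.succ| - |e l.succ| =
    |e 0| - (|e i.succ| + |e j.succ| + |e l.succ|) by ring]
  have ha := abs_nonneg (e i.succ)
  have hb := abs_nonneg (e j.succ)
  have hc := abs_nonneg (e l.succ)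
  generalize |e i.succ| = a at *
  generalize |e j.succ| = b at *
  generalize |e l.succ| = c at *
  have hn' : (n : ℤ) ≤ 8 := by exact_mod_cast hn8
  have hcc : ((n : ℤ) - 3) * c ^ 2 ≤ 5 * c ^ 2 := by
    apply mul_le_mul_of_nonneg_right _ (sq_nonneg _)
    linarith
  have hac : c * c ≤ a * c := mul_le_mul_of_nonneg_right (by linarith) hc
  have hbc : c * c ≤ b * c := mul_le_mul_of_nonneg_right (by linarith) hc
  have hab : c * c ≤ a * b := mul_le_mul (by linarith) (by linarith) hc ha
  refine natAbs_unitSign_mul_lt ?_ ?_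
  · refine lt_of_pow_lt_pow_left₀ 2 (by linarith) ?_
    linarith [mul_self_nonneg c]
  · refine lt_of_pow_lt_pow_left₀ 2 (by linarith) ?_
    have h3 : (a + b + c) ^ 2 ≤ 3 * (a ^ 2 + b ^ 2 + c ^ 2) := by
      linarith [sq_nonneg (a - b), sq_nonneg (a - c), sq_nonneg (b - c)]
    have h4 : 1 ≤ |e 0| ^ 2 := one_le_pow₀ hX
    linarith

theorem isStandardExceptional_two_of_one {e : H2 2} (he : intersectionForm 2 e e = -1)
    (h0 : e 0 = 1) : IsStandardExceptional e := by
  have he' := he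
  rw [intersectionForm_self, h0, Fin.sum_univ_two] at he
  have key : ∀ (e : H2 2), e 0 = 1 → e 1 ^ 2 = 1 → e 2 = -1 → IsStandardExceptional e := by
    intro e h0 h1 h2
    rcases sq_eq_one_iff.1 h1 with h | h
    · refine Or.inr ⟨rfl, reflectionE 0, ?_⟩
      rw [reflectionE_apply, intersectionForm_E]
      funext i
      fin_cases i <;> simp [h0, h, h2, H, E]
    · refine Or.inr ⟨rfl, 1, ?_⟩
      rw [one_val_apply]
      funext i
      fin_cases i <;> simp [h0, h, h2, H, E]
  change 1 ^ 2 - (e 1 ^ 2 + e 2 ^ 2) = -1 at he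
  have h1 : e 1 ^ 2 = 1 ∧ e 2 ^ 2 = 1 := by
    have h5 : |e 1| ≤ 1 := by
      apply abs_le_of_sq_le_sq _ (by norm_num)
      by_contra! hlt
      have : e 1 ^ 2 = 2 := by nlinarith
      have h7 : |e 1| < 2 := abs_lt_of_sq_lt_sq (by linarith) (by norm_num)
      rw [abs_lt] at h7
      have : e 1 = -1 ∨ e 1 = 0 ∨ e 1 = 1 := by omega
      rcases this with h | h | h <;> rw [h] at this <;> norm_num at this
    have h6 : e 1 ≠ 0 := by
      intro h
      rw [h] at he
      have h7 : |e 2| < 2 := abs_lt_of_sq_lt_sq (by linarith) (by norm_num)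
      rw [abs_lt] at h7
      have : e 2 = -1 ∨ e 2 = 0 ∨ e 2 = 1 := by omega
      rcases this with h | h | h <;> rw [h] at he <;> norm_num at he
    rw [abs_le] at h5
    have : e 1 = -1 ∨ e 1 = 1 := by omega
    rcases this with h | h <;> rw [h] at he ⊢ <;> constructor <;> linarith
  rcases sq_eq_one_iff.1 h1.2 with h | h
  · refine IsStandardExceptional.of_apply (reflectionE 1) (key _ ?_ ?_ ?_)
    · rw [reflectionE_apply]; simp [E, h0]
    · rw [reflectionE_apply, ← h1.1]; simp [E]
    · rw [reflectionE_apply, intersectionForm_E]; simp [E, h]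
  · exact key e h0 h1.1 h

/-- For `n = 2` there is no Cremona root; the (-1)-vector with entries `±1` and the signs of `e`
replaces it. Here `s = 2(a + b) - |e₀|`, and `a² + b² = e₀² + 1` gives `|e₀| < a + b < 2|e₀|` once
`|e₀| > 1`. -/
theorem natAbs_lt_descent_two {e : H2 2} (he : intersectionForm 2 e e = -1) (h0 : 1 < |e 0|) :
    ∃ g : Mod 2, ((g.1 e) 0).natAbs < (e 0).natAbs := by
  let r : H2 2 := ![unitSign (e 0), unitSign (e 1), unitSign (e 2)]
  have hQ : ∀ x, intersectionForm 2 x r = unitSign (e 0) * x 0 - unitSign (e 1) * x 1 -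
      unitSign (e 2) * x 2 := by
    intro x
    rw [intersectionForm_apply, Fin.sum_univ_two]
    simp [r]
    ring
  have hr : intersectionForm 2 r r = -1 := by
    rw [hQ]
    simp only [r, Matrix.cons_val, unitSign_mul_self]
    norm_num
  refine ⟨reflection r (by rw [hr]; norm_num), ?_⟩
  rw [reflection_apply_of_neg_one _ hr, hQ]
  simp only [unitSign_mul, Pi.add_apply, Pi.smul_apply, smul_eq_mul]
  rw [intersectionForm_self, Fin.sum_univ_two] at he
  change e 0 ^ 2 - (e 1 ^ 2 + e 2 ^ 2) = -1 at he
  simp only [← sq_abs (e _)] at he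
  have ha := abs_nonneg (e 1)
  have hb := abs_nonneg (e 2)
  change (e 0 + 2 * (|e 0| - |e 1| - |e 2|) * unitSign (e 0)).natAbs < _
  rw [show 2 * (|e 0| - |e 1| - |e 2|) = |e 0| - (2 * (|e 1| + |e 2|) - |e 0|) by ring]
  generalize |e 1| = a at *
  generalize |e 2| = b at *
  have h1 : |e 0| < a + b := by
    refine lt_of_pow_lt_pow_left₀ 2 (by linarith) ?_
    linarith [mul_nonneg ha hb]
  have h2 : a + b < 2 * |e 0| := by
    refine lt_of_pow_lt_pow_left₀ 2 (by linarith) ?_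
    nlinarith [sq_nonneg (a - b)]
  exact natAbs_unitSign_mul_lt (by linarith) (by linarith)

/-- Induction on `|e₀|`, by descent for `n ≥ 3`. For `n = 0` no such vector exists, for `n = 1`
factoring `e₁² - e₀² = 1` forces `e₀ = 0`, and for `n = 2` the descent stops at `|e₀| = 1`, which
accounts for `H - E₁ - E₂`. -/
theorem isStandardExceptional {n : ℕ} (hn : n ≤ 8) {e : H2 n}
    (he : intersectionForm n e e = -1) : IsStandardExceptional e := by
  induction hN : (e 0).natAbs using Nat.strong_induction_on generalizing e with
  | _ N ih =>
  by_cases h0 : e 0 = 0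
  · exact isStandardExceptional_of_zero he h0
  have desc : (∃ g : Mod n, ((g.1 e) 0).natAbs < (e 0).natAbs) → IsStandardExceptional e := by
    rintro ⟨g, hg⟩
    exact IsStandardExceptional.of_apply g
      (ih _ (hN ▸ hg) (by rw [isometry_apply, he]) rfl)
  rcases Nat.lt_or_ge n 3 with hlt | hge
  · interval_cases n
    · rw [intersectionForm_self, Fin.sum_univ_zero] at he
      nlinarith [sq_nonneg (e 0)]
    · rw [intersectionForm_self, Fin.sum_univ_one] at he
      change e 0 ^ 2 - e 1 ^ 2 = -1 at he
      have hm : (e 1 - e 0) * (e 1 + e 0) = 1 := by linarith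
      rcases Int.eq_one_or_neg_one_of_mul_eq_one hm with h | h <;> rw [h] at hm <;> omega
    · rcases lt_or_ge 1 |e 0| with h | h
      · exact desc (natAbs_lt_descent_two he h)
      · have : e 0 = 1 ∨ e 0 = -1 := by
          rw [abs_le] at h
          omega
        rcases this with h | h
        · exact isStandardExceptional_two_of_one he h
        · exact IsStandardExceptional.of_neg he
            (isStandardExceptional_two_of_one (by simpa using he) (by simp [h]))
  · exact desc (natAbs_sq_lt_descent hge hn he h0)

theorem negForm_apply {k : ℕ} (x y : Fin k → ℤ) : negForm k x y = -∑ i, x i * y i := by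
  rw [negForm, Matrix.toBilin'_apply', Matrix.neg_mulVec, Matrix.one_mulVec, dotProduct_neg,
    dotProduct]

/-- Splitting off one coordinate of `ℤ^{k+1}`. -/
def splitCoord {k : ℕ} (p : Fin (k + 1)) : (Fin (k + 1) → ℤ) ≃ₗ[ℤ] (Fin k → ℤ) × ℤ where
  toFun x := (fun j => x (p.succAbove j), x p)
  invFun y := p.insertNth y.2 y.1
  map_add' _ _ := rfl
  map_smul' _ _ := rfl
  left_inv x := p.insertNth_self_removeNth x
  right_inv y := by ext <;> simp

theorem splitCoord_fst {k : ℕ} (p : Fin (k + 1)) (x : Fin (k + 1) → ℤ) (j : Fin k) :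
    (splitCoord p x).1 j = x (p.succAbove j) := rfl

theorem splitCoord_snd {k : ℕ} (p : Fin (k + 1)) (x : Fin (k + 1) → ℤ) :
    (splitCoord p x).2 = x p := rfl

theorem splitCoord_form {n : ℕ} (i : Fin (n + 1)) (x y : H2 (n + 1)) :
    intersectionForm (n + 1) x y =
      intersectionForm n (splitCoord i.succ x).1 (splitCoord i.succ y).1 -
        (splitCoord i.succ x).2 * (splitCoord i.succ y).2 := by
  simp only [intersectionForm_apply, splitCoord_fst, splitCoord_snd, Fin.succ_succAbove_succ,
    Fin.succ_succAbove_zero]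
  rw [Fin.sum_univ_succAbove _ i]
  ring

theorem splitCoord_negForm {k : ℕ} (x y : Fin (k + 1) → ℤ) :
    negForm (k + 1) x y = negForm k (splitCoord 0 x).1 (splitCoord 0 y).1 -
        (splitCoord 0 x).2 * (splitCoord 0 y).2 := by
  simp only [negForm_apply, splitCoord_fst, splitCoord_snd, Fin.sum_univ_succ, Fin.succAbove_zero]
  ring

/-- A splitting of `H₂(Mₙ)` as `H₂(M) ⊕ H₂(# k ℂℙ²-bar)` in which the second summand is spanned by
the given vectors. -/
def HasSplitting {n k : ℕ} (e : Fin k → H2 n) : Prop :=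
  ∃ (M : Manifold) (ι : ((Fin M.b2 → ℤ) × (Fin k → ℤ)) ≃ₗ[ℤ] H2 n),
    (∀ x y, intersectionForm n (ι x) (ι y) = M.form x.1 y.1 + negForm k x.2 y.2) ∧
    ∀ y, ι (0, y) = ∑ j, y j • e j

theorem HasSplitting.of_apply {n k : ℕ} {e : Fin k → H2 n} (g : Mod n)
    (h : HasSplitting fun j => g.1 (e j)) : HasSplitting e := by
  obtain ⟨M, ι, h1, h2⟩ := h
  refine ⟨M, ι.trans (g⁻¹).1, fun x y => ?_, fun y => ?_⟩
  · rw [LinearEquiv.trans_apply, LinearEquiv.trans_apply, isometry_apply, h1]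
  · rw [LinearEquiv.trans_apply, h2, map_sum]
    simp only [map_smul, inv_val_apply_self]

theorem hasSplitting_zero {n : ℕ} (hn : n ≤ 8) (e : Fin 0 → H2 n) : HasSplitting e := by
  let ι : ((Fin (n + 1) → ℤ) × (Fin 0 → ℤ)) ≃ₗ[ℤ] H2 n := LinearEquiv.prodUnique
  refine ⟨.blowup n hn, ι, fun x y => ?_, fun y => ?_⟩
  · rw [negForm_apply, Fin.sum_univ_zero, neg_zero, add_zero]
    rfl
  · rw [Fin.sum_univ_zero]
    rfl

/-- The complement of `H - E₁ - E₂` is spanned by the isotropic classes `H - E₁` and `H - E₂`, whose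
product is one: a hyperbolic plane. This is why `ℂℙ¹ × ℂℙ¹` has to be allowed as a summand. -/
theorem hasSplitting_quadric (e : Fin 1 → H2 2) (he : e 0 = H 2 - ∑ i, E i) : HasSplitting e := by
  let ι : ((Fin 2 → ℤ) × (Fin 1 → ℤ)) ≃ₗ[ℤ] H2 2 :=
    { toFun := fun x => ![x.1 0 + x.1 1 + x.2 0, -x.1 0 - x.2 0, -x.1 1 - x.2 0]
      invFun := fun y => (![y 0 + y 2, y 0 + y 1], ![-(y 0 + y 1 + y 2)])
      map_add' := by
        intro x y
        funext i
        fin_cases i <;> simp <;> ring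
      map_smul' := by
        intro c x
        funext i
        fin_cases i <;> simp <;> ring
      left_inv := by
        intro x
        refine Prod.ext (funext fun i => ?_) (funext fun i => ?_) <;> fin_cases i <;> simp
      right_inv := by
        intro x
        funext i
        fin_cases i <;> simp <;> ring }
  have hι : ∀ x y, intersectionForm 2 (ι x) (ι y) =
      Matrix.toBilin' !![0, 1; 1, 0] x.1 y.1 + negForm 1 x.2 y.2 := by
    intro x y
    rw [intersectionForm_apply, Fin.sum_univ_two, negForm_apply, Fin.sum_univ_one]
    change (x.1 0 + x.1 1 + x.2 0) * (y.1 0 + y.1 1 + y.2 0) -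
      ((-x.1 0 - x.2 0) * (-y.1 0 - y.2 0) + (-x.1 1 - x.2 0) * (-y.1 1 - y.2 0)) =
      Matrix.toBilin' !![0, 1; 1, 0] x.1 y.1 + -(x.2 0 * y.2 0)
    rw [Matrix.toBilin'_apply']
    have h : dotProduct x.1 (Matrix.mulVec !![0, 1; 1, 0] y.1) =
        x.1 0 * y.1 1 + x.1 1 * y.1 0 := by
      simp [dotProduct, Matrix.mulVec, Fin.sum_univ_two]
    rw [h]
    ring
  refine ⟨.quadric, ι, hι, fun y => ?_⟩
  · rw [Fin.sum_univ_one, he]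
    funext i
    change (![0 + 0 + y 0, -0 - y 0, -0 - y 0] : H2 2) i = _
    fin_cases i <;> simp [H, E]

/-- Move the first vector to some `Eᵢ`, delete that coordinate, and apply induction to the remaining
vectors in a lattice of smaller rank. If the first vector is of type `H - E₁ - E₂`, the process
ends. -/
theorem hasSplitting {k : ℕ} : ∀ {n : ℕ} (_ : n ≤ 8) (e : Fin k → H2 n)
    (_ : ∀ a b, intersectionForm n (e a) (e b) = if a = b then -1 else 0), HasSplitting e := by
  induction k with
  | zero => exact fun hn e _ => hasSplitting_zero hn e
  | succ k ih =>
    intro n hn e he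
    rcases isStandardExceptional hn (e := e 0) (by simp [he]) with ⟨g, i, hg⟩ | ⟨rfl, g, hg⟩
    · obtain _ | n := n
      · exact i.elim0
      refine HasSplitting.of_apply g ?_
      have hS : splitCoord i.succ (E i : H2 (n + 1)) = (0, 1) := by
        refine Prod.ext (funext fun j => ?_) ?_
        · simp [splitCoord_fst, E]
        · simp [splitCoord_snd, E]
      have hj : ∀ j : Fin k, (splitCoord i.succ (g.1 (e j.succ))).2 = 0 := by
        intro j
        have h := he j.succ 0
        rw [← isometry_apply g, hg, splitCoord_form i, hS] at h
        simpa using h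
      obtain ⟨M, ι, h1, h2⟩ := ih (by omega : n ≤ 8)
        (fun j => (splitCoord i.succ (g.1 (e j.succ))).1) (by
          intro a b
          have h := he a.succ b.succ
          rw [← isometry_apply g, splitCoord_form i, hj, hj] at h
          simpa using h)
      let ι' : ((Fin M.b2 → ℤ) × (Fin (k + 1) → ℤ)) ≃ₗ[ℤ] H2 (n + 1) :=
        (LinearEquiv.prodCongr (LinearEquiv.refl ℤ _) (splitCoord 0)).trans
          ((LinearEquiv.prodAssoc ℤ _ _ _).symm.trans
            ((LinearEquiv.prodCongr ι (LinearEquiv.refl ℤ ℤ)).trans (splitCoord i.succ).symm))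
      have hι : ∀ x, splitCoord i.succ (ι' x) =
          (ι (x.1, (splitCoord 0 x.2).1), (splitCoord 0 x.2).2) := fun x =>
        (splitCoord i.succ).apply_symm_apply _
      refine ⟨M, ι', fun x y => ?_, fun y => ?_⟩
      · rw [splitCoord_form i, hι, hι, h1, splitCoord_negForm]
        ring
      · apply (splitCoord i.succ).injective
        rw [hι, map_sum, Fin.sum_univ_succ]
        simp only [map_smul, hg, hS]
        refine Prod.ext ?_ ?_
        · simp only [h2, Prod.fst_add, Prod.smul_fst, Prod.fst_sum, smul_zero, zero_add]
          rfl
        · simp only [Prod.snd_add, Prod.smul_snd, Prod.snd_sum, hj, smul_zero,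
            Finset.sum_const_zero]
          simp [splitCoord_snd]
    -- The complement of `H - E₁ - E₂` is an even lattice, so it contains no further vector of norm
    -- -1.
    · have hk : k = 0 := by
        by_contra hk
        obtain ⟨k, rfl⟩ := Nat.exists_eq_succ_of_ne_zero hk
        have h0 := he 1 0
        have h1 := he 1 1
        rw [← isometry_apply g] at h0 h1
        rw [hg] at h0
        rw [map_sub, map_sum, intersectionForm_H, Fin.sum_univ_two, intersectionForm_E,
          intersectionForm_E] at h0
        rw [intersectionForm_self, Fin.sum_univ_two] at h1
        simp only [one_ne_zero, if_true, if_false] at h0 h1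
        generalize (g.1 (e 1)) = x at *
        have : x 0 = -(x (Fin.succ 0) + x (Fin.succ 1)) := by linarith
        rw [this] at h1
        have : 2 * (x (Fin.succ 0) * x (Fin.succ 1)) = -1 := by linarith
        omega
      subst hk
      exact HasSplitting.of_apply g (hasSplitting_quadric _ hg)

/-! ### A criterion for reducibility -/

theorem exists_prod_equiv {A B : Type*} [AddCommGroup A] [AddCommGroup B]
    (T : (A × B) ≃ₗ[ℤ] (A × B)) (h1 : ∀ x, (T (x, 0)).2 = 0) (h2 : ∀ y, (T (0, y)).1 = 0)
    (h1' : ∀ x, (T.symm (x, 0)).2 = 0) (h2' : ∀ y, (T.symm (0, y)).1 = 0) :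
    ∃ (a : A ≃ₗ[ℤ] A) (b : B ≃ₗ[ℤ] B), ∀ x, T x = (a x.1, b x.2) := by
  have e1 : ∀ x, T (x, 0) = ((T (x, 0)).1, 0) := fun x => Prod.ext rfl (h1 x)
  have e2 : ∀ y, T (0, y) = (0, (T (0, y)).2) := fun y => Prod.ext (h2 y) rfl
  have e1' : ∀ x, T.symm (x, 0) = ((T.symm (x, 0)).1, 0) := fun x => Prod.ext rfl (h1' x)
  have e2' : ∀ y, T.symm (0, y) = (0, (T.symm (0, y)).2) := fun y => Prod.ext (h2' y) rfl
  refine ⟨LinearEquiv.ofLinearMap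
    (LinearMap.fst ℤ A B ∘ₗ T.toLinearMap ∘ₗ LinearMap.inl ℤ A B)
    (LinearMap.fst ℤ A B ∘ₗ T.symm.toLinearMap ∘ₗ LinearMap.inl ℤ A B) ?_ ?_,
    LinearEquiv.ofLinearMap
    (LinearMap.snd ℤ A B ∘ₗ T.toLinearMap ∘ₗ LinearMap.inr ℤ A B)
    (LinearMap.snd ℤ A B ∘ₗ T.symm.toLinearMap ∘ₗ LinearMap.inr ℤ A B) ?_ ?_, ?_⟩
  · refine LinearMap.ext fun x => ?_
    simp [← e1']
  · refine LinearMap.ext fun x => ?_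
    simp [← e1]
  · refine LinearMap.ext fun x => ?_
    simp [← e2']
  · refine LinearMap.ext fun x => ?_
    simp [← e2]
  · intro x
    have : x = (x.1, 0) + (0, x.2) := by simp
    conv_lhs => rw [this, map_add, e1, e2]
    simp

theorem linearIndependent_of_orthonormal {n k : ℕ} {e : Fin k → H2 n}
    (he : ∀ a b, intersectionForm n (e a) (e b) = if a = b then -1 else 0) :
    LinearIndependent ℤ e := by
  rw [Fintype.linearIndependent_iff]
  intro c hc i
  have h := congrArg (fun x => intersectionForm n x (e i)) hc
  simp only [map_sum, LinearMap.sum_apply, map_smul, LinearMap.smul_apply, he, smul_eq_mul,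
    map_zero, LinearMap.zero_apply] at h
  simpa using h

/-- A nonempty set of orthogonal `(-1)`-vectors contains a maximal orthonormal family. -/
theorem exists_maximal_orthonormal {n : ℕ} (S : Set (H2 n))
    (hS1 : ∀ x ∈ S, intersectionForm n x x = -1)
    (hS2 : ∀ x ∈ S, ∀ y ∈ S, intersectionForm n x y = 0 ∨ x = y ∨ x = -y) :
    ∃ (k : ℕ) (e : Fin k → H2 n), (∀ j, e j ∈ S) ∧
      (∀ a b, intersectionForm n (e a) (e b) = if a = b then -1 else 0) ∧
      ∀ x ∈ S, ∃ j, x = e j ∨ x = -e j := by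
  -- Without a maximal family, orthonormal families of every length exist, and one of length `n + 2`
  -- exceeds the rank.
  by_contra! hne
  have : ∀ k, ∃ e : Fin k → H2 n, (∀ j, e j ∈ S) ∧
      (∀ a b, intersectionForm n (e a) (e b) = if a = b then -1 else 0) := by
    intro k
    induction k with
    | zero => exact ⟨Fin.elim0, fun j => j.elim0, fun j => j.elim0⟩
    | succ k ih =>
      obtain ⟨e, h1, h2⟩ := ih
      obtain ⟨x, hx, hxe⟩ := hne k e h1 h2
      have hxe' : ∀ j, intersectionForm n x (e j) = 0 := fun j =>
        (hS2 x hx _ (h1 j)).resolve_right fun h => h.elim (hxe j).1 (hxe j).2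
      refine ⟨Fin.cons x e, fun j => ?_, fun a b => ?_⟩
      · refine Fin.cases ?_ (fun j => ?_) j
        · simpa using hx
        · simpa using h1 j
      · refine Fin.cases ?_ (fun a => ?_) a <;> refine Fin.cases ?_ (fun b => ?_) b
        · simpa using hS1 x hx
        · simpa [(Fin.succ_ne_zero b).symm] using hxe' b
        · simpa [intersectionForm_comm (e a)] using hxe' a
        · simpa using h2 a b
  obtain ⟨e, -, he⟩ := this (n + 2)
  have := (linearIndependent_of_orthonormal he).fintype_card_le_finrank
  simp at this

/-- A maximal orthonormal family in `S` contains every element of `S` up to sign, so its span is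
invariant under `f` and `f⁻¹`. The span splits off as `k⟨-1⟩`, and an isometry preserving it also
preserves the orthogonal summand. -/
theorem isReducible_of_orthogonal {n : ℕ} (hn : n ≤ 8) (f : Mod n) (S : Set (H2 n))
    (hS : S.Nonempty) (hS1 : ∀ x ∈ S, intersectionForm n x x = -1)
    (hS2 : ∀ x ∈ S, ∀ y ∈ S, intersectionForm n x y = 0 ∨ x = y ∨ x = -y)
    (hf : ∀ x ∈ S, f.1 x ∈ S) (hf' : ∀ x ∈ S, (f⁻¹).1 x ∈ S) : IsReducible f := by
  obtain ⟨k, e, heS, he, hmax⟩ := exists_maximal_orthonormal S hS1 hS2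
  obtain ⟨x, hx⟩ := hS
  have hk : 0 < k := by
    obtain ⟨j, -⟩ := hmax x hx
    exact j.pos
  obtain ⟨M, ι, h1, h2⟩ := hasSplitting hn e he
  have hmem : ∀ x ∈ S, (ι.symm x).1 = 0 := by
    intro x hx
    obtain ⟨j, hj⟩ := hmax x hx
    have hej : ι (0, Pi.single j 1) = e j := by
      rw [h2]
      simp [Pi.single_apply]
    have : ι.symm (e j) = (0, Pi.single j 1) := by rw [← hej, LinearEquiv.symm_apply_apply]
    rcases hj with rfl | rfl
    · rw [this]
    · rw [map_neg, this]; simp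
  have fst_zero : ∀ g : Mod n, (∀ x ∈ S, g.1 x ∈ S) → ∀ y, (ι.symm (g.1 (ι (0, y)))).1 = 0 := by
    intro g hg y
    rw [h2, map_sum, map_sum, Prod.fst_sum]
    refine Finset.sum_eq_zero fun j _ => ?_
    rw [map_smul, map_smul, Prod.smul_fst, hmem _ (hg _ (heS j)), smul_zero]
  have snd_zero : ∀ g : Mod n, (∀ y, (ι.symm ((g⁻¹).1 (ι (0, y)))).1 = 0) →
      ∀ x, (ι.symm (g.1 (ι (x, 0)))).2 = 0 := by
    intro g hg x
    funext j
    have h3 := isometry_apply g (ι (x, 0)) ((g⁻¹).1 (ι (0, Pi.single j 1)))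
    rw [self_val_apply_inv] at h3
    have h4 := h1 (ι.symm (g.1 (ι (x, 0)))) (0, Pi.single j 1)
    have h5 := h1 (x, 0) (ι.symm ((g⁻¹).1 (ι (0, Pi.single j 1))))
    rw [LinearEquiv.apply_symm_apply] at h4 h5
    rw [hg] at h5
    rw [h3, h5] at h4
    simpa [negForm_apply, Pi.single_apply] using h4
  have f1 := fst_zero f hf
  have f2 := fst_zero f⁻¹ hf'
  let T := ι.trans (f.1.trans ι.symm)
  have hT : ∀ x, ι (T x) = f.1 (ι x) := fun x => ι.apply_symm_apply _
  obtain ⟨a, b, hab⟩ := exists_prod_equiv T (snd_zero f f2) f1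
    (snd_zero f⁻¹ (by rw [inv_inv]; exact f1)) f2
  have hform : ∀ x y : (Fin M.b2 → ℤ) × (Fin k → ℤ),
      M.form (a x.1) (a y.1) + negForm k (b x.2) (b y.2) =
        M.form x.1 y.1 + negForm k x.2 y.2 := by
    intro x y
    rw [← h1, ← isometry_apply f, ← hT, ← hT, h1, hab, hab]
  refine ⟨M, k, hk, ι, h1, ⟨a, fun x y => ?_⟩, ⟨b, fun x y => ?_⟩, fun x => ?_⟩
  · simpa using hform (x, 0) (y, 0)
  · simpa using hform (0, x) (0, y)
  · rw [← hT, hab]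

theorem IsReducible.conj {n : ℕ} {f : Mod n} (g : Mod n) (h : IsReducible (g * f * g⁻¹)) :
    IsReducible f := by
  obtain ⟨M, k, hk, ι, h1, a, b, hab⟩ := h
  refine ⟨M, k, hk, ι.trans (g⁻¹).1, fun x y => ?_, a, b, fun x => ?_⟩
  · rw [LinearEquiv.trans_apply, LinearEquiv.trans_apply, isometry_apply, h1]
  · have := congrArg (g⁻¹).1 (hab x)
    rw [mul_val_apply, mul_val_apply, inv_val_apply_self] at this
    exact this

/-! ### Fixed vectors of an irreducible class -/

/-- The sum of the first `p` iterates of `f` on `x`. -/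
def orbitSum {n : ℕ} (f : Mod n) (p : ℕ) (x : H2 n) : H2 n :=
  ∑ i ∈ Finset.range p, (f ^ i).1 x

theorem apply_orbitSum {n : ℕ} {f : Mod n} {p : ℕ} (hf : f ^ p = 1) (x : H2 n) :
    f.1 (orbitSum f p x) = orbitSum f p x := by
  have h1 := Finset.sum_range_succ (fun i => (f ^ i).1 x) p
  rw [Finset.sum_range_succ', hf, pow_zero] at h1
  rw [orbitSum, map_sum, ← add_right_cancel h1]
  exact Finset.sum_congr rfl fun i _ => by rw [pow_succ']; rfl

theorem pow_apply_of_fixed {n : ℕ} {f : Mod n} {v : H2 n} (hv : f.1 v = v) (i : ℕ) :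
    (f ^ i).1 v = v := by
  induction i with
  | zero => rfl
  | succ i ih => rw [pow_succ', mul_val_apply, ih, hv]

theorem intersectionForm_orbitSum {n : ℕ} {f : Mod n} {v : H2 n} (hv : f.1 v = v) (p : ℕ)
    (x : H2 n) : intersectionForm n (orbitSum f p x) v = p * intersectionForm n x v := by
  rw [orbitSum, map_sum, LinearMap.sum_apply, Finset.sum_congr rfl (g := fun _ =>
    intersectionForm n x v), Finset.sum_const, Finset.card_range, nsmul_eq_mul]
  intro i _
  conv_lhs => rw [← pow_apply_of_fixed hv i]
  exact isometry_apply _ _ _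

/-- The translates of `H` all lie in the upper cone, where any two vectors pair positively, so their
sum is again positive there. -/
theorem exists_fixed_pos {n : ℕ} {f : Mod n} (hf : f ∈ ModPlus n) {p : ℕ} (hp : 0 < p)
    (hfp : f ^ p = 1) : ∃ v, f.1 v = v ∧ 0 < intersectionForm n v v ∧ 0 < v 0 := by
  have hne : (Finset.range p).Nonempty := Finset.nonempty_range_iff.2 hp.ne'
  have hH : 0 < intersectionForm n (H n) (H n) := by rw [intersectionForm_H_H]; norm_num
  have h0 : ∀ i, 0 < ((f ^ i).1 (H n)) 0 := fun i =>
    pos_of_mem_ModPlus ((ModPlus n).pow_mem hf i) hH (by simp [H])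
  refine ⟨orbitSum f p (H n), apply_orbitSum hfp _, ?_, ?_⟩
  · simp only [orbitSum, map_sum, LinearMap.sum_apply]
    refine Finset.sum_pos (fun i _ => Finset.sum_pos (fun j _ => ?_) hne) hne
    exact intersectionForm_pos (by rwa [isometry_apply]) (h0 _)
      (by rw [isometry_apply]; exact hH.le)
      (h0 _)
  · rw [orbitSum, Finset.sum_apply]
    exact Finset.sum_pos (fun i _ => h0 i) hne

/-- If the product is nonzero, one of `x - y`, `x + y` has nonnegative norm in the negative definite
complement of `v`, and so vanishes. -/
theorem eq_zero_or_eq_or_eq_neg {n : ℕ} {v x y : H2 n} (hv : 0 < intersectionForm n v v)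
    (hx : intersectionForm n x x = -1) (hy : intersectionForm n y y = -1)
    (hxv : intersectionForm n x v = 0) (hyv : intersectionForm n y v = 0) :
    intersectionForm n x y = 0 ∨ x = y ∨ x = -y := by
  have hs : intersectionForm n (x - y) (x - y) = -2 - 2 * intersectionForm n x y := by
    simp only [map_sub, LinearMap.sub_apply, hx, hy, intersectionForm_comm y x]; ring
  have ha : intersectionForm n (x + y) (x + y) = -2 + 2 * intersectionForm n x y := by
    simp only [map_add, LinearMap.add_apply, hx, hy, intersectionForm_comm y x]; ring
  rcases lt_trichotomy (intersectionForm n x y) 0 with h | h | h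
  · refine Or.inr (Or.inl (sub_eq_zero.1 (eq_zero_of_orthogonal hv ?_ (by rw [hs]; omega))))
    rw [map_sub, LinearMap.sub_apply, hxv, hyv, sub_zero]
  · exact Or.inl h
  · refine Or.inr (Or.inr (add_eq_zero_iff_eq_neg.1
      (eq_zero_of_orthogonal hv ?_ (by rw [ha]; omega))))
    rw [map_add, LinearMap.add_apply, hxv, hyv, add_zero]

theorem inv_apply_of_fixed {n : ℕ} {f : Mod n} {v : H2 n} (hv : f.1 v = v) : (f⁻¹).1 v = v := by
  conv_lhs => rw [← hv]
  exact inv_val_apply_self f v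

/-- The set of all (-1)-vectors orthogonal to `v` is invariant under `f`, and its elements are
orthogonal up to sign and equality. -/
theorem isReducible_of_fixed_pos {n : ℕ} (hn : n ≤ 8) {f : Mod n} {v e : H2 n} (hfv : f.1 v = v)
    (hv : 0 < intersectionForm n v v) (he : intersectionForm n e e = -1)
    (hev : intersectionForm n e v = 0) : IsReducible f := by
  have key : ∀ g : Mod n, g.1 v = v → ∀ x,
      (intersectionForm n x x = -1 ∧ intersectionForm n x v = 0) →
      (intersectionForm n (g.1 x) (g.1 x) = -1 ∧ intersectionForm n (g.1 x) v = 0) := by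
    intro g hg x hx
    refine ⟨by rw [isometry_apply]; exact hx.1, ?_⟩
    rw [← hx.2]
    conv_lhs => rw [← hg]
    exact isometry_apply g x v
  exact isReducible_of_orthogonal hn f
    {x | intersectionForm n x x = -1 ∧ intersectionForm n x v = 0} ⟨e, he, hev⟩
    (fun x hx => hx.1) (fun x hx y hy => eq_zero_or_eq_or_eq_neg hv hx.1 hy.1 hx.2 hy.2)
    (key f hfv) (key f⁻¹ (inv_apply_of_fixed hfv))

theorem even_self_sub_anticanonical {n : ℕ} (x : H2 n) :
    Even (intersectionForm n x x - intersectionForm n x (anticanonical n)) := by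
  have h : intersectionForm n x x - intersectionForm n x (anticanonical n) =
      (x 0 * (x 0 + 1) - 2 * (2 * x 0)) - ∑ i : Fin n, x i.succ * (x i.succ + 1) := by
    rw [intersectionForm_self, intersectionForm_anticanonical]
    simp only [mul_add, mul_one, Finset.sum_add_distrib, sq]
    ring
  rw [h]
  refine ((Int.even_mul_succ_self _).sub (even_two_mul _)).sub ?_
  exact Finset.even_sum _ fun i _ => Int.even_mul_succ_self _

/-- `-K` is characteristic, and isometries preserve this property. Testing against `H` and the `Eᵢ`
turns it into oddness of the coordinates. -/
theorem odd_apply_anticanonical {n : ℕ} (f : Mod n) (i : Fin (n + 1)) :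
    Odd (f.1 (anticanonical n) i) := by
  have key : ∀ x, Even (intersectionForm n x x -
      intersectionForm n x (f.1 (anticanonical n))) := by
    intro x
    have := even_self_sub_anticanonical ((f⁻¹).1 x)
    rwa [isometry_apply, ← isometry_apply f ((f⁻¹).1 x), self_val_apply_inv] at this
  refine Fin.cases ?_ (fun i => ?_) i
  · have h := key (H n)
    rw [intersectionForm_H_H, intersectionForm_comm, intersectionForm_H] at h
    rw [Int.odd_iff]
    rw [Int.even_iff] at h
    omega
  · have h := key (E i)
    rw [E_self, intersectionForm_comm, intersectionForm_E] at h
    rw [Int.odd_iff]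
    rw [Int.even_iff] at h
    omega

/-- In the interior of the walls `Eᵢ` of the fundamental chamber, the anticanonical class is the
unique nearest among the characteristic vectors of norm `9 - n`. -/
theorem anticanonical_nearest {n : ℕ} (hn : 3 ≤ n) (hn8 : n ≤ 8) {v : H2 n}
    (h1 : ∀ i j l : Fin n, i ≠ j → i ≠ l → j ≠ l →
      0 ≤ intersectionForm n v (cremonaRoot i j l))
    (h2 : ∀ i : Fin n, 0 < intersectionForm n v (E i)) {k : H2 n} (hodd : ∀ i, Odd (k i))
    (hk : intersectionForm n k k = 9 - n) (hk0 : 0 < k 0) :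
    k = anticanonical n ∨ intersectionForm n (anticanonical n) v < intersectionForm n k v := by
  have hn' : (n : ℤ) ≤ 8 := by exact_mod_cast hn8
  have hpos : ∀ k : H2 n, intersectionForm n k k = 9 - n → 0 < k 0 →
      0 < intersectionForm n k (chamberPoint n) := fun k hk hk0 =>
    intersectionForm_pos (by linarith) hk0 (chamberPoint_pos hn8).le (by simp [chamberPoint])
  -- Reflect `k` towards the chamber, by induction on its pairing with the interior point. Each
  -- reflection is in a wall negative on `k` and nonnegative on `v`, so it never increases the
  -- pairing with `v`, and it lowers it strictly at a wall `Eᵢ`. The end point is `-K` by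
  -- `eq_anticanonical_of_chamber`.
  induction hN : (intersectionForm n k (chamberPoint n)).toNat using Nat.strong_induction_on
    generalizing k with
  | _ N ih =>
  have hN0 := hpos k hk hk0
  by_cases hE : ∃ i : Fin n, intersectionForm n k (E i) < 0
  · obtain ⟨i, hi⟩ := hE
    have hk' : intersectionForm n ((reflectionE i).1 k) ((reflectionE i).1 k) = 9 - n := by
      rw [isometry_apply, hk]
    have hk0' := pos_of_mem_ModPlus (reflectionE_mem_ModPlus i) (w := k) (by linarith) hk0
    have hp' := hpos _ hk' hk0'
    have e1 := reflectionE_apply i k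
    have e2 : intersectionForm n ((reflectionE i).1 k) (chamberPoint n) =
        intersectionForm n k (chamberPoint n) + 2 * intersectionForm n k (E i) := by
      rw [e1, map_add, map_smul, LinearMap.add_apply, LinearMap.smul_apply, E_chamberPoint]
      simp
    have e3 : intersectionForm n ((reflectionE i).1 k) v =
        intersectionForm n k v + 2 * intersectionForm n k (E i) * intersectionForm n v (E i) := by
      rw [e1, map_add, map_smul, LinearMap.add_apply, LinearMap.smul_apply,
        intersectionForm_comm v, smul_eq_mul]
    have hlt : intersectionForm n ((reflectionE i).1 k) v < intersectionForm n k v := by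
      rw [e3]
      nlinarith [h2 i]
    right
    have hodd' : ∀ m, Odd (((reflectionE i).1 k) m) := fun m => by
      rw [e1, Pi.add_apply, Pi.smul_apply, smul_eq_mul, mul_assoc]
      exact (hodd m).add_even (even_two_mul _)
    rcases ih _ (by omega) hodd' hk' hk0' rfl with h | h
    · rwa [h] at hlt
    · exact h.trans hlt
  by_cases hC : ∃ i j l : Fin n, i ≠ j ∧ i ≠ l ∧ j ≠ l ∧
      intersectionForm n k (cremonaRoot i j l) < 0
  · obtain ⟨i, j, l, hij, hil, hjl, hi⟩ := hC
    set s := reflectionCremona hij hil hjl with hs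
    have hk' : intersectionForm n (s.1 k) (s.1 k) = 9 - n := by
      rw [isometry_apply, hk]
    have hk0' := pos_of_mem_ModPlus (weylGroup_le_ModPlus hn8
      (reflectionCremona_mem_weylGroup hij hil hjl)) (w := k) (by linarith) hk0
    have hp' := hpos _ hk' hk0'
    have e1 := reflectionCremona_apply hij hil hjl k
    rw [← hs] at e1 hk0'
    have e2 : intersectionForm n (s.1 k) (chamberPoint n) =
        intersectionForm n k (chamberPoint n) + intersectionForm n k (cremonaRoot i j l) := by
      rw [e1, map_add, map_smul, LinearMap.add_apply, LinearMap.smul_apply,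
        cremonaRoot_chamberPoint]
      simp
    have e3 : intersectionForm n (s.1 k) v = intersectionForm n k v +
        intersectionForm n k (cremonaRoot i j l) * intersectionForm n v (cremonaRoot i j l) := by
      rw [e1, map_add, map_smul, LinearMap.add_apply, LinearMap.smul_apply,
        intersectionForm_comm v, smul_eq_mul]
    have hle : intersectionForm n (s.1 k) v ≤ intersectionForm n k v := by
      rw [e3]
      nlinarith [h1 i j l hij hil hjl]
    have hodd' : ∀ m, Odd ((s.1 k) m) := fun m => by
      rw [e1, Pi.add_apply, Pi.smul_apply, smul_eq_mul]
      refine (hodd m).add_even (Even.mul_right ?_ _)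
      rw [intersectionForm_cremonaRoot]
      exact (((hodd _).add_odd (hodd _)).add_odd (hodd _)).add_odd (hodd _)
    rcases ih _ (by omega) hodd' hk' hk0' rfl with h | h
    -- No pairing needs to drop at a Cremona wall, but such a reflection fixes `-K`, so reaching
    -- `-K` means having started there.
    · left
      have hinv : s.1 (anticanonical n) = anticanonical n := by
        rw [hs]
        exact (mem_weylGroup_iff _).1 (reflectionCremona_mem_weylGroup hij hil hjl)
      exact s.1.injective (h.trans hinv.symm)
    · exact Or.inr (h.trans_le hle)
  · push Not at hE hC
    exact Or.inl (eq_anticanonical_of_chamber hn hn8 hC hE hodd hk)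

/-- An irreducible class of finite order is conjugate into the Weyl group. -/
theorem exists_conj_mem_weylGroup {n : ℕ} (hn : 3 ≤ n) (hn8 : n ≤ 8) {f : Mod n}
    (hf : f ∈ ModPlus n) {p : ℕ} (hp : 0 < p) (hfp : f ^ p = 1) (hirr : IsIrreducible f) :
    ∃ g ∈ ModPlus n, (g * f * g⁻¹).1 (anticanonical n) = anticanonical n := by
  obtain ⟨v, hfv, hv, hv0⟩ := exists_fixed_pos hf hp hfp
  obtain ⟨g, hg, h1, h2⟩ := exists_ModPlus_chamber hn8 hv hv0
  refine ⟨g, hg, ?_⟩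
  have hfix : (g * f * g⁻¹).1 (g.1 v) = g.1 v := by
    rw [mul_val_apply, mul_val_apply, inv_val_apply_self, hfv]
  have h2' : ∀ i, 0 < intersectionForm n (g.1 v) (E i) := by
    intro i
    refine (h2 i).lt_of_ne fun h0 => hirr (IsReducible.conj g ?_)
    refine isReducible_of_fixed_pos hn8 hfix (by rwa [isometry_apply]) (E_self i) ?_
    rw [intersectionForm_comm, ← h0]
  have hmem : g * f * g⁻¹ ∈ ModPlus n :=
    (ModPlus n).mul_mem ((ModPlus n).mul_mem hg hf) ((ModPlus n).inv_mem hg)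
  have hself := intersectionForm_anticanonical_self n
  -- The image of `-K` is characteristic of the same norm and has the same pairing with the fixed
  -- vector, so uniqueness of the minimizer applies.
  refine (anticanonical_nearest hn hn8 h1 h2' (odd_apply_anticanonical _) ?_ ?_).resolve_right
    fun h => h.ne ?_
  · rw [isometry_apply, hself]
  · exact pos_of_mem_ModPlus hmem (by rw [hself]; omega) (by rw [anticanonical_zero]; norm_num)
  · conv_rhs => rw [← hfix]
    exact (isometry_apply _ _ _).symm

/-! ### Conic bundles -/

/-- Orthogonality to the isotropic class `H - Eᵢ` makes the coordinates at `H` and `Eᵢ` cancel in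
the norm. What remains is minus a sum of squares, so the form is negative semidefinite with radical
spanned by `H - Eᵢ`. -/
theorem fiber_orthogonal_negative {n : ℕ} {i : Fin n} {x : H2 n}
    (h : intersectionForm n x (H n - E i) = 0) (hx : 0 ≤ intersectionForm n x x) :
    x = x 0 • (H n - E i) := by
  rw [map_sub, intersectionForm_H, intersectionForm_E] at h
  have hi : x i.succ = -x 0 := by linarith
  rw [intersectionForm_self, ← Finset.add_sum_erase _ _ (Finset.mem_univ i), hi] at hx
  have h0 : ∑ j ∈ Finset.univ.erase i, x (Fin.succ j) ^ 2 = 0 :=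
    le_antisymm (by linarith) (Finset.sum_nonneg fun i _ => sq_nonneg _)
  rw [Finset.sum_eq_zero_iff_of_nonneg fun i _ => sq_nonneg _] at h0
  have hs0 : ∀ a : Fin n, (0 : Fin (n + 1)) ≠ a.succ := fun a => (Fin.succ_ne_zero a).symm
  funext j
  refine Fin.cases ?_ (fun j => ?_) j
  · simp [H, E, hs0]
  · by_cases hj : j = i
    · subst hj; simp [H, E, hi]
    · have := h0 j (by simp [hj])
      rw [pow_eq_zero_iff two_ne_zero] at this
      simp [H, E, hj, this]

/-- The order of `f ^ d` divides the odd number `p`, so `f ^ d` is a power of its own square. -/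
theorem eq_of_apply_sq_eq {n : ℕ} {f : Mod n} {p : ℕ} (hodd : Odd p) (hfp : f ^ p = 1) (d : ℕ)
    {y : H2 n} (h : (f ^ d).1 ((f ^ d).1 y) = y) : (f ^ d).1 y = y := by
  obtain ⟨m, rfl⟩ := hodd
  have h1 := pow_apply_of_fixed (f := f ^ d * f ^ d) h m
  have h2 : (f ^ d * f ^ d) ^ m * f ^ d = 1 := by
    rw [← pow_add, ← pow_mul, ← pow_add, show (d + d) * m + d = (2 * m + 1) * d by ring, pow_mul,
      hfp, one_pow]
  have h3 : (f ^ d) * (f ^ d * f ^ d) ^ m = 1 := by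
    rw [← h2]
    exact ((Commute.refl (f ^ d)).mul_right (Commute.refl _)).pow_right m |>.eq
  have := congrArg (fun g : Mod n => g.1 y) h3
  simp only [mul_val_apply, one_val_apply] at this
  rwa [h1] at this

/-- Let `F = H - Eᵢ`. For `j ≠ i` the class `Eⱼ` is a component of a singular fibre of the conic
bundle with fibre `F`, the other component being `F - Eⱼ`. An image of `Eⱼ` under a power of `f` is
equal to `Eⱼ`, orthogonal to it, or complementary to it. Odd order excludes the last possibility, so
the orbit of `Eⱼ` is an orthogonal invariant set. -/
theorem isReducible_of_fixed_fiber {n : ℕ} (hn : 3 ≤ n) (hn8 : n ≤ 8) {f : Mod n} {p : ℕ}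
    (hodd : Odd p) (hfp : f ^ p = 1) (hfk : f.1 (anticanonical n) = anticanonical n) {i : Fin n}
    (hfi : f.1 (H n - E i) = H n - E i) : IsReducible f := by
  obtain ⟨j, hj⟩ : ∃ j : Fin n, j ≠ i := by
    have : Nontrivial (Fin n) := Fin.nontrivial_iff_two_le.2 (by omega)
    exact exists_ne i
  set F := H n - E i with hF
  have hinv : f⁻¹ = f ^ (p - 1) := by
    rw [inv_eq_iff_mul_eq_one, ← pow_succ', Nat.sub_add_cancel hodd.pos, hfp]
  have hE : ∀ a, intersectionForm n ((f ^ a).1 (E j)) ((f ^ a).1 (E j)) = -1 := fun a => by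
    rw [isometry_apply, E_self]
  have hEF : ∀ a, intersectionForm n ((f ^ a).1 (E j)) F = 0 := by
    intro a
    conv_lhs => rw [← pow_apply_of_fixed hfi a]
    rw [isometry_apply, hF, map_sub, intersectionForm_comm, intersectionForm_H_E,
      intersectionForm_E_E, if_neg hj, sub_zero]
  have hEk : ∀ a, intersectionForm n ((f ^ a).1 (E j)) (anticanonical n) = 1 := by
    intro a
    conv_lhs => rw [← pow_apply_of_fixed hfk a]
    rw [isometry_apply, E_anticanonical]
  have hFk : intersectionForm n F (anticanonical n) = 2 := by
    rw [hF, map_sub, LinearMap.sub_apply, E_anticanonical, intersectionForm_comm,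
      intersectionForm_H, anticanonical_zero]
    norm_num
  have hFF : intersectionForm n F F = 0 := by
    rw [hF]
    simp [intersectionForm_H_H, intersectionForm_H_E, E_self, intersectionForm_comm _ (H n)]
  have key : ∀ a b, a ≤ b → (intersectionForm n ((f ^ a).1 (E j)) ((f ^ b).1 (E j)) = 0 ∨
      (f ^ a).1 (E j) = (f ^ b).1 (E j)) := by
    intro a b hab
    obtain ⟨d, rfl⟩ := Nat.exists_eq_add_of_le hab
    have hd : (f ^ (a + d)).1 (E j) = (f ^ a).1 ((f ^ d).1 (E j)) := by rw [pow_add]; rfl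
    rw [hd, isometry_apply, (f ^ a).1.injective.eq_iff]
    have e1 := hE d
    have e2 := E_self j
    have e3 := hEF d
    have e4 := hEF 0
    have e5 := hEk d
    have e6 := E_anticanonical j
    have hfd : (f ^ d).1 F = F := pow_apply_of_fixed hfi d
    rw [pow_zero, one_val_apply] at e4
    rcases lt_trichotomy (intersectionForm n (E j) ((f ^ d).1 (E j))) 0 with h | h | h
    · right
      have h1 := fiber_orthogonal_negative (i := i) (x := E j - (f ^ d).1 (E j))
        (by
          change intersectionForm n _ F = 0
          rw [LinearMap.map_sub₂, e3, e4, sub_zero])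
        (by
          simp only [map_sub, LinearMap.sub_apply, e1, e2,
            intersectionForm_comm ((f ^ d).1 (E j)) (E j)]
          omega)
      have h2 := congrArg (fun x => intersectionForm n x (anticanonical n)) h1
      simp only [← hF, map_smul, LinearMap.smul_apply, hFk] at h2
      rw [map_sub, LinearMap.sub_apply, e5, e6] at h2
      have h3 : (E j - (f ^ d).1 (E j)) 0 = 0 := by simpa using h2
      rw [h3, zero_smul] at h1
      exact sub_eq_zero.1 h1
    · exact Or.inl h
    · exfalso
      have h1 := fiber_orthogonal_negative (i := i) (x := E j + (f ^ d).1 (E j))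
        (by
          change intersectionForm n _ F = 0
          rw [LinearMap.map_add₂, e3, e4, add_zero])
        (by
          simp only [map_add, LinearMap.add_apply, e1, e2,
            intersectionForm_comm ((f ^ d).1 (E j)) (E j)]
          omega)
      have h2 := congrArg (fun x => intersectionForm n x (anticanonical n)) h1
      simp only [← hF, map_smul, LinearMap.smul_apply, hFk] at h2
      rw [map_add, LinearMap.add_apply, e5, e6, smul_eq_mul] at h2
      -- The multiple of `F` is found by pairing with `-K`: both `F` and the sum have degree two.
      have h3 : (E j + (f ^ d).1 (E j)) 0 = 1 := by omega
      rw [h3, one_smul, ← hF] at h1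
      have h4 : (f ^ d).1 (E j) = F - E j := by rw [← h1]; abel
      -- The involution `y ↦ F - y` would be realized on `Eⱼ` by `f ^ d`, so `f ^ (2d)` fixes `Eⱼ`;
      -- hence so does `f ^ d`, which contradicts `Q(F, Eⱼ) = 0`.
      have h5 := eq_of_apply_sq_eq hodd hfp d (y := E j) (by
        rw [h4, map_sub, hfd, h4]; abel)
      rw [h5] at h4
      have h6 : intersectionForm n (E j) (E j) = intersectionForm n (F - E j) (E j) := by
        rw [← h4]
      rw [map_sub, LinearMap.sub_apply, intersectionForm_comm F, e4, e2] at h6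
      norm_num at h6
  refine isReducible_of_orthogonal hn8 f (Set.range fun a : ℕ => (f ^ a).1 (E j)) ⟨_, 0, rfl⟩
    ?_ ?_ ?_ ?_
  · rintro _ ⟨a, rfl⟩
    exact hE a
  · rintro _ ⟨a, rfl⟩ _ ⟨b, rfl⟩
    rcases le_total a b with h | h
    · rcases key a b h with h | h
      · exact Or.inl h
      · exact Or.inr (Or.inl h)
    · rcases key b a h with h | h
      · exact Or.inl (by rwa [intersectionForm_comm])
      · exact Or.inr (Or.inl h.symm)
  · rintro _ ⟨a, rfl⟩
    exact ⟨a + 1, by simp only [pow_succ']; rfl⟩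
  · rintro _ ⟨a, rfl⟩
    exact ⟨p - 1 + a, by rw [hinv]; simp only [pow_add]; rfl⟩

/-- In the chamber the norm is nonnegative. If it is positive, `Eₘ` is a (-1)-vector orthogonal to a
positive fixed vector; if it is zero, `v` is a nonzero multiple of a conic class, which is then
fixed. -/
theorem isReducible_of_chamber {n : ℕ} (hn : 3 ≤ n) (hn8 : n ≤ 8) {f : Mod n} {p : ℕ}
    (hodd : Odd p) (hfp : f ^ p = 1) (hfk : f.1 (anticanonical n) = anticanonical n) {v : H2 n}
    (hfv : f.1 v = v) (hv : v ≠ 0)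
    (h1 : ∀ i j l : Fin n, i ≠ j → i ≠ l → j ≠ l →
      0 ≤ intersectionForm n v (cremonaRoot i j l))
    (h2 : ∀ i : Fin n, 0 ≤ intersectionForm n v (E i)) {m : Fin n}
    (hm : intersectionForm n v (E m) = 0) : IsReducible f := by
  obtain ⟨-, hvv, hiso⟩ := chamber_nonneg hn hn8 h1 h2
  rcases hvv.lt_or_eq with hpos | h0
  · exact isReducible_of_fixed_pos hn8 hfv hpos (E_self m) (by rwa [intersectionForm_comm])
  · obtain ⟨i, hi⟩ := hiso h0.symm
    refine isReducible_of_fixed_fiber hn hn8 hodd hfp hfk (i := i) ?_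
    have hv0 : v 0 ≠ 0 := by
      intro h
      rw [h, zero_smul] at hi
      exact hv hi
    rw [hi, map_smul] at hfv
    exact smul_right_injective _ hv0 hfv

/-- The fixed vectors of an irreducible class of odd order in the Weyl group are the multiples of
the anticanonical class. -/
theorem exists_eq_smul_of_fixed {n : ℕ} (hn : 3 ≤ n) (hn8 : n ≤ 8) {f : Mod n} {p : ℕ}
    (hodd : Odd p) (hfp : f ^ p = 1) (hfk : f.1 (anticanonical n) = anticanonical n)
    (hirr : IsIrreducible f) {w : H2 n} (hfw : f.1 w = w) : ∃ c : ℤ, w = c • anticanonical n := by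
  have hself := intersectionForm_anticanonical_self n
  set k := anticanonical n with hk
  -- Adding a large multiple of the positive vector `-K` brings `w` into the upper positive cone;
  -- the bound on `N` lets the quadratic term dominate.
  obtain ⟨N, hN0, hN1⟩ : ∃ N : ℤ, 0 < (w + N • k) 0 ∧
      0 < intersectionForm n (w + N • k) (w + N • k) := by
    refine ⟨|w 0| + |intersectionForm n w w| + 2 * |intersectionForm n w k| + 1, ?_, ?_⟩
    · simp only [Pi.add_apply, Pi.smul_apply, smul_eq_mul, hk, anticanonical_zero]
      linarith [neg_abs_le (w 0), abs_nonneg (w 0), abs_nonneg (intersectionForm n w w),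
        abs_nonneg (intersectionForm n w k)]
    · simp only [map_add, map_smul, LinearMap.add_apply, LinearMap.smul_apply, smul_eq_mul, hself,
        intersectionForm_comm k w]
      have e1 := neg_abs_le (intersectionForm n w w)
      have e2 := neg_abs_le (intersectionForm n w k)
      have e3 := abs_nonneg (intersectionForm n w w)
      have e4 := abs_nonneg (intersectionForm n w k)
      have e5 := abs_nonneg (w 0)
      have e6 : (1 : ℤ) ≤ 9 - n := by omega
      generalize |intersectionForm n w w| = A at *
      generalize |intersectionForm n w k| = B at *
      generalize |w 0| = C at *
      generalize intersectionForm n w w = a at *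
      generalize intersectionForm n w k = b at *
      have e7 : (C + A + 2 * B + 1) * (-B) ≤ (C + A + 2 * B + 1) * b :=
        mul_le_mul_of_nonneg_left e2 (by linarith)
      have e8 : (C + A + 2 * B + 1) * ((C + A + 2 * B + 1) * 1) ≤
          (C + A + 2 * B + 1) * ((C + A + 2 * B + 1) * (9 - n)) := by
        gcongr
      nlinarith [mul_nonneg e3 e4, mul_nonneg e5 e4, mul_nonneg e3 e5]
  obtain ⟨g, hg, h1⟩ := exists_weylGroup_chamber hn8 hN1 hN0
  have hgk : g.1 k = k := (mem_weylGroup_iff g).1 hg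
  set v := g.1 (w + N • k) with hv
  -- `-K` is orthogonal to the Cremona roots and has product one with every `Eᵢ`. Subtracting the
  -- least of the products with the `Eᵢ` times `-K` therefore keeps the vector in the chamber and
  -- puts it on the wall `Eₘ`.
  obtain ⟨m, -, hm⟩ := Finset.exists_min_image (Finset.univ : Finset (Fin n))
    (fun i => intersectionForm n v (E i)) ⟨⟨0, by omega⟩, Finset.mem_univ _⟩
  set b := intersectionForm n v (E m) with hb
  have hkE : ∀ i : Fin n, intersectionForm n k (E i) = 1 := fun i => by
    rw [intersectionForm_comm, hk, E_anticanonical]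
  have hkC : ∀ i j l : Fin n, intersectionForm n k (cremonaRoot i j l) = 0 := fun i j l => by
    rw [intersectionForm_comm, hk, cremonaRoot_anticanonical]
  have hv0 : v - b • k = 0 := by
    by_contra hne
    refine hirr (IsReducible.conj g (isReducible_of_chamber (v := v - b • k) (m := m) hn hn8 hodd
      (p := p) ?_ ?_ ?_ hne (fun i j l hij hil hjl => ?_) (fun i => ?_) ?_))
    · rw [conj_pow, hfp, mul_one, mul_inv_cancel]
    · rw [mul_val_apply, mul_val_apply, inv_apply_of_fixed hgk, hfk, hgk]
    · rw [map_sub, map_smul, mul_val_apply, mul_val_apply, hv, inv_val_apply_self, map_add, hfw,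
        map_smul, hfk, mul_val_apply, mul_val_apply, inv_apply_of_fixed hgk, hfk, hgk]
    · simp only [map_sub, map_smul, LinearMap.sub_apply, LinearMap.smul_apply, hkC, smul_zero,
        sub_zero]
      exact h1 i j l hij hil hjl
    · simp only [map_sub, map_smul, LinearMap.sub_apply, LinearMap.smul_apply, hkE, smul_eq_mul,
        mul_one]
      exact sub_nonneg.2 (hm i (Finset.mem_univ i))
    · simp only [map_sub, map_smul, LinearMap.sub_apply, LinearMap.smul_apply, hkE, smul_eq_mul,
        mul_one]
      exact sub_self _
  refine ⟨b - N, g.1.injective ?_⟩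
  rw [map_smul, hgk, sub_smul, ← sub_eq_zero.1 hv0, hv, map_add, map_smul, hgk]
  abel

/-- The orbit sums of an irreducible class of odd order in the Weyl group. -/
theorem orbitSum_eq {n : ℕ} (hn : 3 ≤ n) (hn8 : n ≤ 8) {f : Mod n} {p : ℕ}
    (hodd : Odd p) (hfp : f ^ p = 1) (hfk : f.1 (anticanonical n) = anticanonical n)
    (hirr : IsIrreducible f) : ∃ d : ℤ, d * (9 - n) = p ∧
      ∀ x, orbitSum f p x = (d * intersectionForm n x (anticanonical n)) • anticanonical n := by
  have key : ∀ x, ∃ c : ℤ, orbitSum f p x = c • anticanonical n ∧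
      c * (9 - n) = p * intersectionForm n x (anticanonical n) := by
    intro x
    obtain ⟨c, hc⟩ := exists_eq_smul_of_fixed hn hn8 hodd hfp hfk hirr (apply_orbitSum hfp x)
    refine ⟨c, hc, ?_⟩
    rw [← intersectionForm_orbitSum hfk, hc, map_smul, LinearMap.smul_apply,
      intersectionForm_anticanonical_self, smul_eq_mul]
  -- A class `Eᵢ` has degree one, so the coefficient of its orbit sum is `p / (9 - n)`; in
  -- particular `9 - n` divides `p`.
  obtain ⟨d, -, hd⟩ := key (E ⟨0, by omega⟩)
  rw [E_anticanonical, mul_one] at hd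
  refine ⟨d, hd, fun x => ?_⟩
  obtain ⟨c, hc, hc'⟩ := key x
  rw [hc]
  congr 1
  have hne : (9 - n : ℤ) ≠ 0 := by omega
  apply mul_right_cancel₀ hne
  rw [hc', ← hd]
  ring

/-! ### Conjugacy from adapted bases -/

theorem intersectionForm_sum_sum {n : ℕ} {ι : Type*} [Fintype ι] (u : ι → H2 n) (c d : ι → ℤ) :
    intersectionForm n (∑ i, c i • u i) (∑ j, d j • u j) =
      ∑ i, ∑ j, c i * (d j * intersectionForm n (u i) (u j)) := by
  simp only [map_sum, LinearMap.sum_apply, map_smul, LinearMap.smul_apply, smul_eq_mul]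
  rw [Finset.sum_comm]
  refine Finset.sum_congr rfl fun i _ => ?_
  rw [Finset.mul_sum]
  refine Finset.sum_congr rfl fun j _ => ?_
  ring

/-- A family with unimodular Gram matrix is a basis. -/
theorem exists_equiv_of_gram {n : ℕ} {u : Fin (n + 1) → H2 n}
    {G G' : Matrix (Fin (n + 1)) (Fin (n + 1)) ℤ} (hG : G * G' = 1)
    (hu : ∀ i j, intersectionForm n (u i) (u j) = G i j) :
    ∃ φ : (Fin (n + 1) → ℤ) ≃ₗ[ℤ] H2 n, ∀ c, φ c = ∑ i, c i • u i := by
  have h1 : Matrix.of u * gram n * (Matrix.of u).transpose = G := by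
    ext i j
    rw [← hu, intersectionForm, Matrix.toBilin'_apply', Matrix.mul_assoc, Matrix.mul_apply]
    rfl
  have h2 : IsUnit (Matrix.of u).det := by
    have h3 := congrArg Matrix.det hG
    rw [← h1, Matrix.det_mul, Matrix.det_mul, Matrix.det_mul, Matrix.det_one] at h3
    refine IsUnit.of_mul_eq_one ((gram n).det * (Matrix.of u).transpose.det * G'.det) ?_
    rw [← h3]
    ring
  have h4 : IsUnit (Matrix.of u).transpose.det := by rwa [Matrix.det_transpose]
  refine ⟨Matrix.toLinearEquiv' _ (Matrix.invertibleOfIsUnitDet _ h4), fun c => ?_⟩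
  change Matrix.mulVec (Matrix.of u).transpose c = _
  funext j
  simp [Matrix.mulVec, dotProduct, mul_comm]

/-- Two isometries with the same matrix on two bases with the same Gram matrix are conjugate. -/
theorem exists_conj_of_gram {n : ℕ} {f f' : Mod n} {u u' : Fin (n + 1) → H2 n}
    {G G' : Matrix (Fin (n + 1)) (Fin (n + 1)) ℤ} (hG : G * G' = 1)
    (hu : ∀ i j, intersectionForm n (u i) (u j) = G i j)
    (hu' : ∀ i j, intersectionForm n (u' i) (u' j) = G i j)
    (hk : ∃ c : Fin (n + 1) → ℤ, anticanonical n = ∑ i, c i • u i ∧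
      anticanonical n = ∑ i, c i • u' i)
    (hf : ∀ j, ∃ c : Fin (n + 1) → ℤ, f.1 (u j) = ∑ i, c i • u i ∧
      f'.1 (u' j) = ∑ i, c i • u' i) :
    ∃ g ∈ weylGroup n, g * f * g⁻¹ = f' := by
  obtain ⟨φ, hφ⟩ := exists_equiv_of_gram hG hu
  obtain ⟨φ', hφ'⟩ := exists_equiv_of_gram hG hu'
  let g : Mod n := ⟨φ.symm.trans φ', fun x y => by
    obtain ⟨c, rfl⟩ := φ.surjective x
    obtain ⟨d, rfl⟩ := φ.surjective y
    rw [LinearEquiv.trans_apply, LinearEquiv.trans_apply, LinearEquiv.symm_apply_apply,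
      LinearEquiv.symm_apply_apply, hφ, hφ, hφ', hφ', intersectionForm_sum_sum,
      intersectionForm_sum_sum]
    simp only [hu, hu']⟩
  have hg : ∀ c : Fin (n + 1) → ℤ, g.1 (∑ i, c i • u i) = ∑ i, c i • u' i := by
    intro c
    change φ' (φ.symm _) = _
    rw [← hφ, LinearEquiv.symm_apply_apply, hφ']
  have hgu : ∀ j, g.1 (u j) = u' j := by
    intro j
    have := hg (Pi.single j 1)
    simpa [Pi.single_apply] using this
  refine ⟨g, ?_, ?_⟩
  · rw [mem_weylGroup_iff]
    obtain ⟨c, h1, h2⟩ := hk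
    rw [h1, hg, ← h1, h2]
  · rw [mul_inv_eq_iff_eq_mul]
    refine mod_ext fun x => ?_
    obtain ⟨c, rfl⟩ := φ.surjective x
    rw [hφ, mul_val_apply, mul_val_apply, hg, map_sum, map_sum, map_sum]
    refine Finset.sum_congr rfl fun j _ => ?_
    obtain ⟨d, h1, h2⟩ := hf j
    rw [map_smul, map_smul, map_smul, h1, hg, h2]

/-! ### Roots -/

/-- The roots of `Wₙ`. -/
def IsRoot {n : ℕ} (r : H2 n) : Prop :=
  intersectionForm n r r = -2 ∧ intersectionForm n r (anticanonical n) = 0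

theorem IsRoot.neg {n : ℕ} {r : H2 n} (h : IsRoot r) : IsRoot (-r) := by
  simpa [IsRoot] using h

theorem intersectionForm_apply_anticanonical {n : ℕ} {f : Mod n}
    (hfk : f.1 (anticanonical n) = anticanonical n) (x : H2 n) :
    intersectionForm n (f.1 x) (anticanonical n) = intersectionForm n x (anticanonical n) := by
  conv_lhs => rw [← hfk]
  exact isometry_apply f x _

theorem IsRoot.apply {n : ℕ} {f : Mod n} (hfk : f.1 (anticanonical n) = anticanonical n) {r : H2 n}
    (h : IsRoot r) : IsRoot (f.1 r) :=
  ⟨by rw [isometry_apply, h.1], by rw [intersectionForm_apply_anticanonical hfk, h.2]⟩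

theorem IsRoot.add {n : ℕ} {r s : H2 n} (hr : IsRoot r) (hs : IsRoot s)
    (h : intersectionForm n r s = 1) : IsRoot (r + s) := by
  constructor
  · simp only [map_add, LinearMap.add_apply, hr.1, hs.1, intersectionForm_comm s r, h]
    norm_num
  · rw [LinearMap.map_add₂, hr.2, hs.2, add_zero]

theorem IsRoot.sub {n : ℕ} {r s : H2 n} (hr : IsRoot r) (hs : IsRoot s)
    (h : intersectionForm n r s = -1) : IsRoot (r - s) := by
  rw [sub_eq_add_neg]
  exact hr.add hs.neg (by rw [map_neg, h, neg_neg])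

theorem anticanonical_pos {n : ℕ} (hn : n ≤ 8) :
    0 < intersectionForm n (anticanonical n) (anticanonical n) := by
  rw [intersectionForm_anticanonical_self]
  omega

/-- Roots lie in the negative definite complement of `-K`, where `r - s` or `r + s` would have
nonnegative norm if the product were at most -2 or at least 2. -/
theorem IsRoot.pair {n : ℕ} (hn : n ≤ 8) {r s : H2 n} (hr : IsRoot r) (hs : IsRoot s) :
    r = s ∨ r = -s ∨ (-1 ≤ intersectionForm n r s ∧ intersectionForm n r s ≤ 1) := by
  have hd : intersectionForm n (r - s) (r - s) = -4 - 2 * intersectionForm n r s := by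
    simp only [map_sub, LinearMap.sub_apply, hr.1, hs.1, intersectionForm_comm s r]; ring
  have ha : intersectionForm n (r + s) (r + s) = -4 + 2 * intersectionForm n r s := by
    simp only [map_add, LinearMap.add_apply, hr.1, hs.1, intersectionForm_comm s r]; ring
  have hk := anticanonical_pos hn
  by_cases h1 : intersectionForm n r s ≤ -2
  · refine Or.inl (sub_eq_zero.1 (eq_zero_of_orthogonal hk ?_ (by rw [hd]; omega)))
    rw [LinearMap.map_sub₂, hr.2, hs.2, sub_zero]
  by_cases h2 : 2 ≤ intersectionForm n r s
  · refine Or.inr (Or.inl (add_eq_zero_iff_eq_neg.1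
      (eq_zero_of_orthogonal hk ?_ (by rw [ha]; omega))))
    rw [LinearMap.map_add₂, hr.2, hs.2, add_zero]
  · exact Or.inr (Or.inr (by omega))

theorem isRoot_E_sub_E {n : ℕ} {i j : Fin n} (h : i ≠ j) : IsRoot (E i - E j : H2 n) := by
  constructor
  · simp [intersectionForm_E_E, h, h.symm]
  · rw [LinearMap.map_sub₂, E_anticanonical, E_anticanonical, sub_self]

theorem isRoot_cremonaRoot {n : ℕ} {i j l : Fin n} (hij : i ≠ j) (hil : i ≠ l) (hjl : j ≠ l) :
    IsRoot (cremonaRoot i j l) :=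
  ⟨cremonaRoot_self hij hil hjl, cremonaRoot_anticanonical i j l⟩

/-- The root lattice of `E₈` is generated by roots and unimodular. -/
theorem exists_smul_of_forall_root_dvd {x : H2 8} (hx : intersectionForm 8 x (anticanonical 8) = 0)
    {m : ℤ} (h : ∀ r : H2 8, IsRoot r → m ∣ intersectionForm 8 r x) : ∃ y, x = m • y := by
  have h1 : ∀ j : Fin 8, m ∣ x j.succ - x (Fin.succ 0) := by
    intro j
    by_cases hj : j = 0
    · subst hj; simp
    · have := h _ (isRoot_E_sub_E (i := 0) (j := j) (Ne.symm hj))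
      rw [intersectionForm_comm, map_sub, intersectionForm_E, intersectionForm_E] at this
      convert this using 1
      ring
  have h2 := h _ (isRoot_cremonaRoot (n := 8) (i := 0) (j := 1) (l := 2) (by decide) (by decide)
    (by decide))
  rw [intersectionForm_comm, intersectionForm_cremonaRoot] at h2
  rw [intersectionForm_anticanonical] at hx
  choose c hc using h1
  obtain ⟨d, hd⟩ := h2
  have hc' : ∀ j : Fin 8, x j.succ = x (Fin.succ 0) + m * c j := fun j => by
    rw [← hc]; ring
  rw [Finset.sum_congr rfl fun j _ => hc' j] at hx
  have hx0 : x 0 = -3 * x (Fin.succ 0) + m * (d - c 0 - c 1 - c 2) := by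
    have e1 := hc' 0
    have e2 := hc' 1
    have e3 := hc' 2
    linear_combination hd - e1 - e2 - e3
  rw [Finset.sum_add_distrib, ← Finset.mul_sum, hx0] at hx
  simp only [Finset.sum_const, Finset.card_univ, Fintype.card_fin, nsmul_eq_mul] at hx
  -- Modulo `m` all `E`-coordinates equal one value `t` and `x₀ = -3t`. Degree zero then reads `-9t
  -- + 8t = 0`.
  have h0 : m ∣ x (Fin.succ 0) :=
    ⟨3 * (d - c 0 - c 1 - c 2) + ∑ i, c i, by
      push_cast at hx
      change x 1 = _
      change 3 * (-3 * x 1 + m * (d - c 0 - c 1 - c 2)) + (8 * x 1 + m * ∑ i, c i) = 0 at hx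
      linarith⟩
  have hall : ∀ i, m ∣ x i := by
    intro i
    refine Fin.cases ?_ (fun i => ?_) i
    · rw [hx0]
      exact (h0.mul_left _).add (dvd_mul_right _ _)
    · rw [hc']
      exact h0.add (dvd_mul_right _ _)
  choose y hy using hall
  exact ⟨y, funext hy⟩

/-! ### Fixed-point-free automorphisms of order three of the root lattice -/

/-- `f` fixes the anticanonical class and acts on its orthogonal complement as a primitive cube root
of unity. -/
structure IsCubic {n : ℕ} (f : Mod n) : Prop where
  fixes : f.1 (anticanonical n) = anticanonical n
  cube : ∀ x, f.1 (f.1 (f.1 x)) = x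
  sum : ∀ x, intersectionForm n x (anticanonical n) = 0 → x + f.1 x + f.1 (f.1 x) = 0

/-- The reduction modulo `1 - f` of the Hermitian form attached to `f`. -/
def cubicPairing {n : ℕ} (f : Mod n) (x y : H2 n) : ZMod 3 :=
  ((intersectionForm n x y - intersectionForm n x (f.1 y) : ℤ) : ZMod 3)

/-- `s` lies in the orbit of `r` under the group generated by `f` and `-1`. -/
def SameHexagon {n : ℕ} (f : Mod n) (r s : H2 n) : Prop :=
  ∃ i : ℕ, s = (f ^ i).1 r ∨ s = -(f ^ i).1 r

/-- The orbits of `r` and `s` under `f` are orthogonal. -/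
def OrthogonalOrbits {n : ℕ} (f : Mod n) (r s : H2 n) : Prop :=
  ∀ a b : ℕ, intersectionForm n ((f ^ a).1 r) ((f ^ b).1 s) = 0

theorem OrthogonalOrbits.symm {n : ℕ} {f : Mod n} {r s : H2 n} (h : OrthogonalOrbits f r s) :
    OrthogonalOrbits f s r := fun a b => by rw [intersectionForm_comm, h]

theorem OrthogonalOrbits.right {n : ℕ} {f : Mod n} {r s s' : H2 n} (h : OrthogonalOrbits f r s)
    (hs : SameHexagon f s s') : OrthogonalOrbits f r s' := by
  intro a b
  obtain ⟨i, rfl | rfl⟩ := hs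
  · rw [← mul_val_apply, ← pow_add, h]
  · rw [map_neg, map_neg, ← mul_val_apply, ← pow_add, h, neg_zero]

namespace IsCubic

variable {n : ℕ} {f : Mod n}

theorem pow_three (hf : IsCubic f) : f ^ 3 = 1 := mod_ext hf.cube

theorem pow_anticanonical (hf : IsCubic f) (i : ℕ) :
    (f ^ i).1 (anticanonical n) = anticanonical n := pow_apply_of_fixed hf.fixes i

theorem apply_apply (hf : IsCubic f) {x : H2 n}
    (hx : intersectionForm n x (anticanonical n) = 0) : f.1 (f.1 x) = -x - f.1 x := by
  rw [← sub_eq_zero, ← hf.sum x hx]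
  abel

theorem form_apply_left (hf : IsCubic f) (x : H2 n) {y : H2 n}
    (hy : intersectionForm n y (anticanonical n) = 0) :
    intersectionForm n (f.1 x) y = -intersectionForm n x y - intersectionForm n x (f.1 y) := by
  rw [← isometry_apply f, ← isometry_apply f, hf.cube, hf.apply_apply hy, map_sub, map_neg]

theorem pairing_add_left (x x' y : H2 n) :
    cubicPairing f (x + x') y = cubicPairing f x y + cubicPairing f x' y := by
  simp only [cubicPairing, LinearMap.map_add₂]
  push_cast
  ring

theorem pairing_smul_left (c : ℤ) (x y : H2 n) :
    cubicPairing f (c • x) y = c * cubicPairing f x y := by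
  simp only [cubicPairing, map_smul, LinearMap.smul_apply, smul_eq_mul]
  push_cast
  ring

theorem pairing_neg_left (x y : H2 n) : cubicPairing f (-x) y = -cubicPairing f x y := by
  have := pairing_smul_left (f := f) (-1) x y
  simpa using this

theorem pairing_apply_left (hf : IsCubic f) (x : H2 n) {y : H2 n}
    (hy : intersectionForm n y (anticanonical n) = 0) :
    cubicPairing f (f.1 x) y = cubicPairing f x y := by
  have h3 : (3 : ZMod 3) = 0 := rfl
  simp only [cubicPairing, isometry_apply, hf.form_apply_left x hy]
  push_cast
  linear_combination (-(intersectionForm n x y : ZMod 3)) * h3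

theorem pairing_pow_left (hf : IsCubic f) (i : ℕ) (x : H2 n) {y : H2 n}
    (hy : intersectionForm n y (anticanonical n) = 0) :
    cubicPairing f ((f ^ i).1 x) y = cubicPairing f x y := by
  induction i with
  | zero => rfl
  | succ i ih => rw [pow_succ', mul_val_apply, hf.pairing_apply_left _ hy, ih]

/-- Since `f² = -1 - f` on the complement of `K`, exchanging the arguments changes the pairing only
by a sign and a multiple of three. With `pairing_apply_left` and `pairing_self` on roots, symplectic
linear algebra over `𝔽₃` becomes available. -/
theorem pairing_antisymm (hf : IsCubic f) (x : H2 n) {y : H2 n}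
    (hy : intersectionForm n y (anticanonical n) = 0) :
    cubicPairing f x y = -cubicPairing f y x := by
  have h3 : (3 : ZMod 3) = 0 := rfl
  have h1 : intersectionForm n y (f.1 x) =
      -intersectionForm n x y - intersectionForm n x (f.1 y) := by
    rw [intersectionForm_comm, hf.form_apply_left x hy]
  simp only [cubicPairing, h1, intersectionForm_comm y x]
  push_cast
  linear_combination (intersectionForm n x y : ZMod 3) * h3

theorem pairing_move_left (hf : IsCubic f) (s r : H2 n) (c : ℤ) (i : ℕ) {y : H2 n}
    (hy : intersectionForm n y (anticanonical n) = 0) :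
    cubicPairing f (s + c • (f ^ i).1 r) y = cubicPairing f s y + c * cubicPairing f r y := by
  rw [pairing_add_left, pairing_smul_left, hf.pairing_pow_left i r hy]

theorem pairing_zero_iff (x y : H2 n) : cubicPairing f x y = 0 ↔
    3 ∣ intersectionForm n x y - intersectionForm n x (f.1 y) := by
  rw [cubicPairing, ZMod.intCast_zmod_eq_zero_iff_dvd]
  rfl

theorem root_apply (hf : IsCubic f) {r : H2 n} (hr : IsRoot r) :
    intersectionForm n r (f.1 r) = 1 := by
  have h := hf.form_apply_left r hr.2
  rw [intersectionForm_comm, hr.1] at h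
  linarith

theorem pairing_self (hf : IsCubic f) {r : H2 n} (hr : IsRoot r) : cubicPairing f r r = 0 := by
  rw [pairing_zero_iff, hr.1, hf.root_apply hr]
  norm_num

theorem isRoot_pow (hf : IsCubic f) {r : H2 n} (hr : IsRoot r) (i : ℕ) : IsRoot ((f ^ i).1 r) :=
  hr.apply (hf.pow_anticanonical i)

theorem isRoot_of_sameHexagon (hf : IsCubic f) {r s : H2 n} (hr : IsRoot r)
    (h : SameHexagon f r s) : IsRoot s := by
  obtain ⟨i, rfl | rfl⟩ := h
  · exact hf.isRoot_pow hr i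
  · exact (hf.isRoot_pow hr i).neg

theorem pairing_of_sameHexagon (hf : IsCubic f) {r s y : H2 n} (h : SameHexagon f r s)
    (hy : intersectionForm n y (anticanonical n) = 0) :
    cubicPairing f s y = 0 ↔ cubicPairing f r y = 0 := by
  obtain ⟨i, rfl | rfl⟩ := h
  · rw [hf.pairing_pow_left i r hy]
  · rw [pairing_neg_left, hf.pairing_pow_left i r hy, neg_eq_zero]

theorem pairing_comm_eq_zero (hf : IsCubic f) {x y : H2 n}
    (hy : intersectionForm n y (anticanonical n) = 0) :
    cubicPairing f x y = 0 ↔ cubicPairing f y x = 0 := by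
  rw [hf.pairing_antisymm x hy, neg_eq_zero]

/-- The products with the iterates of `s` satisfy the recurrence given by `f² = -1 - f`, so two
consecutive zeros propagate. -/
theorem orthogonalOrbits_of_eq_zero (hf : IsCubic f) {r s : H2 n}
    (hs : intersectionForm n s (anticanonical n) = 0)
    (h0 : intersectionForm n r s = 0) (h1 : intersectionForm n r (f.1 s) = 0) :
    OrthogonalOrbits f r s := by
  have key : ∀ b, intersectionForm n r ((f ^ b).1 s) = 0 ∧
      intersectionForm n r ((f ^ (b + 1)).1 s) = 0 := by
    intro b
    induction b with
    | zero => exact ⟨h0, h1⟩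
    | succ b ih =>
      refine ⟨ih.2, ?_⟩
      have hb : intersectionForm n ((f ^ b).1 s) (anticanonical n) = 0 := by
        rw [intersectionForm_apply_anticanonical (hf.pow_anticanonical b), hs]
      have e : (f ^ (b + 1 + 1)).1 s = -(f ^ b).1 s - (f ^ (b + 1)).1 s := by
        rw [pow_succ', pow_succ', mul_val_apply, mul_val_apply, hf.apply_apply hb]
      rw [e, map_sub, map_neg, ih.1, ih.2]
      norm_num
  intro a b
  have e : (f ^ b).1 s = (f ^ a).1 ((f ^ (2 * a + b)).1 s) := by
    rw [← mul_val_apply, ← pow_add, show a + (2 * a + b) = 3 * a + b by ring, pow_add, pow_mul,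
      hf.pow_three, one_pow, one_mul]
  rw [e, isometry_apply]
  exact (key _).1

theorem sameHexagon_or_bounds (hf : IsCubic f) (hn : n ≤ 8) {r s : H2 n} (hr : IsRoot r)
    (hs : IsRoot s) : SameHexagon f r s ∨
      (-1 ≤ intersectionForm n s r ∧ intersectionForm n s r ≤ 1 ∧
      -1 ≤ intersectionForm n s (f.1 r) ∧ intersectionForm n s (f.1 r) ≤ 1 ∧
      -1 ≤ intersectionForm n s (f.1 (f.1 r)) ∧ intersectionForm n s (f.1 (f.1 r)) ≤ 1) := by
  rcases hs.pair hn hr with h | h | h0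
  · exact Or.inl ⟨0, Or.inl h⟩
  · exact Or.inl ⟨0, Or.inr h⟩
  rcases hs.pair hn (hr.apply hf.fixes) with h | h | h1
  · exact Or.inl ⟨1, Or.inl h⟩
  · exact Or.inl ⟨1, Or.inr h⟩
  rcases hs.pair hn ((hr.apply hf.fixes).apply hf.fixes) with h | h | h2
  · exact Or.inl ⟨2, Or.inl h⟩
  · exact Or.inl ⟨2, Or.inr h⟩
  exact Or.inr ⟨h0.1, h0.2, h1.1, h1.2, h2.1, h2.2⟩

theorem form_apply_apply (hf : IsCubic f) (s : H2 n) {r : H2 n} (hr : IsRoot r) :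
    intersectionForm n s (f.1 (f.1 r)) =
      -intersectionForm n s r - intersectionForm n s (f.1 r) := by
  rw [hf.apply_apply hr.2, map_sub, map_neg]

/-- For distinct hexagons the products of `s` with the orbit of `r` are `a`, `b`, `-a - b`, all in
`{-1, 0, 1}`. Vanishing of the pairing means `a ≡ b` modulo three, which forces `a = b = 0`. -/
theorem sameHexagon_or_orthogonal (hf : IsCubic f) (hn : n ≤ 8) {r s : H2 n} (hr : IsRoot r)
    (hs : IsRoot s) (h : cubicPairing f s r = 0) :
    SameHexagon f r s ∨ OrthogonalOrbits f s r := by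
  rcases hf.sameHexagon_or_bounds hn hr hs with h1 | h1
  · exact Or.inl h1
  · rw [hf.form_apply_apply s hr] at h1
    rw [pairing_zero_iff] at h
    refine Or.inr (hf.orthogonalOrbits_of_eq_zero hr.2 ?_ ?_) <;> omega

theorem bounds_of_pairing_ne_zero (hf : IsCubic f) (hn : n ≤ 8) {r s : H2 n} (hr : IsRoot r)
    (hs : IsRoot s) (h : cubicPairing f s r ≠ 0) :
    (intersectionForm n s r = 1 ∧ intersectionForm n s (f.1 r) = -1) ∨
    (intersectionForm n s r = 0 ∧ intersectionForm n s (f.1 r) = 1) ∨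
    (intersectionForm n s r = -1 ∧ intersectionForm n s (f.1 r) = 0) ∨
    (intersectionForm n s r = -1 ∧ intersectionForm n s (f.1 r) = 1) ∨
    (intersectionForm n s r = 0 ∧ intersectionForm n s (f.1 r) = -1) ∨
    (intersectionForm n s r = 1 ∧ intersectionForm n s (f.1 r) = 0) := by
  rcases hf.sameHexagon_or_bounds hn hr hs with h1 | h1
  · exact absurd ((hf.pairing_of_sameHexagon h1 hr.2).2 (hf.pairing_self hr)) h
  · rw [hf.form_apply_apply s hr] at h1
    rw [Ne, pairing_zero_iff] at h
    omega

/-- Two roots whose orbits are not orthogonal differ by a root, up to the action of `f`. -/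
theorem exists_isRoot_add (hf : IsCubic f) (hn : n ≤ 8) {r s : H2 n} (hr : IsRoot r)
    (hs : IsRoot s) (h : cubicPairing f s r ≠ 0) {c : ℤ} (hc : c = 1 ∨ c = -1) :
    ∃ i : ℕ, IsRoot (s + c • (f ^ i).1 r) := by
  have h2 := hf.form_apply_apply s hr
  have key : ∃ i : ℕ, intersectionForm n s ((f ^ i).1 r) = c := by
    have : intersectionForm n s r = c ∨ intersectionForm n s (f.1 r) = c ∨
        intersectionForm n s (f.1 (f.1 r)) = c := by
      have := hf.bounds_of_pairing_ne_zero hn hr hs h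
      omega
    rcases this with h | h | h
    · exact ⟨0, h⟩
    · exact ⟨1, h⟩
    · exact ⟨2, h⟩
  obtain ⟨i, hi⟩ := key
  refine ⟨i, ?_⟩
  rcases hc with rfl | rfl
  · rw [one_smul]
    exact hs.add (hf.isRoot_pow hr i) hi
  · rw [neg_one_smul, ← sub_eq_add_neg]
    exact hs.sub (hf.isRoot_pow hr i) hi

/-- A nonzero pairing means that the three products are `1, -1, 0` in some order. The six powers
`±fⁱ` permute these six patterns transitively. -/
theorem exists_normalized (hf : IsCubic f) (hn : n ≤ 8) {r s : H2 n} (hr : IsRoot r)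
    (hs : IsRoot s) (h : cubicPairing f s r ≠ 0) :
    ∃ s', SameHexagon f s s' ∧ intersectionForm n s' r = 1 ∧
      intersectionForm n s' (f.1 r) = -1 := by
  have e1 := hf.form_apply_left s hr.2
  have e2 := hf.form_apply_left (f.1 s) hr.2
  rw [isometry_apply] at e2
  have e3 : intersectionForm n (f.1 (f.1 s)) (f.1 r) = intersectionForm n (f.1 s) r :=
    isometry_apply f _ _
  have e4 : intersectionForm n (f.1 s) (f.1 r) = intersectionForm n s r := isometry_apply f _ _
  rcases hf.bounds_of_pairing_ne_zero hn hr hs h with h | h | h | h | h | h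
  · exact ⟨s, ⟨0, Or.inl rfl⟩, h⟩
  · exact ⟨f.1 (f.1 s), ⟨2, Or.inl rfl⟩, by omega, by omega⟩
  · exact ⟨f.1 s, ⟨1, Or.inl rfl⟩, by omega, by omega⟩
  · exact ⟨-s, ⟨0, Or.inr rfl⟩, by simp [h], by simp [h]⟩
  · exact ⟨-f.1 (f.1 s), ⟨2, Or.inr rfl⟩, by
      simp only [map_neg, LinearMap.neg_apply]; omega, by
      simp only [map_neg, LinearMap.neg_apply]; omega⟩
  · exact ⟨-f.1 s, ⟨1, Or.inr rfl⟩, by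
      simp only [map_neg, LinearMap.neg_apply]; omega, by
      simp only [map_neg, LinearMap.neg_apply]; omega⟩

end IsCubic

/-! ### Chains of roots for the pairing modulo three -/

namespace IsCubic

/-- Roots `r₁, r₂, r₃, r₄` for which only consecutive ones pair nontrivially. -/
structure IsChain {n : ℕ} (f : Mod n) (r₁ r₂ r₃ r₄ : H2 n) : Prop where
  root₁ : IsRoot r₁
  root₂ : IsRoot r₂
  root₃ : IsRoot r₃
  root₄ : IsRoot r₄
  pair₁₂ : cubicPairing f r₁ r₂ ≠ 0
  pair₂₃ : cubicPairing f r₂ r₃ ≠ 0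
  pair₃₄ : cubicPairing f r₃ r₄ ≠ 0
  pair₁₃ : cubicPairing f r₁ r₃ = 0
  pair₁₄ : cubicPairing f r₁ r₄ = 0
  pair₂₄ : cubicPairing f r₂ r₄ = 0

theorem exists_sign_add_eq_zero : ∀ a b : ZMod 3, a ≠ 0 → b ≠ 0 →
    a + ((1 : ℤ) : ZMod 3) * b = 0 ∨ a + ((-1 : ℤ) : ZMod 3) * b = 0 := by decide

variable {n : ℕ} {f : Mod n}

theorem pairing_add_right (x y y' : H2 n) :
    cubicPairing f x (y + y') = cubicPairing f x y + cubicPairing f x y' := by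
  simp only [cubicPairing, map_add]
  push_cast
  ring

theorem pairing_neg_right (x y : H2 n) : cubicPairing f x (-y) = -cubicPairing f x y := by
  simp only [cubicPairing, map_neg]
  push_cast
  ring

theorem pairing_move_right (hf : IsCubic f) {s r : H2 n} (hs : IsRoot s) (hr : IsRoot r) (c : ℤ)
    (i : ℕ) {y : H2 n} (hy : intersectionForm n y (anticanonical n) = 0) :
    cubicPairing f y (s + c • (f ^ i).1 r) = cubicPairing f y s + c * cubicPairing f y r := by
  have h : intersectionForm n (s + c • (f ^ i).1 r) (anticanonical n) = 0 := by
    rw [LinearMap.map_add₂, map_smul, LinearMap.smul_apply, (hf.isRoot_pow hr i).2, hs.2]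
    simp
  rw [hf.pairing_antisymm y h, hf.pairing_move_left s r c i hy, hf.pairing_antisymm y hs.2,
    hf.pairing_antisymm y hr.2]
  ring

/-- Two roots with a common neighbour can be decoupled from a third one. -/
theorem exists_decoupled (hf : IsCubic f) (hn : n ≤ 8) {r s t : H2 n} (hr : IsRoot r)
    (hs : IsRoot s) (ht : IsRoot t) (hrs : cubicPairing f s r ≠ 0) (hrt : cubicPairing f r t ≠ 0) :
    ∃ s', IsRoot s' ∧ cubicPairing f s' t = 0 ∧ ∃ (c : ℤ) (i : ℕ), s' = s + c • (f ^ i).1 r := by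
  by_cases h0 : cubicPairing f s t = 0
  · exact ⟨s, hs, h0, 0, 0, by simp⟩
  · rcases exists_sign_add_eq_zero _ _ h0 hrt with h | h
    · obtain ⟨i, hi⟩ := hf.exists_isRoot_add hn hr hs hrs (c := 1) (Or.inl rfl)
      exact ⟨_, hi, by rw [hf.pairing_move_left s r _ i ht.2, h], 1, i, rfl⟩
    · obtain ⟨i, hi⟩ := hf.exists_isRoot_add hn hr hs hrs (c := -1) (Or.inr rfl)
      exact ⟨_, hi, by rw [hf.pairing_move_left s r _ i ht.2, h], -1, i, rfl⟩

/-- The chain is `r₁, r₂', r₃, t`, where `r₂'` is `r₂` altered by a multiple of an iterate of `r₃`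
so as to become orthogonal to `t`. The pairings of `r₂` with `r₁` and `r₃` do not change. -/
theorem exists_chain_of_first_orthogonal (hf : IsCubic f) (hn : n ≤ 8) {r₁ r₂ r₃ t : H2 n}
    (h₁ : IsRoot r₁) (h₂ : IsRoot r₂) (h₃ : IsRoot r₃) (ht : IsRoot t)
    (h₁₂ : cubicPairing f r₁ r₂ ≠ 0) (h₂₃ : cubicPairing f r₂ r₃ ≠ 0)
    (h₁₃ : cubicPairing f r₁ r₃ = 0) (h₁t : cubicPairing f r₁ t = 0)
    (h₃t : cubicPairing f r₃ t ≠ 0) : ∃ a b c d, IsChain f a b c d := by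
  obtain ⟨r₂', hroot, h0, c, i, rfl⟩ := hf.exists_decoupled hn h₃ h₂ ht h₂₃ h₃t
  refine ⟨r₁, _, r₃, t, h₁, hroot, h₃, ht, ?_, ?_, h₃t, h₁₃, h₁t, h0⟩
  · rw [hf.pairing_move_right h₂ h₃ c i h₁.2, h₁₃, mul_zero, add_zero]
    exact h₁₂
  · rw [hf.pairing_move_left _ _ c i h₃.2, hf.pairing_self h₃, mul_zero, add_zero]
    exact h₂₃

/-- With this normalization `r₁ + r₃` spans the radical of the pairing on the three-chain, and `t`
pairs nontrivially with it. Adding iterates of `r₁` and `r₂` to `t` preserves that property and can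
be used to make `t` orthogonal to one end, after which the previous lemma applies from either side.
-/
theorem exists_chain_of_ends (hf : IsCubic f) (hn : n ≤ 8) {r₁ r₂ r₃ t : H2 n}
    (h₁ : IsRoot r₁) (h₂ : IsRoot r₂) (h₃ : IsRoot r₃) (ht : IsRoot t)
    (h₁₂ : cubicPairing f r₁ r₂ = 1) (h₂₃ : cubicPairing f r₂ r₃ = 1)
    (h₁₃ : cubicPairing f r₁ r₃ = 0)
    (hrad : cubicPairing f r₁ t + cubicPairing f r₃ t ≠ 0) : ∃ a b c d, IsChain f a b c d := by
  have h₃₂ : cubicPairing f r₃ r₂ = -1 := by rw [hf.pairing_antisymm r₃ h₂.2, h₂₃]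
  have h₃₁ : cubicPairing f r₃ r₁ = 0 := by rw [hf.pairing_antisymm r₃ h₁.2, h₁₃, neg_zero]
  have h₂₁ : cubicPairing f r₂ r₁ = -1 := by rw [hf.pairing_antisymm r₂ h₁.2, h₁₂]
  have n10 : (1 : ZMod 3) ≠ 0 := by decide
  have n20 : (-1 : ZMod 3) ≠ 0 := by decide
  have hone : ∀ t, IsRoot t → cubicPairing f r₁ t + cubicPairing f r₃ t ≠ 0 →
      (cubicPairing f r₁ t = 0 ∨ cubicPairing f r₃ t = 0) → ∃ a b c d, IsChain f a b c d := by
    rintro t ht hr (h | h)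
    · refine hf.exists_chain_of_first_orthogonal hn h₁ h₂ h₃ ht (by rw [h₁₂]; exact n10)
        (by rw [h₂₃]; exact n10) h₁₃ h ?_
      rwa [h, zero_add] at hr
    · refine hf.exists_chain_of_first_orthogonal hn h₃ h₂ h₁ ht (by rw [h₃₂]; exact n20)
        (by rw [h₂₁]; exact n20) h₃₁ h ?_
      rwa [h, add_zero] at hr
  -- If `t` is linked to `r₂`, adding plus or minus an iterate of `r₂` shifts the pairing of `r₁`
  -- with `t` by `±1`, so it can be made zero.
  have htwo : ∀ t, IsRoot t → cubicPairing f r₁ t + cubicPairing f r₃ t ≠ 0 →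
      cubicPairing f r₂ t ≠ 0 → ∃ a b c d, IsChain f a b c d := by
    intro t ht hr h2
    by_cases h : cubicPairing f r₁ t = 0 ∨ cubicPairing f r₃ t = 0
    · exact hone t ht hr h
    push Not at h
    have h2' : cubicPairing f t r₂ ≠ 0 := by
      rwa [Ne, hf.pairing_comm_eq_zero h₂.2]
    rcases exists_sign_add_eq_zero _ 1 h.1 n10 with h4 | h4
    · obtain ⟨i, hi⟩ := hf.exists_isRoot_add hn h₂ ht h2' (c := 1) (Or.inl rfl)
      refine hone _ hi ?_ (Or.inl ?_) <;> simp only [hf.pairing_move_right ht h₂ _ i h₁.2, h₁₂,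
        hf.pairing_move_right ht h₂ _ i h₃.2, h₃₂]
      · convert hr using 1
        ring
      · exact h4
    · obtain ⟨i, hi⟩ := hf.exists_isRoot_add hn h₂ ht h2' (c := -1) (Or.inr rfl)
      refine hone _ hi ?_ (Or.inl ?_) <;> simp only [hf.pairing_move_right ht h₂ _ i h₁.2, h₁₂,
        hf.pairing_move_right ht h₂ _ i h₃.2, h₃₂]
      · convert hr using 1
        ring
      · exact h4
  by_cases h : cubicPairing f r₁ t = 0 ∨ cubicPairing f r₃ t = 0
  · exact hone t ht hrad h
  by_cases h2 : cubicPairing f r₂ t = 0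
  · push Not at h
    have h1' : cubicPairing f t r₁ ≠ 0 := by
      rw [Ne, hf.pairing_comm_eq_zero h₁.2]
      exact h.1
    -- If `t` is not linked to `r₂`, adding an iterate of `r₁` creates such a link.
    obtain ⟨i, hi⟩ := hf.exists_isRoot_add hn h₁ ht h1' (c := 1) (Or.inl rfl)
    refine htwo _ hi ?_ ?_
    · rw [hf.pairing_move_right ht h₁ _ i h₁.2, hf.pairing_move_right ht h₁ _ i h₃.2,
        hf.pairing_self h₁, h₃₁, mul_zero, add_zero, add_zero]
      exact hrad
    · rw [hf.pairing_move_right ht h₁ _ i h₂.2, h2, h₂₁]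
      decide
  · exact htwo t ht hrad h2

end IsCubic

/-! ### Adapted roots in `E₈` for an automorphism of order three -/

namespace IsCubic

variable {f : Mod 8}

theorem form_sub_apply_self (hf : IsCubic f) {x : H2 8}
    (hx : intersectionForm 8 x (anticanonical 8) = 0) :
    intersectionForm 8 (x - f.1 x) (x - f.1 x) = 3 * intersectionForm 8 x x := by
  have h := hf.form_apply_left x hx
  simp only [map_sub, LinearMap.sub_apply, isometry_apply]
  rw [intersectionForm_comm (f.1 x) x] at h ⊢
  linarith

/-- Modulo `1 - f`, a vector orthogonal to all roots has norm divisible by three. -/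
theorem exists_root_pairing_ne_zero (hf : IsCubic f) {x : H2 8}
    (hx : intersectionForm 8 x (anticanonical 8) = 0) (h3 : ¬ 3 ∣ intersectionForm 8 x x) :
    ∃ t, IsRoot t ∧ cubicPairing f t x ≠ 0 := by
  by_contra! hne
  have hfx : intersectionForm 8 (f.1 x) (anticanonical 8) = 0 := by
    rw [intersectionForm_apply_anticanonical hf.fixes, hx]
  -- If all pairings vanish then `x - f x = 3y`. Comparing norms gives `3 Q(x,x) = 9 Q(y,y)`.
  obtain ⟨y, hy⟩ := exists_smul_of_forall_root_dvd (x := x - f.1 x) (m := 3)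
    (by rw [LinearMap.map_sub₂, hx, hfx, sub_zero]) (fun r hr => by
      rw [map_sub, ← pairing_zero_iff]
      exact hne r hr)
  have h := hf.form_sub_apply_self hx
  rw [hy] at h
  simp only [map_smul, LinearMap.smul_apply, smul_eq_mul] at h
  exact h3 ⟨intersectionForm 8 y y, by linarith⟩

/-- Start from two linked roots `r₁, r₂`. The vector `x = r₁ + f r₂` of norm -4 pairs evenly with
both orbits but is not twice a vector of the even lattice `E₈`, so some root `t` pairs oddly with
it. Thus `t` is outside every hexagon in the span of the two orbits and is linked to `r₁` or `r₂`.
Orthogonality of orbits, stronger than a zero pairing, is recorded because a norm is computed from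
it later. -/
theorem exists_three_chain (hf : IsCubic f) : ∃ r₁ r₂ r₃ : H2 8, IsRoot r₁ ∧ IsRoot r₂ ∧
    IsRoot r₃ ∧ cubicPairing f r₁ r₂ ≠ 0 ∧ cubicPairing f r₂ r₃ ≠ 0 ∧
    OrthogonalOrbits f r₁ r₃ := by
  have hn : 8 ≤ 8 := le_rfl
  obtain ⟨r₁, h₁⟩ : ∃ r : H2 8, IsRoot r := ⟨_, isRoot_E_sub_E (i := 0) (j := 1) (by decide)⟩
  obtain ⟨s, hs, hs1⟩ := hf.exists_root_pairing_ne_zero h₁.2 (by rw [h₁.1]; norm_num)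
  obtain ⟨r₂, hhex, e1, e2⟩ := hf.exists_normalized hn h₁ hs hs1
  have h₂ := hf.isRoot_of_sameHexagon hs hhex
  have h₂₁ : cubicPairing f r₂ r₁ ≠ 0 := by
    rwa [Ne, hf.pairing_of_sameHexagon hhex h₁.2]
  have h₁₂ : cubicPairing f r₁ r₂ ≠ 0 := by
    rwa [Ne, hf.pairing_comm_eq_zero h₂.2]
  have e3 := hf.form_apply_left r₂ h₁.2
  rw [e1, e2] at e3
  norm_num at e3
  have e4 := hf.root_apply h₁
  have e5 := hf.root_apply h₂
  have e6 : intersectionForm 8 (f.1 r₁) (f.1 r₂) = 1 := by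
    rw [isometry_apply, intersectionForm_comm, e1]
  have e7 : intersectionForm 8 (f.1 r₁) r₂ = -1 := by rw [intersectionForm_comm, e2]
  set x := r₁ + f.1 r₂ with hx
  have hev : ∀ y : H2 8, intersectionForm 8 y (anticanonical 8) = 0 →
      2 ∣ intersectionForm 8 y x → 2 ∣ intersectionForm 8 (f.1 y) x →
      ∀ i : ℕ, 2 ∣ intersectionForm 8 ((f ^ i).1 y) x ∧
        2 ∣ intersectionForm 8 ((f ^ (i + 1)).1 y) x := by
    intro y hy h0 h1 i
    induction i with
    | zero => exact ⟨h0, h1⟩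
    | succ i ih =>
      refine ⟨ih.2, ?_⟩
      have hb : intersectionForm 8 ((f ^ i).1 y) (anticanonical 8) = 0 := by
        rw [intersectionForm_apply_anticanonical (hf.pow_anticanonical i), hy]
      have e : (f ^ (i + 1 + 1)).1 y = -(f ^ i).1 y - (f ^ (i + 1)).1 y := by
        rw [pow_succ', pow_succ', mul_val_apply, mul_val_apply, hf.apply_apply hb]
      rw [e, LinearMap.map_sub₂, map_neg, LinearMap.neg_apply]
      exact (ih.1.neg_right).sub ih.2
  have ev1 := hev r₁ h₁.2
    (by rw [hx, map_add, h₁.1, intersectionForm_comm, e3]; norm_num)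
    (by rw [hx, map_add, e6, intersectionForm_comm, e4]; norm_num)
  have ev2 := hev r₂ h₂.2
    (by rw [hx, map_add, e1, e5]; norm_num)
    (by rw [hx, map_add, e3, isometry_apply, h₂.1]; norm_num)
  have hxx : intersectionForm 8 x x = -4 := by
    rw [hx]
    simp only [map_add, LinearMap.add_apply, isometry_apply, h₁.1, h₂.1, e3,
      intersectionForm_comm r₁ (f.1 r₂)]
    norm_num
  have hxk : intersectionForm 8 x (anticanonical 8) = 0 := by
    rw [hx, LinearMap.map_add₂, h₁.2, (h₂.apply hf.fixes).2, add_zero]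
  obtain ⟨t, ht, htx⟩ : ∃ t : H2 8, IsRoot t ∧ ¬ 2 ∣ intersectionForm 8 t x := by
    by_contra! hne
    obtain ⟨y, hy⟩ := exists_smul_of_forall_root_dvd hxk hne
    have hyy := even_self_sub_anticanonical y
    have h2 : 2 * intersectionForm 8 y (anticanonical 8) = 0 := by
      rw [hy, map_smul, LinearMap.smul_apply, smul_eq_mul] at hxk
      exact hxk
    rw [show intersectionForm 8 y (anticanonical 8) = 0 by linarith, sub_zero] at hyy
    rw [hy] at hxx
    simp only [map_smul, LinearMap.smul_apply, smul_eq_mul] at hxx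
    obtain ⟨c, hc⟩ := hyy
    omega
  have hnot : ∀ y : H2 8, (∀ i : ℕ, 2 ∣ intersectionForm 8 ((f ^ i).1 y) x) →
      ¬ SameHexagon f y t := by
    rintro y hy ⟨i, rfl | rfl⟩
    · exact htx (hy i)
    · refine htx ?_
      rw [map_neg, LinearMap.neg_apply]
      exact (hy i).neg_right
  have horth : ∀ y : H2 8, IsRoot y → (∀ i : ℕ, 2 ∣ intersectionForm 8 ((f ^ i).1 y) x) →
      cubicPairing f t y = 0 → OrthogonalOrbits f y t := fun y hy h h0 =>
    ((hf.sameHexagon_or_orthogonal hn hy ht h0).resolve_left (hnot y h)).symm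
  by_cases ha : cubicPairing f t r₁ = 0
  · have ho1 := horth r₁ h₁ (fun i => (ev1 i).1) ha
    refine ⟨r₁, r₂, t, h₁, h₂, ht, h₁₂, fun hb => ?_, ho1⟩
    have ho2 := horth r₂ h₂ (fun i => (ev2 i).1) ((hf.pairing_comm_eq_zero h₂.2).2 hb)
    refine htx ?_
    rw [hx, map_add, intersectionForm_comm t, intersectionForm_comm t]
    have o1 := ho1 0 0
    have o2 := ho2 1 0
    rw [pow_zero, one_val_apply, one_val_apply] at o1
    rw [pow_one, pow_zero, one_val_apply] at o2
    rw [o1, o2]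
    norm_num
  have ha' : cubicPairing f r₁ t ≠ 0 := by
    rwa [Ne, hf.pairing_comm_eq_zero ht.2]
  by_cases hb : cubicPairing f t r₂ = 0
  · exact ⟨r₂, r₁, t, h₂, h₁, ht, h₂₁, ha', horth r₂ h₂ (fun i => (ev2 i).1) hb⟩
  -- If `t` is linked to both roots, replace `r₁` by a root `r₁ + c fⁱ r₂` that is not linked to
  -- `t`; its orbit still pairs evenly with `x`.
  · have hb' : cubicPairing f r₂ t ≠ 0 := by
      rwa [Ne, hf.pairing_comm_eq_zero ht.2]
    obtain ⟨r, hr, hrt, c, i, hri⟩ := hf.exists_decoupled hn h₂ h₁ ht h₁₂ hb'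
    refine ⟨r, r₂, t, hr, h₂, ht, ?_, hb', horth r hr (fun j => ?_) ?_⟩
    · rw [hri, hf.pairing_move_left _ _ c i h₂.2, hf.pairing_self h₂, mul_zero, add_zero]
      exact h₁₂
    · have e : (f ^ j).1 r = (f ^ j).1 r₁ + c • (f ^ (j + i)).1 r₂ := by
        rw [hri, map_add, map_smul, ← mul_val_apply, ← pow_add]
      rw [e, LinearMap.map_add₂, map_smul, LinearMap.smul_apply]
      exact (ev1 j).1.add ((ev2 (j + i)).1.mul_left _)
    · rwa [hf.pairing_comm_eq_zero hr.2]

theorem exists_neg_pairing_eq_one {r s : H2 8} (h : cubicPairing f r s ≠ 0) :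
    cubicPairing f r s = 1 ∨ cubicPairing f r (-s) = 1 := by
  rw [pairing_neg_right]
  revert h
  generalize cubicPairing f r s = a
  revert a
  decide

/-- After sign changes the radical vector of the three-chain is `r₁ + s₃`, of norm -4. This is prime
to three, so some root `t` pairs nontrivially with it and extends the chain. -/
theorem exists_chain (hf : IsCubic f) : ∃ a b c d, IsChain f a b c d := by
  obtain ⟨r₁, r₂, r₃, h₁, h₂, h₃, h₁₂, h₂₃, ho⟩ := hf.exists_three_chain
  obtain ⟨s₂, hs₂, h₁₂', h₂₃'⟩ : ∃ s, IsRoot s ∧ cubicPairing f r₁ s = 1 ∧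
      cubicPairing f s r₃ ≠ 0 := by
    rcases exists_neg_pairing_eq_one h₁₂ with h | h
    · exact ⟨r₂, h₂, h, h₂₃⟩
    · exact ⟨-r₂, h₂.neg, h, by rwa [pairing_neg_left, neg_ne_zero]⟩
  obtain ⟨s₃, hs₃, h₂₃'', ho'⟩ : ∃ s, IsRoot s ∧ cubicPairing f s₂ s = 1 ∧
      OrthogonalOrbits f r₁ s := by
    rcases exists_neg_pairing_eq_one h₂₃' with h | h
    · exact ⟨r₃, h₃, h, ho⟩
    · exact ⟨-r₃, h₃.neg, h, ho.right ⟨0, Or.inr rfl⟩⟩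
  have o1 : intersectionForm 8 r₁ s₃ = 0 := ho' 0 0
  have o2 : intersectionForm 8 r₁ (f.1 s₃) = 0 := ho' 0 1
  obtain ⟨t, ht, htx⟩ := hf.exists_root_pairing_ne_zero (x := r₁ + s₃)
    (by rw [LinearMap.map_add₂, h₁.2, hs₃.2, add_zero]) (by
      simp only [map_add, LinearMap.add_apply, h₁.1, hs₃.1, o1, intersectionForm_comm s₃ r₁]
      norm_num)
  refine hf.exists_chain_of_ends le_rfl h₁ hs₂ hs₃ ht h₁₂' h₂₃'' ?_ ?_
  · rw [cubicPairing, o1, o2]; rfl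
  · rw [pairing_add_right, hf.pairing_antisymm t h₁.2, hf.pairing_antisymm t hs₃.2] at htx
    intro h
    refine htx ?_
    linear_combination -h

/-- Roots adapted to `f`: together with their images under `f` they form a basis of `E₈`. -/
theorem exists_adapted_roots (hf : IsCubic f) : ∃ r₁ r₂ r₃ r₄ : H2 8,
    IsRoot r₁ ∧ IsRoot r₂ ∧ IsRoot r₃ ∧ IsRoot r₄ ∧
    (intersectionForm 8 r₂ r₁ = 1 ∧ intersectionForm 8 r₂ (f.1 r₁) = -1) ∧
    (intersectionForm 8 r₃ r₂ = 1 ∧ intersectionForm 8 r₃ (f.1 r₂) = -1) ∧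
    (intersectionForm 8 r₄ r₃ = 1 ∧ intersectionForm 8 r₄ (f.1 r₃) = -1) ∧
    OrthogonalOrbits f r₁ r₃ ∧ OrthogonalOrbits f r₁ r₄ ∧ OrthogonalOrbits f r₂ r₄ := by
  have hn : 8 ≤ 8 := le_rfl
  obtain ⟨r₁, r₂, r₃, r₄, h⟩ := hf.exists_chain
  have h₃₁ := (hf.pairing_comm_eq_zero h.root₃.2).1 h.pair₁₃
  have h₄₁ := (hf.pairing_comm_eq_zero h.root₄.2).1 h.pair₁₄
  have h₄₂ := (hf.pairing_comm_eq_zero h.root₄.2).1 h.pair₂₄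
  -- Unlinked roots have orthogonal orbits unless they share a hexagon. That is impossible here,
  -- since some other member of the chain is linked to exactly one of the two.
  have o₁₃ : OrthogonalOrbits f r₁ r₃ := by
    refine ((hf.sameHexagon_or_orthogonal hn h.root₁ h.root₃ h₃₁).resolve_left fun hh => ?_).symm
    exact h.pair₃₄ ((hf.pairing_of_sameHexagon hh h.root₄.2).2 h.pair₁₄)
  have o₁₄ : OrthogonalOrbits f r₁ r₄ := by
    refine ((hf.sameHexagon_or_orthogonal hn h.root₁ h.root₄ h₄₁).resolve_left fun hh => ?_).symm
    exact h.pair₃₄ ((hf.pairing_comm_eq_zero h.root₄.2).2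
      ((hf.pairing_of_sameHexagon hh h.root₃.2).2 h.pair₁₃))
  have o₂₄ : OrthogonalOrbits f r₂ r₄ := by
    refine ((hf.sameHexagon_or_orthogonal hn h.root₂ h.root₄ h₄₂).resolve_left fun hh => ?_).symm
    exact h.pair₁₂ ((hf.pairing_comm_eq_zero h.root₂.2).2
      ((hf.pairing_of_sameHexagon hh h.root₁.2).1 h₄₁))
  have p₂₁ : cubicPairing f r₂ r₁ ≠ 0 := fun h0 =>
    h.pair₁₂ ((hf.pairing_comm_eq_zero h.root₂.2).2 h0)
  -- Each root is normalized against its predecessor inside its own hexagon, which does not disturb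
  -- the orthogonality of orbits.
  obtain ⟨s₂, x₂, q₂⟩ := hf.exists_normalized hn h.root₁ h.root₂ p₂₁
  have hs₂ := hf.isRoot_of_sameHexagon h.root₂ x₂
  have p₃₂ : cubicPairing f r₃ s₂ ≠ 0 := fun h0 =>
    h.pair₂₃ ((hf.pairing_of_sameHexagon x₂ h.root₃.2).1 ((hf.pairing_comm_eq_zero hs₂.2).1 h0))
  obtain ⟨s₃, x₃, q₃⟩ := hf.exists_normalized hn hs₂ h.root₃ p₃₂
  have hs₃ := hf.isRoot_of_sameHexagon h.root₃ x₃
  have p₄₃ : cubicPairing f r₄ s₃ ≠ 0 := fun h0 =>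
    h.pair₃₄ ((hf.pairing_of_sameHexagon x₃ h.root₄.2).1 ((hf.pairing_comm_eq_zero hs₃.2).1 h0))
  obtain ⟨s₄, x₄, q₄⟩ := hf.exists_normalized hn hs₃ h.root₄ p₄₃
  exact ⟨r₁, s₂, s₃, s₄, h.root₁, hs₂, hs₃, hf.isRoot_of_sameHexagon h.root₄ x₄, q₂, q₃, q₄,
    o₁₃.right x₃, o₁₄.right x₄, ((o₂₄.right x₄).symm.right x₂).symm⟩

end IsCubic

/-! ### Conjugacy of automorphisms of order three for `n = 8` -/

/-- The Gram matrix of a basis of `H₂(M₈)` adapted to an automorphism of order three. -/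
def gramCubic : Matrix (Fin 9) (Fin 9) ℤ :=
  !![-2, 1, 1, 0, 0, 0, 0, 0, 0;
    1, -2, -1, 1, 0, 0, 0, 0, 0;
    1, -1, -2, 1, 1, 0, 0, 0, 0;
    0, 1, 1, -2, -1, 1, 0, 0, 0;
    0, 0, 1, -1, -2, 1, 1, 0, 0;
    0, 0, 0, 1, 1, -2, -1, 1, 0;
    0, 0, 0, 0, 1, -1, -2, 1, 0;
    0, 0, 0, 0, 0, 1, 1, -2, 0;
    0, 0, 0, 0, 0, 0, 0, 0, 1]

/-- The inverse of `gramCubic`. -/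
def gramCubicInv : Matrix (Fin 9) (Fin 9) ℤ :=
  !![-2, -1, -2, -2, -1, -2, 0, -1, 0;
    -1, -2, 0, -2, 1, -1, 1, 0, 0;
    -2, 0, -4, -2, -3, -3, -1, -2, 0;
    -2, -2, -2, -4, 0, -3, 1, -1, 0;
    -1, 1, -3, 0, -4, -2, -2, -2, 0;
    -2, -1, -3, -3, -2, -4, 0, -2, 0;
    0, 1, -1, 1, -2, 0, -2, -1, 0;
    -1, 0, -2, -1, -2, -2, -1, -2, 0;
    0, 0, 0, 0, 0, 0, 0, 0, 1]

theorem gramCubic_mul_inv : gramCubic * gramCubicInv = 1 := by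
  decide +kernel

namespace IsCubic

theorem exists_basis {f : Mod 8} (hf : IsCubic f) : ∃ r : Fin 4 → H2 8,
    (∀ i j, intersectionForm 8
      ((![r 0, f.1 (r 0), r 1, f.1 (r 1), r 2, f.1 (r 2), r 3, f.1 (r 3), anticanonical 8] :
        Fin 9 → H2 8) i)
      ((![r 0, f.1 (r 0), r 1, f.1 (r 1), r 2, f.1 (r 2), r 3, f.1 (r 3), anticanonical 8] :
        Fin 9 → H2 8) j) = gramCubic i j) ∧ ∀ i, IsRoot (r i) := by
  obtain ⟨r₁, r₂, r₃, r₄, h₁, h₂, h₃, h₄, ⟨a₂₁, b₂₁⟩, ⟨a₃₂, b₃₂⟩, ⟨a₄₃, b₄₃⟩, o₁₃, o₁₄, o₂₄⟩ :=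
    hf.exists_adapted_roots
  have c₂₁ : intersectionForm 8 (f.1 r₂) r₁ = 0 := by
    rw [hf.form_apply_left r₂ h₁.2, a₂₁, b₂₁]; norm_num
  have c₃₂ : intersectionForm 8 (f.1 r₃) r₂ = 0 := by
    rw [hf.form_apply_left r₃ h₂.2, a₃₂, b₃₂]; norm_num
  have c₄₃ : intersectionForm 8 (f.1 r₄) r₃ = 0 := by
    rw [hf.form_apply_left r₄ h₃.2, a₄₃, b₄₃]; norm_num
  have z : ∀ r s : H2 8, OrthogonalOrbits f r s → intersectionForm 8 r s = 0 ∧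
      intersectionForm 8 (f.1 r) s = 0 ∧ intersectionForm 8 r (f.1 s) = 0 ∧
      intersectionForm 8 s r = 0 ∧
      intersectionForm 8 (f.1 s) r = 0 ∧ intersectionForm 8 s (f.1 r) = 0 := fun r s h =>
    ⟨h 0 0, h 1 0, h 0 1, h.symm 0 0, h.symm 1 0, h.symm 0 1⟩
  have z₁₃ := z _ _ o₁₃
  have z₁₄ := z _ _ o₁₄
  have z₂₄ := z _ _ o₂₄
  have q : ∀ r : H2 8, IsRoot r → intersectionForm 8 r r = -2 ∧
      intersectionForm 8 r (f.1 r) = 1 ∧ intersectionForm 8 (f.1 r) r = 1 ∧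
      intersectionForm 8 r (anticanonical 8) = 0 ∧
      intersectionForm 8 (f.1 r) (anticanonical 8) = 0 ∧
      intersectionForm 8 (anticanonical 8) r = 0 ∧
      intersectionForm 8 (anticanonical 8) (f.1 r) = 0 := fun r h =>
    ⟨h.1, hf.root_apply h, by rw [intersectionForm_comm, hf.root_apply h], h.2,
      (h.apply hf.fixes).2, by rw [intersectionForm_comm, h.2],
      by rw [intersectionForm_comm, (h.apply hf.fixes).2]⟩
  have q₁ := q _ h₁
  have q₂ := q _ h₂
  have q₃ := q _ h₃
  have q₄ := q _ h₄
  have a₁₂ := (intersectionForm_comm r₁ r₂).trans a₂₁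
  have b₁₂ := (intersectionForm_comm (f.1 r₁) r₂).trans b₂₁
  have c₁₂ := (intersectionForm_comm r₁ (f.1 r₂)).trans c₂₁
  have a₂₃ := (intersectionForm_comm r₂ r₃).trans a₃₂
  have b₂₃ := (intersectionForm_comm (f.1 r₂) r₃).trans b₃₂
  have c₂₃ := (intersectionForm_comm r₂ (f.1 r₃)).trans c₃₂
  have a₃₄ := (intersectionForm_comm r₃ r₄).trans a₄₃
  have b₃₄ := (intersectionForm_comm (f.1 r₃) r₄).trans b₄₃
  have c₃₄ := (intersectionForm_comm r₃ (f.1 r₄)).trans c₄₃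
  have k := intersectionForm_anticanonical_self 8
  norm_num at k
  refine ⟨![r₁, r₂, r₃, r₄], fun i j => ?_, fun i => ?_⟩
  · fin_cases i <;> fin_cases j <;>
      simp [gramCubic, isometry_apply, *]
  · fin_cases i
    exacts [h₁, h₂, h₃, h₄]

/-- Fixed-point-free automorphisms of order three of `E₈` are conjugate. -/
theorem exists_conj {f f' : Mod 8} (hf : IsCubic f) (hf' : IsCubic f') :
    ∃ g ∈ weylGroup 8, g * f * g⁻¹ = f' := by
  obtain ⟨r, hr, hroot⟩ := hf.exists_basis
  obtain ⟨s, hs, hroot'⟩ := hf'.exists_basis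
  refine exists_conj_of_gram gramCubic_mul_inv hr hs ⟨Pi.single 8 1, ?_, ?_⟩ fun j => ?_
  · simp [Pi.single_apply]
  · simp [Pi.single_apply]
  · have e := fun i => hf.apply_apply (hroot i).2
    have e' := fun i => hf'.apply_apply (hroot' i).2
    fin_cases j
    · exact ⟨![0, 1, 0, 0, 0, 0, 0, 0, 0], by simp [Fin.sum_univ_succ], by simp [Fin.sum_univ_succ]⟩
    · exact ⟨![-1, -1, 0, 0, 0, 0, 0, 0, 0], by simp [Fin.sum_univ_succ, e]; abel,
        by simp [Fin.sum_univ_succ, e']; abel⟩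
    · exact ⟨![0, 0, 0, 1, 0, 0, 0, 0, 0], by simp [Fin.sum_univ_succ], by simp [Fin.sum_univ_succ]⟩
    · exact ⟨![0, 0, -1, -1, 0, 0, 0, 0, 0], by simp [Fin.sum_univ_succ, e]; abel,
        by simp [Fin.sum_univ_succ, e']; abel⟩
    · exact ⟨![0, 0, 0, 0, 0, 1, 0, 0, 0], by simp [Fin.sum_univ_succ], by simp [Fin.sum_univ_succ]⟩
    · exact ⟨![0, 0, 0, 0, -1, -1, 0, 0, 0], by simp [Fin.sum_univ_succ, e]; abel,
        by simp [Fin.sum_univ_succ, e']; abel⟩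
    · exact ⟨![0, 0, 0, 0, 0, 0, 0, 1, 0], by simp [Fin.sum_univ_succ], by simp [Fin.sum_univ_succ]⟩
    · exact ⟨![0, 0, 0, 0, 0, 0, -1, -1, 0], by simp [Fin.sum_univ_succ, e]; abel,
        by simp [Fin.sum_univ_succ, e']; abel⟩
    · exact ⟨![0, 0, 0, 0, 0, 0, 0, 0, 1], by simp [Fin.sum_univ_succ, hf.fixes],
        by simp [Fin.sum_univ_succ, hf'.fixes]⟩

end IsCubic

/-! ### Fixed-point-free automorphisms of order five -/

/-- The pairing of `x` with the iterates of `f` on `y`. -/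
def orbitPairing {n : ℕ} (f : Mod n) (x y : H2 n) (d : ℕ) : ℤ :=
  intersectionForm n x ((f ^ d).1 y)

section OrbitPairing

variable {n : ℕ} {f : Mod n}

theorem orbitPairing_zero (x y : H2 n) : orbitPairing f x y 0 = intersectionForm n x y := rfl

theorem orbitPairing_add_left (x x' y : H2 n) (d : ℕ) :
    orbitPairing f (x + x') y d = orbitPairing f x y d + orbitPairing f x' y d := by
  rw [orbitPairing, LinearMap.map_add₂]; rfl

theorem orbitPairing_smul_left (c : ℤ) (x y : H2 n) (d : ℕ) :
    orbitPairing f (c • x) y d = c * orbitPairing f x y d := by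
  rw [orbitPairing, map_smul, LinearMap.smul_apply]; rfl

theorem orbitPairing_smul_right (c : ℤ) (x y : H2 n) (d : ℕ) :
    orbitPairing f x (c • y) d = c * orbitPairing f x y d := by
  rw [orbitPairing, map_smul, map_smul]; rfl

theorem orbitPairing_add_right (x y y' : H2 n) (d : ℕ) :
    orbitPairing f x (y + y') d = orbitPairing f x y d + orbitPairing f x y' d := by
  rw [orbitPairing, map_add, map_add]; rfl

/-- The exponent `4 * a` stands for `-a` modulo five, which keeps all exponents natural. -/
theorem intersectionForm_pow_pow (hf : f ^ 5 = 1) (x y : H2 n) (a b : ℕ) :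
    intersectionForm n ((f ^ a).1 x) ((f ^ b).1 y) = orbitPairing f x y (b + 4 * a) := by
  have e : (f ^ b).1 y = (f ^ a).1 ((f ^ (b + 4 * a)).1 y) := by
    rw [← mul_val_apply, ← pow_add, show a + (b + 4 * a) = 5 * a + b by ring, pow_add, pow_mul, hf,
      one_pow, one_mul]
  rw [e, isometry_apply]
  rfl

theorem orbitPairing_pow (hf : f ^ 5 = 1) (x y : H2 n) (a b d : ℕ) :
    orbitPairing f ((f ^ a).1 x) ((f ^ b).1 y) d = orbitPairing f x y (d + b + 4 * a) := by
  rw [orbitPairing, ← mul_val_apply, ← pow_add, intersectionForm_pow_pow hf]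

theorem orbitPairing_pow_left (hf : f ^ 5 = 1) (x y : H2 n) (a d : ℕ) :
    orbitPairing f ((f ^ a).1 x) y d = orbitPairing f x y (d + 4 * a) :=
  orbitPairing_pow hf x y a 0 d

theorem orbitPairing_mod (hf : f ^ 5 = 1) (x y : H2 n) (d : ℕ) :
    orbitPairing f x y d = orbitPairing f x y (d % 5) := by
  rw [orbitPairing, orbitPairing]
  congr 3
  conv_lhs => rw [← Nat.div_add_mod d 5, pow_add, pow_mul, hf, one_pow, one_mul]

theorem orbitPairing_comm (hf : f ^ 5 = 1) (x y : H2 n) (d : ℕ) :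
    orbitPairing f y x d = orbitPairing f x y (4 * d) := by
  rw [orbitPairing, intersectionForm_comm]
  have := intersectionForm_pow_pow hf x y d 0
  rwa [zero_add] at this

end OrbitPairing

/-- `f` fixes the anticanonical class and acts on its orthogonal complement as a primitive fifth
root of unity. -/
structure IsQuintic {n : ℕ} (f : Mod n) : Prop where
  fixes : f.1 (anticanonical n) = anticanonical n
  pow_five : f ^ 5 = 1
  sum : ∀ x, intersectionForm n x (anticanonical n) = 0 → orbitSum f 5 x = 0

/-- A root whose orbit consists of consecutive neighbours. -/
structure IsPentagonRoot {n : ℕ} (f : Mod n) (r : H2 n) : Prop where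
  root : IsRoot r
  one : orbitPairing f r r 1 = 1
  two : orbitPairing f r r 2 = 0

/-- Here `b i - 1` stands for the product of a pentagon root `s` with the `i`-th iterate of another,
`r`. The hypotheses are the vanishing orbit sum, nontrivial glue, and the sign rule of
`neighbors_neg`. Up to rotation by `j` and a sign, encoded by `c`, only `(1, -1, 0, 0, 0)` and `(0,
1, -1, 1, -1)` survive. -/
theorem pentagon_patterns : ∀ b : Fin 5 → Fin 3,
    (∑ i, (((b i).val : ℤ) - 1) = 0) →
    (¬ (5 : ℤ) ∣ (((b 0).val : ℤ) - 1) + 2 * (((b 1).val : ℤ) - 1) + 3 * (((b 2).val : ℤ) - 1) +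
      4 * (((b 3).val : ℤ) - 1)) →
    (∀ i, ((b i).val : ℤ) - 1 = 1 → (((b (i + 1)).val : ℤ) - 1) + (((b (i + 4)).val : ℤ) - 1) < 0) →
    (∀ i, ((b i).val : ℤ) - 1 = -1 →
      0 < (((b (i + 1)).val : ℤ) - 1) + (((b (i + 4)).val : ℤ) - 1)) →
    ∃ j : Fin 5, ∃ c : Fin 2, (fun c : ℤ =>
      (c * (((b j).val : ℤ) - 1) = 1 ∧ c * (((b (j + 1)).val : ℤ) - 1) = -1 ∧
        c * (((b (j + 2)).val : ℤ) - 1) = 0 ∧ c * (((b (j + 3)).val : ℤ) - 1) = 0 ∧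
        c * (((b (j + 4)).val : ℤ) - 1) = 0) ∨
      (c * (((b j).val : ℤ) - 1) = 0 ∧ c * (((b (j + 1)).val : ℤ) - 1) = 1 ∧
        c * (((b (j + 2)).val : ℤ) - 1) = -1 ∧ c * (((b (j + 3)).val : ℤ) - 1) = 1 ∧
        c * (((b (j + 4)).val : ℤ) - 1) = -1)) (if c = 0 then 1 else -1) := by
  decide +kernel

namespace IsQuintic

variable {n : ℕ} {f : Mod n}

theorem pow_anticanonical (hf : IsQuintic f) (i : ℕ) :
    (f ^ i).1 (anticanonical n) = anticanonical n := pow_apply_of_fixed hf.fixes i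

theorem isRoot_pow (hf : IsQuintic f) {r : H2 n} (hr : IsRoot r) (i : ℕ) : IsRoot ((f ^ i).1 r) :=
  hr.apply (hf.pow_anticanonical i)

theorem sum_orbitPairing (hf : IsQuintic f) (x : H2 n) {y : H2 n}
    (hy : intersectionForm n y (anticanonical n) = 0) :
    orbitPairing f x y 0 + orbitPairing f x y 1 + orbitPairing f x y 2 + orbitPairing f x y 3 +
      orbitPairing f x y 4 = 0 := by
  have h := congrArg (intersectionForm n x) (hf.sum y hy)
  rw [orbitSum, map_sum, map_zero] at h
  simpa [Finset.sum_range_succ, orbitPairing] using h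

theorem orbitPairing_self (hf : IsQuintic f) {r : H2 n} (hr : IsRoot r) :
    orbitPairing f r r 0 = -2 ∧ orbitPairing f r r 3 = orbitPairing f r r 2 ∧
      orbitPairing f r r 4 = orbitPairing f r r 1 ∧
      orbitPairing f r r 1 + orbitPairing f r r 2 = 1 := by
  have h0 : orbitPairing f r r 0 = -2 := hr.1
  have h3 := orbitPairing_comm hf.pow_five r r 2
  have h4 := orbitPairing_comm hf.pow_five r r 1
  have h := hf.sum_orbitPairing r hr.2
  rw [orbitPairing_mod hf.pow_five] at h3
  norm_num at h3 h4
  rw [orbitPairing_mod hf.pow_five _ _ 8] at h3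
  norm_num at h3
  exact ⟨h0, h3.symm, h4.symm, by linarith⟩

/-- The products of `r` with its orbit are `-2, a, b, b, a` with `a + b = 1`. Values outside `{-1,
0, 1}` would mean `fⁱ r = ±r`, which is incompatible with that sum. -/
theorem orbitPairing_self_cases (hf : IsQuintic f) (hn : n ≤ 8) {r : H2 n} (hr : IsRoot r) :
    (orbitPairing f r r 1 = 1 ∧ orbitPairing f r r 2 = 0) ∨
    (orbitPairing f r r 1 = 0 ∧ orbitPairing f r r 2 = 1) := by
  obtain ⟨h0, h3, h4, hs⟩ := hf.orbitPairing_self hr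
  have key : ∀ i, (orbitPairing f r r i = -2) ∨ (r = -(f ^ i).1 r ∧ orbitPairing f r r i = 2) ∨
      (-1 ≤ orbitPairing f r r i ∧ orbitPairing f r r i ≤ 1) := by
    intro i
    rcases hr.pair hn (hf.isRoot_pow hr i) with h | h | h
    · left
      rw [orbitPairing, ← h, hr.1]
    · refine Or.inr (Or.inl ⟨h, ?_⟩)
      have h' : (f ^ i).1 r = -r := by rw [eq_neg_iff_add_eq_zero]; nth_rw 2 [h]; abel
      rw [orbitPairing, h', map_neg, hr.1]
      norm_num
    · exact Or.inr (Or.inr h)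
  have hneg : ∀ i, r = -(f ^ i).1 r → orbitPairing f r r (i + i) = -2 := by
    intro i h
    have h' : (f ^ i).1 r = -r := by rw [eq_neg_iff_add_eq_zero]; nth_rw 2 [h]; abel
    rw [orbitPairing, pow_add, mul_val_apply, h', map_neg, h', neg_neg, hr.1]
  rcases key 1 with h1 | ⟨h1, e1⟩ | h1
  · rcases key 2 with h2 | ⟨h2, e2⟩ | h2 <;> omega
  · have := hneg 1 h1
    norm_num at this
    omega
  · rcases key 2 with h2 | ⟨h2, e2⟩ | h2
    · omega
    · have := hneg 2 h2
      norm_num at this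
      omega
    · omega

/-- The root `f r + f⁻¹ r` for a root `r` which does not pair with `f r`. -/
theorem isPentagonRoot_add (hf : IsQuintic f) {r : H2 n} (hr : IsRoot r)
    (h1 : orbitPairing f r r 1 = 0) : IsPentagonRoot f ((f ^ 1).1 r + (f ^ 4).1 r) := by
  obtain ⟨h0, h3, h4, hs⟩ := hf.orbitPairing_self hr
  have key : ∀ d, orbitPairing f ((f ^ 1).1 r + (f ^ 4).1 r) ((f ^ 1).1 r + (f ^ 4).1 r) d =
      orbitPairing f r r ((d + 5) % 5) + orbitPairing f r r ((d + 8) % 5) +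
      orbitPairing f r r ((d + 17) % 5) + orbitPairing f r r ((d + 20) % 5) := by
    intro d
    simp only [← orbitPairing_mod hf.pow_five, orbitPairing_add_left, orbitPairing_add_right,
      orbitPairing_pow hf.pow_five]
    ring_nf
  refine ⟨⟨?_, ?_⟩, ?_, ?_⟩
  · rw [← orbitPairing_zero (f := f), key]
    norm_num
    linarith
  · rw [LinearMap.map_add₂, (hf.isRoot_pow hr 1).2, (hf.isRoot_pow hr 4).2, add_zero]
  · rw [key]
    norm_num
    linarith
  · rw [key]
    norm_num
    linarith

theorem isPentagonRoot_smul_pow (hf : IsQuintic f) {r : H2 n} (hr : IsPentagonRoot f r) {c : ℤ}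
    (hc : c * c = 1) (i : ℕ) : IsPentagonRoot f (c • (f ^ i).1 r) := by
  have key : ∀ d, orbitPairing f (c • (f ^ i).1 r) (c • (f ^ i).1 r) d = orbitPairing f r r d := by
    intro d
    rw [orbitPairing_smul_left, orbitPairing_smul_right, orbitPairing_pow hf.pow_five, ← mul_assoc,
      hc, one_mul, orbitPairing_mod hf.pow_five, orbitPairing_mod hf.pow_five _ _ d]
    congr 1
    omega
  refine ⟨⟨?_, ?_⟩, by rw [key, hr.one], by rw [key, hr.two]⟩
  · rw [← orbitPairing_zero (f := f), key, orbitPairing_zero, hr.root.1]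
  · rw [map_smul, LinearMap.smul_apply, (hf.isRoot_pow hr.root i).2, smul_zero]

end IsQuintic

/-! ### Pentagon roots in `E₈` -/

namespace IsQuintic

variable {f : Mod 8}

theorem exists_isPentagonRoot (hf : IsQuintic f) : ∃ r, IsPentagonRoot f r := by
  have hr : IsRoot (E 0 - E 1 : H2 8) := isRoot_E_sub_E (by decide)
  rcases hf.orbitPairing_self_cases le_rfl hr with h | h
  · exact ⟨_, hr, h.1, h.2⟩
  · exact ⟨_, hf.isPentagonRoot_add hr h.1⟩

/-- The functional on roots given by pairing with a generator of the discriminant group of the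
lattice spanned by the orbit of `r`. -/
def gluePairing (f : Mod 8) (r s : H2 8) : ℤ :=
  orbitPairing f s r 0 + 2 * orbitPairing f s r 1 + 3 * orbitPairing f s r 2 +
    4 * orbitPairing f s r 3

/-- The functional is the product with `r + 2fr + 3f²r + 4f³r`, a vector of norm -20. Were it
divisible by five on all roots, that vector would be `5y`, and 25 would divide 20. -/
theorem exists_glue_ne_zero (hf : IsQuintic f) {r : H2 8} (hr : IsPentagonRoot f r) :
    ∃ s, IsPentagonRoot f s ∧ ¬ 5 ∣ gluePairing f r s := by
  obtain ⟨h0, h3, h4, -⟩ := hf.orbitPairing_self hr.root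
  have hm := orbitPairing_mod hf.pow_five
  obtain ⟨t, ht, ht5⟩ : ∃ t, IsRoot t ∧ ¬ 5 ∣ gluePairing f r t := by
    by_contra! hne
    have hx : ∀ t, gluePairing f r t = intersectionForm 8 t
        (r + 2 • (f ^ 1).1 r + 3 • (f ^ 2).1 r + 4 • (f ^ 3).1 r) := by
      intro t
      simp only [map_add, map_nsmul, gluePairing, orbitPairing]
      simp
    obtain ⟨y, hy⟩ := exists_smul_of_forall_root_dvd (m := 5)
      (x := r + 2 • (f ^ 1).1 r + 3 • (f ^ 2).1 r + 4 • (f ^ 3).1 r)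
      (by
        simp only [LinearMap.map_add₂, map_nsmul, LinearMap.smul_apply, (hf.isRoot_pow hr.root _).2,
          hr.root.2]
        norm_num) (fun t ht => hx t ▸ hne t ht)
    have hxx : gluePairing f r (r + 2 • (f ^ 1).1 r + 3 • (f ^ 2).1 r + 4 • (f ^ 3).1 r) = -20 := by
      have e : ∀ (k : ℕ) (x : H2 8), k • x = (k : ℤ) • x := fun k x => (natCast_zsmul x k).symm
      simp only [gluePairing, e, orbitPairing_add_left, orbitPairing_smul_left,
        orbitPairing_pow_left hf.pow_five]
      norm_num
      rw [hm r r 5, hm r r 6, hm r r 7, hm r r 8, hm r r 9, hm r r 10, hm r r 11, hm r r 12,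
        hm r r 13, hm r r 14, hm r r 15]
      norm_num [h0, h3, h4, hr.one, hr.two]
    rw [hx, hy] at hxx
    simp only [map_smul, LinearMap.smul_apply, smul_eq_mul] at hxx
    omega
  rcases hf.orbitPairing_self_cases le_rfl ht with h | h
  · exact ⟨t, ⟨ht, h.1, h.2⟩, ht5⟩
  -- Replacing `t` by `f t + f⁻¹ t` doubles the functional modulo five.
  · refine ⟨_, hf.isPentagonRoot_add ht h.1, ?_⟩
    simp only [gluePairing, orbitPairing_add_left, orbitPairing_pow_left hf.pow_five] at ht5 ⊢
    norm_num
    rw [hm t r 5, hm t r 6, hm t r 7, hm t r 16, hm t r 17, hm t r 18, hm t r 19]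
    norm_num
    omega

end IsQuintic

/-! ### Conjugacy of automorphisms of order five for `n = 8` -/

namespace IsQuintic

/-- The sum `s + c fⁱ r` is again a root. Its product with its image under `f` is two plus the
quantity in question, and for a root this product is zero or one. -/
theorem neighbors_neg {n : ℕ} {f : Mod n} (hf : IsQuintic f) (hn : n ≤ 8) {r s : H2 n}
    (hr : IsPentagonRoot f r)
    (hs : IsPentagonRoot f s) {i : ℕ} {c : ℤ} (hc : c = 1 ∨ c = -1)
    (h : c * orbitPairing f s r i = 1) :
    c * (orbitPairing f s r (i + 1) + orbitPairing f s r (i + 4)) < 0 := by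
  have hcc : c * c = 1 := by rcases hc with rfl | rfl <;> rfl
  have ht := hf.isPentagonRoot_smul_pow hr hcc i
  have hst : intersectionForm n s (c • (f ^ i).1 r) = 1 := by
    rw [map_smul]; exact h
  have hw := hs.root.add ht.root hst
  have e : orbitPairing f (s + c • (f ^ i).1 r) (s + c • (f ^ i).1 r) 1 =
      2 + c * (orbitPairing f s r (i + 1) + orbitPairing f s r (i + 4)) := by
    have e1 : orbitPairing f s ((f ^ i).1 r) 1 = orbitPairing f s r (i + 1) := by
      rw [add_comm i]; exact orbitPairing_pow hf.pow_five s r 0 i 1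
    have e2 : orbitPairing f ((f ^ i).1 r) s 1 = orbitPairing f s r (i + 4) := by
      rw [orbitPairing_comm hf.pow_five, add_comm i]
      exact orbitPairing_pow hf.pow_five s r 0 i 4
    rw [orbitPairing_add_left, orbitPairing_add_right, orbitPairing_add_right, ht.one, hs.one,
      orbitPairing_smul_left, orbitPairing_smul_right, e1, e2]
    ring
  rcases hf.orbitPairing_self_cases hn hw with h | h
  · rw [e] at h; linarith [h.1]
  · rw [e] at h; linarith [h.1]

variable {f : Mod 8}

/-- Elements of the orbit of `r` and their negatives have glue divisible by five, so `s` is none of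
them. -/
theorem orbitPairing_bounds (hf : IsQuintic f) {r s : H2 8} (hr : IsPentagonRoot f r)
    (hs : IsPentagonRoot f s) (h : ¬ 5 ∣ gluePairing f r s) (i : ℕ) :
    -1 ≤ orbitPairing f s r i ∧ orbitPairing f s r i ≤ 1 := by
  have hm := orbitPairing_mod hf.pow_five
  obtain ⟨h0, h3, h4, -⟩ := hf.orbitPairing_self hr.root
  have key : 5 ∣ gluePairing f r ((f ^ (i % 5)).1 r) := by
    have hi : i % 5 < 5 := Nat.mod_lt _ (by norm_num)
    simp only [gluePairing, orbitPairing_pow_left hf.pow_five]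
    rw [hm r r (0 + _), hm r r (1 + _), hm r r (2 + _), hm r r (3 + _)]
    generalize i % 5 = k at hi
    interval_cases k <;> norm_num [h0, h3, h4, hr.one, hr.two]
  rw [hm]
  rcases hs.root.pair le_rfl (hf.isRoot_pow hr.root (i % 5)) with e | e | e
  · rw [← e] at key
    exact absurd key h
  · refine absurd ?_ h
    have : gluePairing f r s = -gluePairing f r ((f ^ (i % 5)).1 r) := by
      have e' : s = (-1 : ℤ) • (f ^ (i % 5)).1 r := by rw [neg_one_smul]; exact e
      conv_lhs => rw [e']
      simp only [gluePairing, orbitPairing_smul_left]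
      ring
    rw [this]
    exact (dvd_neg).2 key
  · exact e

/-- A second pentagon root linked to the first in a standard way. -/
theorem exists_linked (hf : IsQuintic f) {r : H2 8} (hr : IsPentagonRoot f r) :
    ∃ s, IsPentagonRoot f s ∧ orbitPairing f s r 0 = 1 ∧ orbitPairing f s r 1 = -1 ∧
      orbitPairing f s r 2 = 0 ∧ orbitPairing f s r 3 = 0 ∧ orbitPairing f s r 4 = 0 := by
  obtain ⟨s, hs, h5⟩ := hf.exists_glue_ne_zero hr
  obtain ⟨h0, h3, h4, -⟩ := hf.orbitPairing_self hr.root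
  have hm := orbitPairing_mod hf.pow_five
  have hb := hf.orbitPairing_bounds hr hs h5
  have hsum := hf.sum_orbitPairing s hr.root.2
  let b : Fin 5 → Fin 3 := fun i => ⟨(orbitPairing f s r i + 1).toNat, by
    have := hb i; omega⟩
  have hbv : ∀ i : Fin 5, ((b i).val : ℤ) - 1 = orbitPairing f s r i := fun i => by
    have := hb i
    simp only [b]
    omega
  have hadd : ∀ i k : Fin 5, orbitPairing f s r (i + k : Fin 5) =
      orbitPairing f s r ((i : ℕ) + k) := fun i k => by
    rw [hm _ _ ((i : ℕ) + k)]; rfl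
  obtain ⟨j, c, hjc⟩ := pentagon_patterns b
    (by simp only [hbv, Fin.sum_univ_five]; exact hsum)
    (by simp only [hbv]; exact h5)
    (fun i hi => by
      rw [hbv] at hi
      rw [hbv, hbv, hadd, hadd]
      simpa using hf.neighbors_neg le_rfl hr hs (Or.inl rfl) (by rw [hi]; rfl))
    (fun i hi => by
      rw [hbv] at hi
      rw [hbv, hbv, hadd, hadd]
      have := hf.neighbors_neg le_rfl hr hs (c := -1) (Or.inr rfl) (by rw [hi]; rfl)
      simp only [neg_mul, one_mul] at this
      exact neg_lt_zero.1 this)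
  obtain ⟨c', hc, hc'⟩ : ∃ c' : ℤ, c' * c' = 1 ∧ (if c = 0 then 1 else -1) = c' :=
    ⟨_, by split_ifs <;> rfl, rfl⟩
  rw [hc'] at hjc
  clear hc'
  have hs₁ := hf.isPentagonRoot_smul_pow hs hc (4 * j)
  have a₁ : ∀ d : Fin 5, orbitPairing f (c' • (f ^ (4 * (j : ℕ))).1 s) r d =
      c' * (((b (j + d)).val : ℤ) - 1) := by
    intro d
    rw [hbv, hadd, orbitPairing_smul_left, orbitPairing_pow_left hf.pow_five, hm,
      hm _ _ ((j : ℕ) + d)]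
    congr 2
    omega
  generalize c' • (f ^ (4 * (j : ℕ))).1 s = s₁ at hs₁ a₁
  have b0 := a₁ 0
  have b1 := a₁ 1
  have b2 := a₁ 2
  have b3 := a₁ 3
  have b4 := a₁ 4
  rw [add_zero] at b0
  rcases hjc with ⟨e0, e1, e2, e3, e4⟩ | ⟨e0, e1, e2, e3, e4⟩
  · exact ⟨s₁, hs₁, b0.trans e0, b1.trans e1, b2.trans e2, b3.trans e3, b4.trans e4⟩
  replace b0 : orbitPairing f s₁ r 0 = 0 := b0.trans e0
  replace b1 : orbitPairing f s₁ r 1 = 1 := b1.trans e1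
  replace b2 : orbitPairing f s₁ r 2 = -1 := b2.trans e2
  replace b3 : orbitPairing f s₁ r 3 = 1 := b3.trans e3
  replace b4 : orbitPairing f s₁ r 4 = -1 := b4.trans e4
  -- The pattern `(0, 1, -1, 1, -1)` is reduced to the other one. The root `w = s₁ + f³ r` is
  -- orthogonal to `f w`, so `f w + f⁻¹ w` is a pentagon root, and `-f(f w + f⁻¹ w)` has products
  -- `1, -1, 0, 0, 0` with the orbit of `r`.
  have hw : IsRoot (s₁ + (f ^ 3).1 r) := hs₁.root.add (hf.isRoot_pow hr.root 3) b3
  have hw1 : orbitPairing f (s₁ + (f ^ 3).1 r) (s₁ + (f ^ 3).1 r) 1 = 0 := by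
    have e1 : orbitPairing f s₁ ((f ^ 3).1 r) 1 = orbitPairing f s₁ r 4 :=
      orbitPairing_pow hf.pow_five s₁ r 0 3 1
    have e2 : orbitPairing f ((f ^ 3).1 r) s₁ 1 = orbitPairing f s₁ r 2 := by
      rw [orbitPairing_comm hf.pow_five, hm _ _ 2]
      exact (orbitPairing_pow hf.pow_five s₁ r 0 3 4).trans (hm _ _ _)
    have e3 := orbitPairing_pow hf.pow_five r r 3 3 1
    rw [hm _ _ (1 + 3 + 4 * 3)] at e3
    change _ = orbitPairing f r r 1 at e3
    rw [orbitPairing_add_left, orbitPairing_add_right, orbitPairing_add_right, hs₁.one, e1, e2, e3,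
      b4, b2, hr.one]
    norm_num
  have hs₂ := hf.isPentagonRoot_smul_pow (hf.isPentagonRoot_add hw hw1) (c := -1) (by norm_num) 1
  have aw : ∀ d, orbitPairing f (s₁ + (f ^ 3).1 r) r d =
      orbitPairing f s₁ r (d % 5) + orbitPairing f r r ((d + 2) % 5) := by
    intro d
    rw [orbitPairing_add_left, orbitPairing_pow_left hf.pow_five, hm, hm r r (d + _)]
    congr 2
    omega
  have as : ∀ d, orbitPairing f ((-1 : ℤ) • (f ^ 1).1 ((f ^ 1).1 (s₁ + (f ^ 3).1 r) +
      (f ^ 4).1 (s₁ + (f ^ 3).1 r))) r d = -(orbitPairing f s₁ r ((d + 3) % 5) +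
        orbitPairing f r r (d % 5) + orbitPairing f s₁ r (d % 5) +
        orbitPairing f r r ((d + 2) % 5)) := by
    intro d
    rw [orbitPairing_smul_left, orbitPairing_pow_left hf.pow_five, orbitPairing_add_left,
      orbitPairing_pow_left hf.pow_five, orbitPairing_pow_left hf.pow_five, aw, aw,
      show (d + 4 * 1 + 4 * 1) % 5 = (d + 3) % 5 by omega,
      show (d + 4 * 1 + 4 * 4) % 5 = d % 5 by omega,
      show (d + 4 * 1 + 4 * 1 + 2) % 5 = d % 5 by omega,
      show (d + 4 * 1 + 4 * 4 + 2) % 5 = (d + 2) % 5 by omega]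
    ring
  refine ⟨_, hs₂, ?_, ?_, ?_, ?_, ?_⟩ <;> rw [as] <;>
    norm_num [b0, b1, b2, b3, b4, h0, h3, h4, hr.one, hr.two]

end IsQuintic

/-- The Gram matrix of a basis of `H₂(M₈)` adapted to an automorphism of order five. -/
def gramQuintic : Matrix (Fin 9) (Fin 9) ℤ :=
  !![-2, 1, 0, 0, 1, 0, 0, 0, 0;
    1, -2, 1, 0, -1, 1, 0, 0, 0;
    0, 1, -2, 1, 0, -1, 1, 0, 0;
    0, 0, 1, -2, 0, 0, -1, 1, 0;
    1, -1, 0, 0, -2, 1, 0, 0, 0;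
    0, 1, -1, 0, 1, -2, 1, 0, 0;
    0, 0, 1, -1, 0, 1, -2, 1, 0;
    0, 0, 0, 1, 0, 0, 1, -2, 0;
    0, 0, 0, 0, 0, 0, 0, 0, 1]

/-- The inverse of `gramQuintic`. -/
def gramQuinticInv : Matrix (Fin 9) (Fin 9) ℤ :=
  !![-2, -2, -1, 0, -1, -2, -2, -1, 0;
    -2, -4, -3, -1, 0, -2, -3, -2, 0;
    -1, -3, -4, -2, 1, 0, -2, -2, 0;
    0, -1, -2, -2, 1, 1, 0, -1, 0;
    -1, 0, 1, 1, -2, -2, -1, 0, 0;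
    -2, -2, 0, 1, -2, -4, -3, -1, 0;
    -2, -3, -2, 0, -1, -3, -4, -2, 0;
    -1, -2, -2, -1, 0, -1, -2, -2, 0;
    0, 0, 0, 0, 0, 0, 0, 0, 1]

theorem gramQuintic_mul_inv : gramQuintic * gramQuinticInv = 1 := by
  decide +kernel

namespace IsQuintic

theorem form_orbits {n : ℕ} {f : Mod n} (hf : f ^ 5 = 1) (x y : H2 n) :
    intersectionForm n x (f.1 y) = orbitPairing f x y 1 ∧
    intersectionForm n x (f.1 (f.1 y)) = orbitPairing f x y 2 ∧
    intersectionForm n x (f.1 (f.1 (f.1 y))) = orbitPairing f x y 3 ∧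
    intersectionForm n (f.1 x) y = orbitPairing f x y 4 ∧
    intersectionForm n (f.1 (f.1 x)) y = orbitPairing f x y 3 ∧
    intersectionForm n (f.1 (f.1 (f.1 x))) y = orbitPairing f x y 2 :=
  ⟨rfl, rfl, rfl, intersectionForm_pow_pow hf x y 1 0,
    (intersectionForm_pow_pow hf x y 2 0).trans (orbitPairing_mod hf _ _ _),
    (intersectionForm_pow_pow hf x y 3 0).trans (orbitPairing_mod hf _ _ _)⟩

/-- The basis spanned by the orbits of two roots and the anticanonical class. -/
def rootBasis (f : Mod 8) (r s : H2 8) : Fin 9 → H2 8 :=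
  ![r, f.1 r, f.1 (f.1 r), f.1 (f.1 (f.1 r)), s, f.1 s, f.1 (f.1 s), f.1 (f.1 (f.1 s)),
    anticanonical 8]

theorem exists_basis {f : Mod 8} (hf : IsQuintic f) : ∃ r s : H2 8,
    (∀ i j, intersectionForm 8 (rootBasis f r s i) (rootBasis f r s j) = gramQuintic i j) ∧
      IsRoot r ∧ IsRoot s := by
  obtain ⟨r, hr⟩ := hf.exists_isPentagonRoot
  obtain ⟨s, hs, a0, a1, a2, a3, a4⟩ := hf.exists_linked hr
  have c0 : orbitPairing f r s 0 = 1 := (orbitPairing_comm hf.pow_five _ _ _).trans a0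
  have c1 : orbitPairing f r s 1 = 0 := (orbitPairing_comm hf.pow_five _ _ _).trans a4
  have c2 : orbitPairing f r s 2 = 0 :=
    (orbitPairing_comm hf.pow_five _ _ _).trans ((orbitPairing_mod hf.pow_five _ _ _).trans a3)
  have c3 : orbitPairing f r s 3 = 0 :=
    (orbitPairing_comm hf.pow_five _ _ _).trans ((orbitPairing_mod hf.pow_five _ _ _).trans a2)
  have c4 : orbitPairing f r s 4 = -1 :=
    (orbitPairing_comm hf.pow_five _ _ _).trans ((orbitPairing_mod hf.pow_five _ _ _).trans a1)
  obtain ⟨p0, p3, p4, -⟩ := hf.orbitPairing_self hr.root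
  obtain ⟨q0, q3, q4, -⟩ := hf.orbitPairing_self hs.root
  rw [hr.one] at p4
  rw [hr.two] at p3
  rw [hs.one] at q4
  rw [hs.two] at q3
  have p1 := hr.one
  have p2 := hr.two
  have q1 := hs.one
  have q2 := hs.two
  rw [orbitPairing_zero] at a0 c0 p0 q0
  have t₁ := form_orbits hf.pow_five r r
  have t₂ := form_orbits hf.pow_five r s
  have t₃ := form_orbits hf.pow_five s r
  have t₄ := form_orbits hf.pow_five s s
  have k := intersectionForm_anticanonical_self 8
  norm_num at k
  have q : ∀ x : H2 8, IsRoot x → intersectionForm 8 x (anticanonical 8) = 0 ∧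
      intersectionForm 8 (anticanonical 8) x = 0 := fun x h =>
    ⟨h.2, by rw [intersectionForm_comm, h.2]⟩
  have r₁ := q _ hr.root
  have r₂ := q _ (hr.root.apply hf.fixes)
  have r₃ := q _ ((hr.root.apply hf.fixes).apply hf.fixes)
  have r₄ := q _ (((hr.root.apply hf.fixes).apply hf.fixes).apply hf.fixes)
  have s₁ := q _ hs.root
  have s₂ := q _ (hs.root.apply hf.fixes)
  have s₃ := q _ ((hs.root.apply hf.fixes).apply hf.fixes)
  have s₄ := q _ (((hs.root.apply hf.fixes).apply hf.fixes).apply hf.fixes)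
  refine ⟨r, s, fun i j => ?_, hr.root, hs.root⟩
  clear q hr hs
  fin_cases i <;> fin_cases j <;> simp [rootBasis, gramQuintic, isometry_apply, *]

theorem apply_four {n : ℕ} {f : Mod n} (hf : IsQuintic f) {r : H2 n} (hr : IsRoot r) :
    f.1 (f.1 (f.1 (f.1 r))) = -r - f.1 r - f.1 (f.1 r) - f.1 (f.1 (f.1 r)) := by
  have h := hf.sum r hr.2
  simp only [orbitSum, Finset.sum_range_succ, Finset.sum_range_zero, zero_add] at h
  have e : (f ^ 4).1 r = f.1 (f.1 (f.1 (f.1 r))) := rfl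
  rw [← e, eq_neg_of_add_eq_zero_right h]
  change -(r + f.1 r + f.1 (f.1 r) + f.1 (f.1 (f.1 r))) = _
  abel

/-- Fixed-point-free automorphisms of order five of `E₈` are conjugate. -/
theorem exists_conj {f f' : Mod 8} (hf : IsQuintic f) (hf' : IsQuintic f') :
    ∃ g ∈ weylGroup 8, g * f * g⁻¹ = f' := by
  obtain ⟨r, s, hu, hr, hs⟩ := hf.exists_basis
  obtain ⟨r', s', hu', hr', hs'⟩ := hf'.exists_basis
  refine exists_conj_of_gram gramQuintic_mul_inv hu hu' ⟨Pi.single 8 1, ?_, ?_⟩ fun j => ?_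
  · simp [Pi.single_apply, rootBasis]
  · simp [Pi.single_apply, rootBasis]
  · refine ⟨![Pi.single 1 1, Pi.single 2 1, Pi.single 3 1, ![-1, -1, -1, -1, 0, 0, 0, 0, 0],
      Pi.single 5 1, Pi.single 6 1, Pi.single 7 1, ![0, 0, 0, 0, -1, -1, -1, -1, 0],
      Pi.single 8 1] j, ?_, ?_⟩
    · have e1 := hf.apply_four hr
      have e2 := hf.apply_four hs
      fin_cases j <;>
        simp [Fin.sum_univ_succ, Pi.single_apply, rootBasis, e1, e2, hf.fixes] <;> abel
    · have e1 := hf'.apply_four hr'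
      have e2 := hf'.apply_four hs'
      fin_cases j <;>
        simp [Fin.sum_univ_succ, Pi.single_apply, rootBasis, e1, e2, hf'.fixes] <;> abel

end IsQuintic

/-! ### Lines -/

/-- The classes of lines on a del Pezzo surface. -/
def IsLine {n : ℕ} (e : H2 n) : Prop :=
  intersectionForm n e e = -1 ∧ intersectionForm n e (anticanonical n) = 1

theorem isLine_E {n : ℕ} (i : Fin n) : IsLine (E i : H2 n) := ⟨E_self i, E_anticanonical i⟩

theorem IsLine.apply {n : ℕ} {f : Mod n} (hfk : f.1 (anticanonical n) = anticanonical n)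
    {e : H2 n} (h : IsLine e) : IsLine (f.1 e) :=
  ⟨by rw [isometry_apply, h.1], by rw [intersectionForm_apply_anticanonical hfk, h.2]⟩

theorem IsLine.eq_or_nonneg {n : ℕ} (hn : n ≤ 8) {e s : H2 n} (he : IsLine e) (hs : IsLine s) :
    e = s ∨ 0 ≤ intersectionForm n e s := by
  by_contra! h
  refine h.1 (sub_eq_zero.1 (eq_zero_of_orthogonal (anticanonical_pos hn) ?_ ?_))
  · rw [LinearMap.map_sub₂, he.2, hs.2, sub_self]
  · simp only [map_sub, LinearMap.sub_apply, he.1, hs.1, intersectionForm_comm s e]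
    linarith [h.2]

/-- The vector `(9 - n)(e + s) - 2(-K)` is orthogonal to `K`, so its norm `(9 - n)(2(9 - n)(Q(e,s) -
1) - 4)` cannot be positive. For `9 - n ≥ 3` this excludes products above one. -/
theorem IsLine.le_one {n : ℕ} (hn : n ≤ 6) {e s : H2 n} (he : IsLine e) (hs : IsLine s) :
    intersectionForm n e s ≤ 1 := by
  by_contra! h
  have hk := intersectionForm_anticanonical_self n
  have h1 : intersectionForm n ((9 - n : ℤ) • (e + s) - (2 : ℤ) • anticanonical n)
      ((9 - n : ℤ) • (e + s) - (2 : ℤ) • anticanonical n) =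
      (9 - n : ℤ) * (2 * (9 - n : ℤ) * (intersectionForm n e s - 1) - 4) := by
    simp only [map_sub, map_add, map_smul, LinearMap.sub_apply, LinearMap.add_apply,
      LinearMap.smul_apply, smul_eq_mul, he.1, hs.1, he.2, hs.2, hk, intersectionForm_comm s e,
      intersectionForm_comm (anticanonical n) e, intersectionForm_comm (anticanonical n) s]
    ring
  have h2 : 0 < intersectionForm n ((9 - n : ℤ) • (e + s) - (2 : ℤ) • anticanonical n)
      ((9 - n : ℤ) • (e + s) - (2 : ℤ) • anticanonical n) := by
    rw [h1]
    have h3 : (3 : ℤ) ≤ 9 - n := by omega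
    have h4 : (3 : ℤ) * 1 ≤ (9 - n) * (intersectionForm n e s - 1) :=
      mul_le_mul h3 (by omega) (by norm_num) (by omega)
    exact mul_pos (by omega) (by linarith)
  have h5 := eq_zero_of_orthogonal (x := (9 - n : ℤ) • (e + s) - (2 : ℤ) • anticanonical n)
    (anticanonical_pos (n := n) (by omega)) (by
      simp only [map_sub, map_add, map_smul, LinearMap.sub_apply, LinearMap.add_apply,
        LinearMap.smul_apply, smul_eq_mul, he.2, hs.2, hk]
      ring) h2.le
  rw [h5] at h2
  simp at h2

/-! ### Conjugacy of automorphisms of order five for `n = 4` -/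

/-- The Gram matrix of a pentagon of lines in `H₂(M₄)`. -/
def gramPentagon : Matrix (Fin 5) (Fin 5) ℤ :=
  !![-1, 1, 0, 0, 1;
    1, -1, 1, 0, 0;
    0, 1, -1, 1, 0;
    0, 0, 1, -1, 1;
    1, 0, 0, 1, -1]

/-- The inverse of `gramPentagon`. -/
def gramPentagonInv : Matrix (Fin 5) (Fin 5) ℤ :=
  !![-1, 0, 1, 1, 0;
    0, -1, 0, 1, 1;
    1, 0, -1, 0, 1;
    1, 1, 0, -1, 0;
    0, 1, 1, 0, -1]

theorem gramPentagon_mul_inv : gramPentagon * gramPentagonInv = 1 := by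
  decide +kernel

/-- A pentagon of lines, as the orbit of one of them. -/
def lineOrbit (f : Mod 4) (e : H2 4) : Fin 5 → H2 4 :=
  ![e, f.1 e, f.1 (f.1 e), f.1 (f.1 (f.1 e)), f.1 (f.1 (f.1 (f.1 e)))]

namespace IsQuintic

/-- The orbit of a line sums to `-K`, so its products are `-1, a, b, b, a` with `a + b = 1`. As
lines meet at most once here, one of `a`, `b` is one and the other is zero. -/
theorem exists_line_orbit {f : Mod 4} (hf : IsQuintic f)
    (hsum : ∀ x, orbitSum f 5 x = intersectionForm 4 x (anticanonical 4) • anticanonical 4) :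
    ∃ e : H2 4, IsLine e ∧
      ∀ i j, intersectionForm 4 (lineOrbit f e i) (lineOrbit f e j) = gramPentagon i j := by
  have hm := orbitPairing_mod hf.pow_five
  have hself : ∀ e : H2 4, IsLine e → orbitPairing f e e 0 = -1 ∧
      orbitPairing f e e 3 = orbitPairing f e e 2 ∧ orbitPairing f e e 4 = orbitPairing f e e 1 ∧
      orbitPairing f e e 1 + orbitPairing f e e 2 = 1 := by
    intro e he
    have h0 : orbitPairing f e e 0 = -1 := he.1
    have h3 : orbitPairing f e e 3 = orbitPairing f e e 2 :=
      ((orbitPairing_comm hf.pow_five e e 2).trans (hm _ _ _)).symm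
    have h4 : orbitPairing f e e 4 = orbitPairing f e e 1 :=
      (orbitPairing_comm hf.pow_five e e 1).symm
    have h := congrArg (intersectionForm 4 e) (hsum e)
    rw [orbitSum, map_sum, he.2, one_smul, he.2] at h
    simp only [Finset.sum_range_succ, Finset.sum_range_zero, zero_add] at h
    change orbitPairing f e e 0 + orbitPairing f e e 1 + orbitPairing f e e 2 +
      orbitPairing f e e 3 + orbitPairing f e e 4 = 1 at h
    exact ⟨h0, h3, h4, by linarith⟩
  have hpow : ∀ (i : ℕ) (e : H2 4), IsLine e → IsLine ((f ^ i).1 e) := fun i e he =>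
    he.apply (hf.pow_anticanonical i)
  obtain ⟨e, he, h1⟩ : ∃ e : H2 4, IsLine e ∧ orbitPairing f e e 1 = 1 := by
    have he : IsLine (E 0 : H2 4) := isLine_E 0
    obtain ⟨h0, h3, h4, hs⟩ := hself _ he
    generalize (E 0 : H2 4) = e at *
    have b1 : orbitPairing f e e 1 ≤ 1 := he.le_one (by norm_num) (hpow 1 e he)
    have b2 : orbitPairing f e e 2 ≤ 1 := he.le_one (by norm_num) (hpow 2 e he)
    by_cases h1 : orbitPairing f e e 1 = 1
    · exact ⟨e, he, h1⟩
    -- If `f e` is disjoint from `e`, the line `f e + f⁻¹ e - e` meets its own image and replaces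
    -- `e`.
    replace h1 : orbitPairing f e e 1 = 0 := by omega
    have h2 : orbitPairing f e e 2 = 1 := by omega
    have key : ∀ d, orbitPairing f ((f ^ 1).1 e + (f ^ 4).1 e + (-1 : ℤ) • e)
        ((f ^ 1).1 e + (f ^ 4).1 e + (-1 : ℤ) • e) d =
        orbitPairing f e e ((d + 5) % 5) + orbitPairing f e e ((d + 17) % 5) -
        orbitPairing f e e ((d + 1) % 5) + orbitPairing f e e ((d + 8) % 5) +
        orbitPairing f e e ((d + 20) % 5) - orbitPairing f e e ((d + 4) % 5) -
        orbitPairing f e e ((d + 4) % 5) - orbitPairing f e e ((d + 16) % 5) +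
        orbitPairing f e e (d % 5) := by
      intro d
      have e1 : ∀ a, orbitPairing f ((f ^ a).1 e) e d = orbitPairing f e e (d + 4 * a) :=
        fun a => orbitPairing_pow hf.pow_five e e a 0 d
      have e2 : ∀ a, orbitPairing f e ((f ^ a).1 e) d = orbitPairing f e e (d + a) :=
        fun a => orbitPairing_pow hf.pow_five e e 0 a d
      simp only [← hm, orbitPairing_add_left, orbitPairing_add_right, orbitPairing_smul_left,
        orbitPairing_smul_right, orbitPairing_pow hf.pow_five, e1, e2]
      ring_nf
    refine ⟨(f ^ 1).1 e + (f ^ 4).1 e + (-1 : ℤ) • e, ⟨?_, ?_⟩, ?_⟩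
    · rw [← orbitPairing_zero (f := f), key]
      norm_num [h0, h1, h2, h3, h4]
    · simp only [map_add, map_smul, LinearMap.add_apply, LinearMap.smul_apply, he.2,
        (hpow 1 e he).2, (hpow 4 e he).2]
      norm_num
    · rw [key]
      norm_num [h0, h1, h2, h3, h4]
  obtain ⟨h0, h3, h4, hs⟩ := hself _ he
  have h2 : orbitPairing f e e 2 = 0 := by omega
  rw [h1] at h4
  rw [h2] at h3
  rw [orbitPairing_zero] at h0
  have t := form_orbits hf.pow_five e e
  have t4 : intersectionForm 4 e (f.1 (f.1 (f.1 (f.1 e)))) = orbitPairing f e e 4 := rfl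
  have t1 : intersectionForm 4 (f.1 (f.1 (f.1 (f.1 e)))) e = orbitPairing f e e 1 :=
    (intersectionForm_pow_pow hf.pow_five e e 4 0).trans (hm _ _ _)
  refine ⟨e, he, fun i j => ?_⟩
  clear hself hpow hm hsum
  fin_cases i <;> fin_cases j <;> simp [lineOrbit, gramPentagon, isometry_apply, *]

/-- Automorphisms of order five are conjugate for `n = 4`. -/
theorem exists_conj_four {f f' : Mod 4} (hf : IsQuintic f) (hf' : IsQuintic f')
    (hsum : ∀ x, orbitSum f 5 x = intersectionForm 4 x (anticanonical 4) • anticanonical 4)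
    (hsum' : ∀ x, orbitSum f' 5 x = intersectionForm 4 x (anticanonical 4) • anticanonical 4) :
    ∃ g ∈ weylGroup 4, g * f * g⁻¹ = f' := by
  obtain ⟨e, he, hu⟩ := hf.exists_line_orbit hsum
  obtain ⟨e', he', hu'⟩ := hf'.exists_line_orbit hsum'
  have hk : ∀ {h : Mod 4} {x : H2 4}, IsLine x →
      (∀ x, orbitSum h 5 x = intersectionForm 4 x (anticanonical 4) • anticanonical 4) →
      anticanonical 4 = ∑ i, (fun _ => (1 : ℤ)) i • lineOrbit h x i := by
    intro h x hx hs
    have := hs x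
    rw [hx.2, one_smul] at this
    rw [← this]
    simp only [orbitSum, Finset.sum_range_succ, Finset.sum_range_zero, zero_add, one_smul,
      Fin.sum_univ_five]
    rfl
  refine exists_conj_of_gram gramPentagon_mul_inv hu hu' ⟨fun _ => 1, hk he hsum, hk he' hsum'⟩
    fun j => ⟨Pi.single (j + 1) 1, ?_, ?_⟩
  · have h5 : f.1 (f.1 (f.1 (f.1 (f.1 e)))) = e := congrArg (fun g : Mod 4 => g.1 e) hf.pow_five
    fin_cases j <;> simp [Pi.single_apply, lineOrbit, h5]
  · have h5 : f'.1 (f'.1 (f'.1 (f'.1 (f'.1 e')))) = e' :=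
      congrArg (fun g : Mod 4 => g.1 e') hf'.pow_five
    fin_cases j <;> simp [Pi.single_apply, lineOrbit, h5]

end IsQuintic

/-! ### Conjugacy of automorphisms of order three for `n = 6` -/

/-- The Gram matrix of a basis of `H₂(M₆)` adapted to an automorphism of order three. -/
def gramTritangent : Matrix (Fin 7) (Fin 7) ℤ :=
  !![-1, 1, 1, 1, 0, 1, 0;
    1, -1, 1, 0, 1, 0, 1;
    1, 1, 3, 1, 1, 1, 1;
    1, 0, 1, -1, 1, 0, 0;
    0, 1, 1, 1, -1, 1, 0;
    1, 0, 1, 0, 1, -1, 1;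
    0, 1, 1, 0, 0, 1, -1]

/-- The inverse of `gramTritangent`. -/
def gramTritangentInv : Matrix (Fin 7) (Fin 7) ℤ :=
  !![-2, -1, 2, -1, -1, -1, 0;
    -1, -2, 2, 0, -1, -1, -1;
    2, 2, -3, 1, 2, 2, 1;
    -1, 0, 1, -2, -1, 0, 1;
    -1, -1, 2, -1, -2, -1, 0;
    -1, -1, 2, 0, -1, -2, -1;
    0, -1, 1, 1, 0, -1, -2]

theorem gramTritangent_mul_inv : gramTritangent * gramTritangentInv = 1 := by
  decide +kernel

/-- The family formed by two lines out of each of three tritangent trios and the anticanonical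
class. -/
def trioBasis (f : Mod 6) (e₁ e₂ e₃ : H2 6) : Fin 7 → H2 6 :=
  ![e₁, f.1 e₁, anticanonical 6, e₂, f.1 e₂, e₃, f.1 e₃]

/-- The line `s` meets `e`, and none of `f e`, `f² e`. -/
structure Meets {n : ℕ} (f : Mod n) (s e : H2 n) : Prop where
  zero : intersectionForm n s e = 1
  one : intersectionForm n s (f.1 e) = 0
  two : intersectionForm n s (f.1 (f.1 e)) = 0

theorem Meets.apply {n : ℕ} {f : Mod n} {s e : H2 n} (h : Meets f s e) : Meets f (f.1 s) (f.1 e) :=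
  ⟨by rw [isometry_apply, h.zero], by rw [isometry_apply, h.one], by rw [isometry_apply, h.two]⟩

namespace IsCubic

theorem form_apply_swap {n : ℕ} {f : Mod n} (hf : IsCubic f) (x y : H2 n) :
    intersectionForm n (f.1 x) y = intersectionForm n x (f.1 (f.1 y)) := by
  rw [← isometry_apply f x, hf.cube]

theorem meets_symm {n : ℕ} {f : Mod n} (hf : IsCubic f) {s e : H2 n} (h : Meets f s e) :
    Meets f e s := by
  refine ⟨?_, ?_, ?_⟩
  · rw [intersectionForm_comm, h.zero]
  · rw [intersectionForm_comm, hf.form_apply_swap, h.two]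
  · rw [intersectionForm_comm, hf.form_apply_swap, hf.form_apply_swap, hf.cube, h.one]

variable {f : Mod 6}

/-- `f` permutes the lines of each trio cyclically. -/
theorem line_sum (hsum : ∀ x, x + f.1 x + f.1 (f.1 x) =
      intersectionForm 6 x (anticanonical 6) • anticanonical 6) (s : H2 6) {e : H2 6}
    (hs : IsLine s) (he : IsLine e) : intersectionForm 6 s e + intersectionForm 6 s (f.1 e) +
      intersectionForm 6 s (f.1 (f.1 e)) = 1 := by
  rw [← map_add, ← map_add, hsum, he.2, one_smul, hs.2]

theorem line_self (hf : IsCubic f) (hsum : ∀ x, x + f.1 x + f.1 (f.1 x) =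
      intersectionForm 6 x (anticanonical 6) • anticanonical 6) {e : H2 6} (he : IsLine e) :
    intersectionForm 6 e (f.1 e) = 1 ∧ intersectionForm 6 e (f.1 (f.1 e)) = 1 := by
  have h := line_sum hsum e he he
  have h1 := he.le_one le_rfl (he.apply hf.fixes)
  have h2 := he.le_one le_rfl ((he.apply hf.fixes).apply hf.fixes)
  rw [he.1] at h
  constructor <;> linarith

/-- The trio `e, f e, f² e` sums to `-K`, so a line outside it has three nonnegative products with
total one. -/
theorem exists_meets (hf : IsCubic f) (hsum : ∀ x, x + f.1 x + f.1 (f.1 x) =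
      intersectionForm 6 x (anticanonical 6) • anticanonical 6) {s e : H2 6} (hs : IsLine s)
    (he : IsLine e) (h0 : s ≠ e) (h1 : s ≠ f.1 e) (h2 : s ≠ f.1 (f.1 e)) :
    Meets f s e ∨ Meets f s (f.1 e) ∨ Meets f s (f.1 (f.1 e)) := by
  have h := line_sum hsum s hs he
  have b0 := (hs.eq_or_nonneg (by norm_num) he).resolve_left h0
  have b1 := (hs.eq_or_nonneg (by norm_num) (he.apply hf.fixes)).resolve_left h1
  have b2 := (hs.eq_or_nonneg (by norm_num) ((he.apply hf.fixes).apply hf.fixes)).resolve_left h2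
  by_cases c0 : intersectionForm 6 s e = 1
  · exact Or.inl ⟨c0, by omega, by omega⟩
  by_cases c1 : intersectionForm 6 s (f.1 e) = 1
  · exact Or.inr (Or.inl ⟨c1, by omega, by rw [hf.cube]; omega⟩)
  · exact Or.inr (Or.inr ⟨by omega, by rw [hf.cube]; omega, by rw [hf.cube]; omega⟩)

/-- The lines `Eᵢ` and `H - E₁ - E₂` generate the lattice, so divisibility by three on all lines
makes `x` a multiple of three. -/
theorem exists_line_not_dvd {x : H2 6} (hx : ¬ 9 ∣ intersectionForm 6 x x) :
    ∃ s, IsLine s ∧ ¬ 3 ∣ intersectionForm 6 s x := by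
  by_contra! h
  have h1 : ∀ i : Fin 6, (3 : ℤ) ∣ x i.succ := fun i => by
    have := h _ (isLine_E i)
    rwa [intersectionForm_comm, intersectionForm_E, dvd_neg] at this
  have h2 : (3 : ℤ) ∣ x 0 := by
    have hl : IsLine (H 6 - E 0 - E 1) := by
      constructor
      · simp [intersectionForm_H_H, intersectionForm_H_E, intersectionForm_E_E,
          intersectionForm_comm _ (H 6)]
      · rw [LinearMap.map_sub₂, LinearMap.map_sub₂, E_anticanonical, E_anticanonical,
          intersectionForm_comm, intersectionForm_H, anticanonical_zero]
        norm_num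
    have := h _ hl
    rw [intersectionForm_comm, map_sub, map_sub, intersectionForm_H, intersectionForm_E,
      intersectionForm_E] at this
    have e0 := h1 0
    have e1 := h1 1
    omega
  have h3 : ∀ i, (3 : ℤ) ∣ x i := fun i => Fin.cases h2 h1 i
  choose y hy using h3
  refine hx ⟨intersectionForm 6 y y, ?_⟩
  have : x = (3 : ℤ) • y := funext hy
  rw [this]
  simp only [map_smul, LinearMap.smul_apply, smul_eq_mul]
  ring

/-- Take two trios with `e₂` meeting `e₁`. The vector `fe₁ + 2f²e₁ - fe₂ - 2f²e₂` has norm -12, so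
some line `s` pairs with it nontrivially modulo three; lines of the two trios do not. If `s` meets
`fᵃe₁` and `fᵇe₂`, with `a, b` in `{0, 1, 2}`, the product is `a - b`, so `a ≠ b`. Rotating by `f`
gives `a = 0`. -/
theorem exists_lines (hf : IsCubic f) (hsum : ∀ x, x + f.1 x + f.1 (f.1 x) =
      intersectionForm 6 x (anticanonical 6) • anticanonical 6) :
    ∃ e₁ e₂ e₃ : H2 6, IsLine e₁ ∧ IsLine e₂ ∧ IsLine e₃ ∧ Meets f e₂ e₁ ∧ Meets f e₃ e₁ ∧
      Meets f e₃ (f.1 e₂) := by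
  obtain ⟨e₁, e₂, h₁, h₂, h₂₁⟩ : ∃ e₁ e₂ : H2 6, IsLine e₁ ∧ IsLine e₂ ∧ Meets f e₂ e₁ := by
    have h₀ : IsLine (E 0 : H2 6) := isLine_E 0
    have h₁ : IsLine (E 1 : H2 6) := isLine_E 1
    have h : intersectionForm 6 (E 1 : H2 6) (E 0) = 0 := by simp [intersectionForm_E_E]
    obtain ⟨a, b⟩ := hf.line_self hsum h₀
    rw [intersectionForm_comm] at a b
    rcases hf.exists_meets hsum h₁ h₀
      (by intro e; rw [e, h₀.1] at h; norm_num at h)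
      (by intro e; rw [e, a] at h; norm_num at h)
      (by intro e; rw [e, b] at h; norm_num at h) with h | h | h
    · exact ⟨_, _, h₀, h₁, h⟩
    · exact ⟨_, _, h₀.apply hf.fixes, h₁, h⟩
    · exact ⟨_, _, (h₀.apply hf.fixes).apply hf.fixes, h₁, h⟩
  obtain ⟨a₁, b₁⟩ := hf.line_self hsum h₁
  obtain ⟨a₂, b₂⟩ := hf.line_self hsum h₂
  have h₁₂ := hf.meets_symm h₂₁
  have hx : ∀ s : H2 6, intersectionForm 6 s
      (f.1 e₁ + (2 : ℤ) • f.1 (f.1 e₁) - f.1 e₂ - (2 : ℤ) • f.1 (f.1 e₂)) =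
      intersectionForm 6 s (f.1 e₁) + 2 * intersectionForm 6 s (f.1 (f.1 e₁)) -
      intersectionForm 6 s (f.1 e₂) - 2 * intersectionForm 6 s (f.1 (f.1 e₂)) := fun s => by
    simp only [map_sub, map_add, map_smul, smul_eq_mul]
  obtain ⟨s, hs, hsx⟩ := exists_line_not_dvd
    (x := f.1 e₁ + (2 : ℤ) • f.1 (f.1 e₁) - f.1 e₂ - (2 : ℤ) • f.1 (f.1 e₂)) (by
      rw [hx]
      simp only [LinearMap.map_sub₂, LinearMap.map_add₂, LinearMap.map_smul₂,
        hf.form_apply_swap, hf.cube, a₁, b₁, a₂, b₂, h₁.1, h₂.1, h₂₁.zero, h₂₁.one, h₂₁.two,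
        h₁₂.zero, h₁₂.one, h₁₂.two]
      norm_num)
  have hex : ∀ y : H2 6, (3 : ℤ) ∣ intersectionForm 6 y
      (f.1 e₁ + (2 : ℤ) • f.1 (f.1 e₁) - f.1 e₂ - (2 : ℤ) • f.1 (f.1 e₂)) → s ≠ y := by
    rintro y hy rfl
    exact hsx hy
  have m₁ := hf.exists_meets hsum hs h₁
    (hex _ (by
      rw [hx]
      norm_num [isometry_apply, hf.form_apply_swap, hf.cube, a₁, b₁, h₁.1, h₁₂.zero, h₁₂.one,
        h₁₂.two]))
    (hex _ (by
      rw [hx]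
      norm_num [isometry_apply, hf.form_apply_swap, hf.cube, a₁, b₁, h₁.1, h₁₂.zero, h₁₂.one,
        h₁₂.two]))
    (hex _ (by
      rw [hx]
      norm_num [isometry_apply, hf.form_apply_swap, hf.cube, a₁, b₁, h₁.1, h₁₂.zero, h₁₂.one,
        h₁₂.two]))
  have m₂ := hf.exists_meets hsum hs h₂
    (hex _ (by
      rw [hx]
      norm_num [isometry_apply, hf.form_apply_swap, hf.cube, a₂, b₂, h₂.1, h₂₁.zero, h₂₁.one,
        h₂₁.two]))
    (hex _ (by
      rw [hx]
      norm_num [isometry_apply, hf.form_apply_swap, hf.cube, a₂, b₂, h₂.1, h₂₁.zero, h₂₁.one,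
        h₂₁.two]))
    (hex _ (by
      rw [hx]
      norm_num [isometry_apply, hf.form_apply_swap, hf.cube, a₂, b₂, h₂.1, h₂₁.zero, h₂₁.one,
        h₂₁.two]))
  rw [hx] at hsx
  have hne : ¬ (Meets f s e₁ ∧ Meets f s e₂) ∧ ¬ (Meets f s (f.1 e₁) ∧ Meets f s (f.1 e₂)) ∧
      ¬ (Meets f s (f.1 (f.1 e₁)) ∧ Meets f s (f.1 (f.1 e₂))) := by
    refine ⟨fun h => hsx ?_, fun h => hsx ?_, fun h => hsx ?_⟩
    · rw [h.1.one, h.1.two, h.2.one, h.2.two]; norm_num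
    · rw [h.1.zero, h.1.one, h.2.zero, h.2.one]; norm_num
    · have u := h.1.two
      have v := h.2.two
      rw [hf.cube] at u v
      rw [h.1.zero, h.2.zero, (by rw [← hf.cube e₁, h.1.two] : 
        intersectionForm 6 s (f.1 e₁) = 0), v]
      norm_num
  have final : ∀ t, IsLine t → Meets f t e₁ → (Meets f t (f.1 e₂) ∨ Meets f t (f.1 (f.1 e₂))) →
      ∃ e₁ e₂ e₃ : H2 6, IsLine e₁ ∧ IsLine e₂ ∧ IsLine e₃ ∧ Meets f e₂ e₁ ∧ Meets f e₃ e₁ ∧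
      Meets f e₃ (f.1 e₂) := by
    rintro t ht ht₁ (h | h)
    · exact ⟨e₁, e₂, t, h₁, h₂, ht, h₂₁, ht₁, h⟩
    -- A difference of two becomes a difference of one when the second and third trios are
    -- exchanged.
    · refine ⟨e₁, t, e₂, h₁, ht, h₂, ht₁, h₂₁, ?_⟩
      have := hf.meets_symm h.apply
      rwa [hf.cube] at this
  have hs' := hs.apply hf.fixes
  rcases m₁ with m₁ | m₁ | m₁ <;> rcases m₂ with m₂ | m₂ | m₂
  · exact absurd ⟨m₁, m₂⟩ hne.1
  · exact final s hs m₁ (Or.inl m₂)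
  · exact final s hs m₁ (Or.inr m₂)
  · have u := m₁.apply.apply
    have v := m₂.apply.apply
    rw [hf.cube] at u
    exact final _ (hs'.apply hf.fixes) u (Or.inr v)
  · exact absurd ⟨m₁, m₂⟩ hne.2.1
  · have u := m₁.apply.apply
    have v := m₂.apply.apply
    rw [hf.cube] at u v
    exact final _ (hs'.apply hf.fixes) u (Or.inl v)
  · have u := m₁.apply
    rw [hf.cube] at u
    exact final _ hs' u (Or.inl m₂.apply)
  · have u := m₁.apply
    rw [hf.cube] at u
    exact final _ hs' u (Or.inr m₂.apply)
  · exact absurd ⟨m₁, m₂⟩ hne.2.2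

theorem exists_trio_basis (hf : IsCubic f) (hsum : ∀ x, x + f.1 x + f.1 (f.1 x) =
      intersectionForm 6 x (anticanonical 6) • anticanonical 6) :
    ∃ e₁ e₂ e₃ : H2 6, (∀ i j, intersectionForm 6 (trioBasis f e₁ e₂ e₃ i)
      (trioBasis f e₁ e₂ e₃ j) = gramTritangent i j) ∧ IsLine e₁ ∧ IsLine e₂ ∧ IsLine e₃ := by
  obtain ⟨e₁, e₂, e₃, h₁, h₂, h₃, m₂₁, m₃₁, m₃₂⟩ := hf.exists_lines hsum
  have n₁₂ := hf.meets_symm m₂₁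
  have n₁₃ := hf.meets_symm m₃₁
  have n₂₃ := hf.meets_symm m₃₂
  have q₁ := hf.line_self hsum h₁
  have q₂ := hf.line_self hsum h₂
  have q₃ := hf.line_self hsum h₃
  have k := intersectionForm_anticanonical_self 6
  norm_num at k
  have q : ∀ x : H2 6, IsLine x → intersectionForm 6 x (anticanonical 6) = 1 ∧
      intersectionForm 6 (f.1 x) (anticanonical 6) = 1 ∧
      intersectionForm 6 (anticanonical 6) x = 1 ∧
      intersectionForm 6 (anticanonical 6) (f.1 x) = 1 ∧ intersectionForm 6 x x = -1 := fun x h =>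
    ⟨h.2, (h.apply hf.fixes).2, by rw [intersectionForm_comm, h.2],
      by rw [intersectionForm_comm, (h.apply hf.fixes).2], h.1⟩
  have k₁ := q _ h₁
  have k₂ := q _ h₂
  have k₃ := q _ h₃
  have w₁ := m₃₂.zero
  have w₂ := m₃₂.one
  have w₃ := m₃₂.two
  rw [hf.cube] at w₃
  have w₄ := n₂₃.zero
  have w₅ := n₂₃.one
  have w₆ := n₂₃.two
  rw [isometry_apply] at w₅
  rw [hf.form_apply_swap] at w₄
  rw [hf.form_apply_swap, hf.cube] at w₆
  refine ⟨e₁, e₂, e₃, fun i j => ?_, h₁, h₂, h₃⟩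
  have s := hf.form_apply_swap
  have c := hf.cube
  have z₁ := m₂₁.zero
  have z₂ := m₂₁.one
  have z₃ := m₂₁.two
  have z₄ := m₃₁.zero
  have z₅ := m₃₁.one
  have z₆ := m₃₁.two
  have y₁ := n₁₂.zero
  have y₂ := n₁₂.one
  have y₃ := n₁₂.two
  have y₄ := n₁₃.zero
  have y₅ := n₁₃.one
  have y₆ := n₁₃.two
  clear q h₁ h₂ h₃ m₂₁ m₃₁ m₃₂ n₁₂ n₁₃ n₂₃ hsum
  fin_cases i <;> fin_cases j <;> simp [trioBasis, gramTritangent, *]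

/-- Automorphisms of order three which fix only multiples of the anticanonical class are conjugate
for `n = 6`. -/
theorem exists_conj_six {f' : Mod 6} (hf : IsCubic f) (hf' : IsCubic f')
    (hsum : ∀ x, x + f.1 x + f.1 (f.1 x) =
      intersectionForm 6 x (anticanonical 6) • anticanonical 6)
    (hsum' : ∀ x, x + f'.1 x + f'.1 (f'.1 x) =
      intersectionForm 6 x (anticanonical 6) • anticanonical 6) :
    ∃ g ∈ weylGroup 6, g * f * g⁻¹ = f' := by
  obtain ⟨e₁, e₂, e₃, hu, h₁, h₂, h₃⟩ := hf.exists_trio_basis hsum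
  obtain ⟨e₁', e₂', e₃', hu', h₁', h₂', h₃'⟩ := hf'.exists_trio_basis hsum'
  have hff : ∀ {g : Mod 6} {x : H2 6}, IsLine x → (∀ x, x + g.1 x + g.1 (g.1 x) =
      intersectionForm 6 x (anticanonical 6) • anticanonical 6) →
      g.1 (g.1 x) = anticanonical 6 - x - g.1 x := by
    intro g x hx h
    have := h x
    rw [hx.2, one_smul] at this
    rw [← this]
    abel
  refine exists_conj_of_gram gramTritangent_mul_inv hu hu' ⟨Pi.single 2 1, ?_, ?_⟩ fun j => ?_
  · simp [Pi.single_apply, trioBasis]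
  · simp [Pi.single_apply, trioBasis]
  · refine ⟨![Pi.single 1 1, ![-1, -1, 1, 0, 0, 0, 0], Pi.single 2 1, Pi.single 4 1,
      ![0, 0, 1, -1, -1, 0, 0], Pi.single 6 1, ![0, 0, 1, 0, 0, -1, -1]] j, ?_, ?_⟩
    · have i₁ := hff h₁ hsum
      have i₂ := hff h₂ hsum
      have i₃ := hff h₃ hsum
      fin_cases j <;>
        simp [Fin.sum_univ_succ, Pi.single_apply, trioBasis, i₁, i₂, i₃, hf.fixes] <;> abel
    · have i₁ := hff h₁' hsum'
      have i₂ := hff h₂' hsum'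
      have i₃ := hff h₃' hsum'
      fin_cases j <;>
        simp [Fin.sum_univ_succ, Pi.single_apply, trioBasis, i₁, i₂, i₃, hf'.fixes] <;> abel

end IsCubic

/-! ### Isometries fixing only multiples of the anticanonical class -/

/-- `f` fixes the anticanonical class, and the sum of its first `p` powers is `d` times the
projection to the line spanned by it. -/
structure IsCuspidal {n : ℕ} (f : Mod n) (p : ℕ) (d : ℤ) : Prop where
  fixes : f.1 (anticanonical n) = anticanonical n
  sum : ∀ x, orbitSum f p x = (d * intersectionForm n x (anticanonical n)) • anticanonical n

namespace IsCuspidal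

variable {n : ℕ} {f : Mod n} {p : ℕ} {d : ℤ}

/-- The orbit sum is a multiple of the fixed vector `-K`, so shifting the sum by one step leaves it
unchanged and the end terms `fᵖ x` and `x` agree. -/
theorem pow_eq_one (hf : IsCuspidal f p d) : f ^ p = 1 := by
  refine mod_ext fun x => ?_
  have h1 : f.1 (orbitSum f p x) = orbitSum f p x := by rw [hf.sum, map_smul, hf.fixes]
  have h2 : f.1 (orbitSum f p x) = ∑ i ∈ Finset.range p, (f ^ (i + 1)).1 x := by
    rw [orbitSum, map_sum]
    refine Finset.sum_congr rfl fun i _ => ?_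
    rw [pow_succ', mul_val_apply]
  have h3 := Finset.sum_range_succ (fun i => (f ^ i).1 x) p
  rw [Finset.sum_range_succ', ← h2, h1] at h3
  exact (add_left_cancel h3).symm

theorem isCubic (hf : IsCuspidal f 3 d) : IsCubic f where
  fixes := hf.fixes
  cube x := congrArg (fun g : Mod n => g.1 x) hf.pow_eq_one
  sum x hx := by
    have h := hf.sum x
    rw [hx, mul_zero, zero_smul] at h
    simp only [orbitSum, Finset.sum_range_succ, Finset.sum_range_zero, zero_add] at h
    exact h

theorem isQuintic (hf : IsCuspidal f 5 d) : IsQuintic f where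
  fixes := hf.fixes
  pow_five := hf.pow_eq_one
  sum x hx := by rw [hf.sum x, hx, mul_zero, zero_smul]

/-- Counting fixed points of `f` on the reduction of the lattice modulo `q`. -/
theorem card_modEq {f : Mod n} (hf : IsCuspidal f p p) (hn : 0 < n) (hp : p.Prime) {q : ℕ}
    (hq : q.Prime) (hpq : p ≠ q) : q ^ (n + 1) ≡ q [MOD p] := by
  have := Fact.mk hp
  have := Fact.mk hq
  let red : H2 n → (Fin (n + 1) → ZMod q) := fun x i => (x i : ZMod q)
  have red_add : ∀ x y, red (x + y) = red x + red y := fun x y => funext fun i => by simp [red]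
  have red_smul : ∀ (c : ℤ) x, red (c • x) = (c : ZMod q) • red x := fun c x =>
    funext fun i => by simp [red]
  have red_eq : ∀ x y, red x = red y → ∀ g : Mod n, red (g.1 x) = red (g.1 y) := by
    intro x y h g
    have h1 : ∀ i, (q : ℤ) ∣ x i - y i := fun i => by
      rw [← ZMod.intCast_zmod_eq_zero_iff_dvd]
      have := congrFun h i
      simp only [red] at this
      rw [Int.cast_sub, this, sub_self]
    choose z hz using h1
    have h2 : x = y + (q : ℤ) • z := funext fun i => by
      rw [Pi.add_apply, Pi.smul_apply, smul_eq_mul, ← hz]; ring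
    rw [h2, map_add, map_smul, red_add, red_smul]
    simp
  let lift : (Fin (n + 1) → ZMod q) → H2 n := fun v i => ((v i).val : ℤ)
  have red_lift : ∀ v, red (lift v) = v := fun v => funext fun i => by simp [red, lift]
  let F : Function.End (Fin (n + 1) → ZMod q) := fun v => red (f.1 (lift v))
  have F_red : ∀ x, F (red x) = red (f.1 x) := fun x => red_eq _ _ (red_lift _) f
  have F_pow : ∀ (k : ℕ) x, (F ^ k) (red x) = red ((f ^ k).1 x) := by
    intro k
    induction k with
    | zero => intro x; rfl
    | succ k ih =>
      intro x
      rw [pow_succ' F, pow_succ' f, mul_val_apply, ← F_red, ← ih]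
      rfl
  have hF : F ^ p ^ 1 = 1 := by
    funext v
    rw [pow_one, ← red_lift v, F_pow, hf.pow_eq_one]
    rfl
  have h := Equiv.Perm.card_fixedPoints_modEq hF
  have hfixed : ∀ v, v ∈ F.fixedPoints ↔ ∃ c : ZMod q, v = c • red (anticanonical n) := by
    intro v
    constructor
    · intro hv
      have h1 : red (f.1 (lift v)) = red (lift v) := by rw [red_lift]; exact hv
      have h2 : ∀ i : ℕ, red ((f ^ i).1 (lift v)) = red (lift v) := by
        intro i
        induction i with
        | zero => rfl
        | succ i ih => rw [pow_succ, mul_val_apply, red_eq _ _ h1, ih]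
      have h3 : ∀ m, red (orbitSum f m (lift v)) = (m : ZMod q) • red (lift v) := by
        intro m
        induction m with
        | zero => funext i; simp [orbitSum, red]
        | succ m ih =>
          have e : orbitSum f (m + 1) (lift v) = orbitSum f m (lift v) + (f ^ m).1 (lift v) :=
            Finset.sum_range_succ _ _
          rw [e, red_add, ih, h2, Nat.cast_succ, add_smul, one_smul]
      have h4 := h3 p
      rw [hf.sum, red_smul, red_lift, Int.cast_mul, Int.cast_natCast, mul_smul] at h4
      have hp0 : (p : ZMod q) ≠ 0 := by
        rw [Ne, ZMod.natCast_eq_zero_iff]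
        exact fun hd => hpq ((Nat.prime_dvd_prime_iff_eq hq hp).1 hd).symm
      -- On a vector fixed modulo `q` the orbit sum is `p` times the vector, and it is also `p`
      -- times a multiple of `-K`. Since `p` is invertible modulo `q`, the vector is a multiple of
      -- `-K`.
      exact ⟨_, (smul_right_injective _ hp0 h4).symm⟩
    · rintro ⟨c, rfl⟩
      obtain ⟨a, rfl⟩ := ZMod.intCast_surjective c
      change F _ = _
      rw [← red_smul, F_red, map_smul, hf.fixes]
  have hcard : Fintype.card F.fixedPoints = q := by
    have hbij : Function.Bijective (fun c : ZMod q =>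
        (⟨c • red (anticanonical n), (hfixed _).2 ⟨c, rfl⟩⟩ : F.fixedPoints)) := by
      refine ⟨fun a b hab => ?_, fun v => ?_⟩
      · have := congrFun (congrArg Subtype.val hab) (Fin.succ ⟨0, hn⟩)
        have e : red (anticanonical n) (Fin.succ ⟨0, hn⟩) = -1 := by
          simp only [red, anticanonical_succ]
          norm_num
        change a * _ = b * _ at this
        rw [e] at this
        simpa using this
      · obtain ⟨c, hc⟩ := (hfixed _).1 v.2
        exact ⟨c, Subtype.ext hc.symm⟩
    exact (Fintype.card_of_bijective hbij).symm.trans (ZMod.card q)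
  rw [hcard] at h
  simpa using h

/-- The fixed-point count gives `p ∣ 2⁹ - 2 = 510` and, unless `p = 3`, `p ∣ 3⁹ - 3 = 19680`. The
greatest common divisor is 30. -/
theorem eq_three_or_five {f : Mod 8} (hf : IsCuspidal f p p) (hp : p.Prime) (hodd : Odd p) :
    p = 3 ∨ p = 5 := by
  by_cases h3 : p = 3
  · exact Or.inl h3
  have h2 : p ≠ 2 := by rintro rfl; exact absurd hodd (by decide)
  have e2 := (Nat.modEq_iff_dvd' (by norm_num)).1
    (hf.card_modEq (by norm_num) hp Nat.prime_two h2).symm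
  have e3 := (Nat.modEq_iff_dvd' (by norm_num)).1
    (hf.card_modEq (by norm_num) hp Nat.prime_three h3).symm
  have e := Nat.dvd_gcd e2 e3
  norm_num at e
  have hd : p ∈ Nat.primeFactors 30 := Nat.mem_primeFactors.2 ⟨hp, e, by norm_num⟩
  have hs : Nat.primeFactors 30 = {2, 3, 5} := by decide +kernel
  rw [hs] at hd
  simp only [Finset.mem_insert, Finset.mem_singleton] at hd
  omega

end IsCuspidal

/-! ### Coxeter elements -/

theorem simpleReflection_zero_apply {n : ℕ} (hn : 3 ≤ n) {j : Fin n} (hj : (j : ℕ) = 0)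
    (x : H2 n) : (simpleReflection hn j).1 x = fun i : Fin (n + 1) =>
      x i + (x 0 + x ⟨1, by omega⟩ + x ⟨2, by omega⟩ + x ⟨3, by omega⟩) *
        if i = 0 then 1 else if (i : ℕ) ≤ 3 then -1 else 0 := by
  have e : simpleRoot hn j = cremonaRoot ⟨0, by omega⟩ ⟨1, by omega⟩ ⟨2, by omega⟩ := if_pos hj
  rw [simpleReflection, reflection_apply_of_neg_two _ (simpleRoot_self hn _), e,
    intersectionForm_cremonaRoot]
  funext i
  rw [Pi.add_apply, Pi.smul_apply, smul_eq_mul]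
  congr 2
  refine Fin.cases ?_ (fun i => ?_) i
  · simp [cremonaRoot, H, E]
  · simp only [cremonaRoot, H, E, Pi.sub_apply, Pi.single_apply, Fin.succ_ne_zero, if_false,
      Fin.succ_inj]
    simp only [Fin.ext_iff, Fin.val_succ]
    split_ifs <;> omega

theorem simpleReflection_succ_apply {n : ℕ} (hn : 3 ≤ n) {j : Fin n} (hj : (j : ℕ) ≠ 0) (x : H2 n) :
    (simpleReflection hn j).1 x = fun i => x (Equiv.swap j.castSucc j.succ i) := by
  have e : simpleRoot hn j = E (⟨j - 1, by omega⟩ : Fin n) - E j := if_neg hj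
  have e' : (⟨j - 1, by omega⟩ : Fin n).succ = j.castSucc :=
    Fin.ext (by simp only [Fin.val_succ, Fin.val_castSucc]; omega)
  have hne : j.castSucc ≠ j.succ := Fin.castSucc_lt_succ.ne
  rw [simpleReflection, reflection_apply_of_neg_two _ (simpleRoot_self hn _), e, map_sub,
    intersectionForm_E, intersectionForm_E, e']
  funext i
  rw [Pi.add_apply, Pi.smul_apply, smul_eq_mul, E, E, e', Pi.sub_apply, Pi.single_apply,
    Pi.single_apply, Equiv.swap_apply_def]
  split_ifs with h1 h2 h2
  · exact absurd (h1.symm.trans h2) hne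
  · rw [h1]; ring
  · rw [h2]; ring
  · ring

/-- The product of the simple reflections in their standard order. -/
noncomputable def coxeterElement {n : ℕ} (hn : 3 ≤ n) : Mod n :=
  (List.ofFn fun i => simpleReflection hn i).prod

theorem simpleRoot_anticanonical {n : ℕ} (hn : 3 ≤ n) (j : Fin n) :
    intersectionForm n (simpleRoot hn j) (anticanonical n) = 0 := by
  unfold simpleRoot
  split_ifs
  · exact cremonaRoot_anticanonical _ _ _
  · rw [LinearMap.map_sub₂, E_anticanonical, E_anticanonical, sub_self]

theorem coxeterElement_mem {n : ℕ} (hn : 3 ≤ n) : coxeterElement hn ∈ weylGroup n := by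
  refine Subgroup.list_prod_mem _ fun g hg => ?_
  obtain ⟨j, rfl⟩ := (List.mem_ofFn' _ _).1 hg
  change simpleReflection hn j ∈ _
  rw [mem_weylGroup_iff, simpleReflection, reflection_apply_of_neg_two _ (simpleRoot_self hn _),
    intersectionForm_comm, simpleRoot_anticanonical, zero_smul, add_zero]

theorem isCoxeterElement_coxeterElement {n : ℕ} (hn : 3 ≤ n) :
    IsCoxeterElement hn ⟨coxeterElement hn, coxeterElement_mem hn⟩ :=
  ⟨1, rfl⟩

theorem pow_apply_mulVec {n : ℕ} {g : Mod n} {A : Matrix (Fin (n + 1)) (Fin (n + 1)) ℤ}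
    (hA : ∀ x, g.1 x = A.mulVec x) (k : ℕ) (x : H2 n) : (g ^ k).1 x = (A ^ k).mulVec x := by
  induction k generalizing x with
  | zero => rw [pow_zero, pow_zero, Matrix.one_mulVec]; rfl
  | succ k ih => rw [pow_succ, pow_succ, mul_val_apply, ih, hA, Matrix.mulVec_mulVec]

/-- The matrix of the projection of an isometry to the anticanonical class. -/
def cuspidalMatrix (n : ℕ) (d : ℤ) : Matrix (Fin (n + 1)) (Fin (n + 1)) ℤ :=
  Matrix.of fun i j => d * anticanonical n i * Fin.cons (α := fun _ => ℤ) 3 (fun _ => 1) j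

theorem cuspidalMatrix_mulVec (n : ℕ) (d : ℤ) (x : H2 n) : (cuspidalMatrix n d).mulVec x =
    (d * intersectionForm n x (anticanonical n)) • anticanonical n := by
  funext i
  rw [Matrix.mulVec, dotProduct, intersectionForm_anticanonical, Fin.sum_univ_succ]
  simp only [cuspidalMatrix, Matrix.of_apply, Fin.cons_zero, Fin.cons_succ, Pi.smul_apply,
    smul_eq_mul, mul_assoc, ← Finset.mul_sum, one_mul]
  ring

theorem isCuspidal_of_matrix {n : ℕ} {g : Mod n} (hg : g ∈ weylGroup n)
    {A : Matrix (Fin (n + 1)) (Fin (n + 1)) ℤ} (hA : ∀ x, g.1 x = A.mulVec x) {p : ℕ} {d : ℤ}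
    (h : ∑ i ∈ Finset.range p, A ^ i = cuspidalMatrix n d) : IsCuspidal g p d where
  fixes := (mem_weylGroup_iff g).1 hg
  sum x := by
    rw [← cuspidalMatrix_mulVec, ← h, Matrix.sum_mulVec]
    exact Finset.sum_congr rfl fun i _ => pow_apply_mulVec hA i x

/-- The matrix of the Coxeter element for `n = 4`. -/
def coxeterMatrix4 : Matrix (Fin 5) (Fin 5) ℤ :=
  !![2, 1, 1, 0, 1;
    -1, -1, -1, 0, 0;
    -1, 0, -1, 0, -1;
    -1, -1, 0, 0, -1;
    0, 0, 0, 1, 0]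

/-- The matrix of the Coxeter element for `n = 6`. -/
def coxeterMatrix6 : Matrix (Fin 7) (Fin 7) ℤ :=
  !![2, 1, 1, 0, 0, 0, 1;
    -1, -1, -1, 0, 0, 0, 0;
    -1, 0, -1, 0, 0, 0, -1;
    -1, -1, 0, 0, 0, 0, -1;
    0, 0, 0, 1, 0, 0, 0;
    0, 0, 0, 0, 1, 0, 0;
    0, 0, 0, 0, 0, 1, 0]

/-- The matrix of the Coxeter element for `n = 8`. -/
def coxeterMatrix8 : Matrix (Fin 9) (Fin 9) ℤ :=
  !![2, 1, 1, 0, 0, 0, 0, 0, 1;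
    -1, -1, -1, 0, 0, 0, 0, 0, 0;
    -1, 0, -1, 0, 0, 0, 0, 0, -1;
    -1, -1, 0, 0, 0, 0, 0, 0, -1;
    0, 0, 0, 1, 0, 0, 0, 0, 0;
    0, 0, 0, 0, 1, 0, 0, 0, 0;
    0, 0, 0, 0, 0, 1, 0, 0, 0;
    0, 0, 0, 0, 0, 0, 1, 0, 0;
    0, 0, 0, 0, 0, 0, 0, 1, 0]

theorem coxeterElement_apply_four (x : H2 4) :
    (coxeterElement (by norm_num : 3 ≤ 4)).1 x = coxeterMatrix4.mulVec x := by
  simp only [coxeterElement, List.ofFn_succ, List.ofFn_zero, List.prod_cons, List.prod_nil, mul_one,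
    mul_val_apply]
  change (simpleReflection _ 0).1 ((simpleReflection _ 1).1 ((simpleReflection _ 2).1
    ((simpleReflection _ 3).1 x))) = _
  rw [simpleReflection_zero_apply _ (j := 0) rfl, simpleReflection_succ_apply _ (j := 1) (by
    decide), simpleReflection_succ_apply _ (j := 2) (by decide), simpleReflection_succ_apply _ (j
    := 3) (by decide)]
  funext i
  fin_cases i <;>
    simp [coxeterMatrix4, Matrix.mulVec, dotProduct, Fin.sum_univ_succ, Equiv.swap_apply_def,
      Fin.ext_iff] <;> ring

theorem coxeterElement_apply_six (x : H2 6) :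
    (coxeterElement (by norm_num : 3 ≤ 6)).1 x = coxeterMatrix6.mulVec x := by
  simp only [coxeterElement, List.ofFn_succ, List.ofFn_zero, List.prod_cons, List.prod_nil, mul_one,
    mul_val_apply]
  change (simpleReflection _ 0).1 ((simpleReflection _ 1).1 ((simpleReflection _ 2).1
    ((simpleReflection _ 3).1 ((simpleReflection _ 4).1 ((simpleReflection _ 5).1 x))))) = _
  rw [simpleReflection_zero_apply _ (j := 0) rfl, simpleReflection_succ_apply _ (j := 1) (by
    decide), simpleReflection_succ_apply _ (j := 2) (by decide), simpleReflection_succ_apply _ (j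
    := 3) (by decide), simpleReflection_succ_apply _ (j := 4) (by decide),
    simpleReflection_succ_apply _ (j := 5) (by decide)]
  funext i
  fin_cases i <;>
    simp [coxeterMatrix6, Matrix.mulVec, dotProduct, Fin.sum_univ_succ, Equiv.swap_apply_def,
      Fin.ext_iff] <;> ring

set_option maxRecDepth 4000 in
theorem coxeterElement_apply_eight (x : H2 8) :
    (coxeterElement (by norm_num : 3 ≤ 8)).1 x = coxeterMatrix8.mulVec x := by
  simp only [coxeterElement, List.ofFn_succ, List.ofFn_zero, List.prod_cons, List.prod_nil, mul_one,
    mul_val_apply]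
  change (simpleReflection _ 0).1 ((simpleReflection _ 1).1 ((simpleReflection _ 2).1
    ((simpleReflection _ 3).1 ((simpleReflection _ 4).1 ((simpleReflection _ 5).1
    ((simpleReflection _ 6).1 ((simpleReflection _ 7).1 x))))))) = _
  rw [simpleReflection_zero_apply _ (j := 0) rfl, simpleReflection_succ_apply _ (j := 1) (by
    decide), simpleReflection_succ_apply _ (j := 2) (by decide), simpleReflection_succ_apply _ (j
    := 3) (by decide), simpleReflection_succ_apply _ (j := 4) (by decide),
    simpleReflection_succ_apply _ (j := 5) (by decide), simpleReflection_succ_apply _ (j := 6) (by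
    decide), simpleReflection_succ_apply _ (j := 7) (by decide)]
  funext i
  fin_cases i <;>
    simp [coxeterMatrix8, Matrix.mulVec, dotProduct, Fin.sum_univ_succ, Equiv.swap_apply_def,
      Fin.ext_iff] <;> ring

/-- The Coxeter numbers for `n = 4, 6, 8` are 5, 12 and 30, so the exponents 1, 4, 10 and 6 used
here and below are the quotients by the required order. -/
theorem isCuspidal_coxeterElement_four :
    IsCuspidal (coxeterElement (by norm_num : 3 ≤ 4) ^ 1) 5 1 := by
  rw [pow_one]
  refine isCuspidal_of_matrix (coxeterElement_mem _) coxeterElement_apply_four ?_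
  have h2 : coxeterMatrix4 ^ 2 = !![2, 1, 0, 1, 1;
    0, 0, 1, 0, 0;
    -1, -1, 0, -1, 0;
    -1, 0, 0, -1, -1;
    -1, -1, 0, 0, -1] := by
    rw [pow_two]
    decide +kernel
  simp only [Finset.sum_range_succ, Finset.sum_range_zero, zero_add, pow_zero, pow_one,
    show coxeterMatrix4 ^ 3 = coxeterMatrix4 ^ 2 * coxeterMatrix4 from pow_succ _ 2,
    show coxeterMatrix4 ^ 4 = coxeterMatrix4 ^ 2 * coxeterMatrix4 ^ 2 from pow_add _ 2 2, h2]
  decide +kernel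

theorem isCuspidal_coxeterElement_six :
    IsCuspidal (coxeterElement (by norm_num : 3 ≤ 6) ^ 4) 3 1 := by
  refine isCuspidal_of_matrix (Subgroup.pow_mem _ (coxeterElement_mem _) _)
    (pow_apply_mulVec coxeterElement_apply_six 4) ?_
  have h2 : coxeterMatrix6 ^ 2 = !![2, 1, 0, 0, 0, 1, 1;
    0, 0, 1, 0, 0, 0, 0;
    -1, -1, 0, 0, 0, -1, 0;
    -1, 0, 0, 0, 0, -1, -1;
    -1, -1, 0, 0, 0, 0, -1;
    0, 0, 0, 1, 0, 0, 0;
    0, 0, 0, 0, 1, 0, 0] := by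
    rw [pow_two]
    decide +kernel
  have h4 : coxeterMatrix6 ^ 4 = !![4, 2, 1, 1, 1, 2, 2;
    -1, -1, 0, 0, 0, -1, 0;
    -2, -1, -1, -1, 0, -1, -1;
    -2, -1, 0, -1, -1, -1, -1;
    -2, -1, -1, 0, -1, -1, -1;
    -1, 0, 0, 0, 0, -1, -1;
    -1, -1, 0, 0, 0, 0, -1] := by
    rw [show coxeterMatrix6 ^ 4 = coxeterMatrix6 ^ 2 * coxeterMatrix6 ^ 2 from
      pow_add _ 2 2, h2]
    decide +kernel
  simp only [Finset.sum_range_succ, Finset.sum_range_zero, zero_add, pow_zero, pow_one, pow_two, h4]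
  decide +kernel

theorem coxeterMatrix8_pow_six : coxeterMatrix8 ^ 6 =
  !![7, 3, 2, 1, 1, 2, 2, 3, 4;
    -2, -1, -1, 0, 0, -1, 0, -1, -1;
    -3, -1, -1, -1, 0, -1, -1, -1, -2;
    -4, -2, -1, -1, -1, -1, -1, -2, -2;
    -3, -1, -1, 0, -1, -1, -1, -1, -2;
    -2, -1, 0, 0, 0, -1, -1, -1, -1;
    -2, -1, -1, 0, 0, 0, -1, -1, -1;
    -1, 0, 0, 0, 0, 0, 0, -1, -1;
    -1, -1, 0, 0, 0, 0, 0, 0, -1] ∧ coxeterMatrix8 ^ 10 =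
  !![13, 5, 4, 3, 4, 4, 5, 5, 6;
    -4, -2, -1, -1, -1, -1, -2, -1, -2;
    -5, -2, -2, -1, -2, -1, -2, -2, -2;
    -6, -2, -2, -2, -2, -2, -2, -2, -3;
    -5, -2, -1, -1, -2, -2, -2, -2, -2;
    -5, -2, -2, -1, -1, -2, -2, -2, -2;
    -4, -1, -1, -1, -1, -1, -2, -2, -2;
    -4, -2, -1, -1, -1, -1, -1, -2, -2;
    -3, -1, -1, 0, -1, -1, -1, -1, -2] := by
  have h2 : coxeterMatrix8 ^ 2 = !![2, 1, 0, 0, 0, 0, 0, 1, 1;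
    0, 0, 1, 0, 0, 0, 0, 0, 0;
    -1, -1, 0, 0, 0, 0, 0, -1, 0;
    -1, 0, 0, 0, 0, 0, 0, -1, -1;
    -1, -1, 0, 0, 0, 0, 0, 0, -1;
    0, 0, 0, 1, 0, 0, 0, 0, 0;
    0, 0, 0, 0, 1, 0, 0, 0, 0;
    0, 0, 0, 0, 0, 1, 0, 0, 0;
    0, 0, 0, 0, 0, 0, 1, 0, 0] := by
    rw [pow_two]
    decide +kernel
  have h4 : coxeterMatrix8 ^ 4 = !![4, 2, 1, 0, 0, 1, 1, 2, 2;
    -1, -1, 0, 0, 0, 0, 0, -1, 0;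
    -2, -1, -1, 0, 0, -1, 0, -1, -1;
    -2, -1, 0, 0, 0, -1, -1, -1, -1;
    -2, -1, -1, 0, 0, 0, -1, -1, -1;
    -1, 0, 0, 0, 0, 0, 0, -1, -1;
    -1, -1, 0, 0, 0, 0, 0, 0, -1;
    0, 0, 0, 1, 0, 0, 0, 0, 0;
    0, 0, 0, 0, 1, 0, 0, 0, 0] := by
    rw [show coxeterMatrix8 ^ 4 = coxeterMatrix8 ^ 2 * coxeterMatrix8 ^ 2 from
      pow_add _ 2 2, h2]
    decide +kernel
  have h6 : coxeterMatrix8 ^ 6 = !![7, 3, 2, 1, 1, 2, 2, 3, 4;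
    -2, -1, -1, 0, 0, -1, 0, -1, -1;
    -3, -1, -1, -1, 0, -1, -1, -1, -2;
    -4, -2, -1, -1, -1, -1, -1, -2, -2;
    -3, -1, -1, 0, -1, -1, -1, -1, -2;
    -2, -1, 0, 0, 0, -1, -1, -1, -1;
    -2, -1, -1, 0, 0, 0, -1, -1, -1;
    -1, 0, 0, 0, 0, 0, 0, -1, -1;
    -1, -1, 0, 0, 0, 0, 0, 0, -1] := by
    rw [show coxeterMatrix8 ^ 6 = coxeterMatrix8 ^ 4 * coxeterMatrix8 ^ 2 from
      pow_add _ 4 2, h2, h4]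
    decide +kernel
  refine ⟨h6, ?_⟩
  rw [show coxeterMatrix8 ^ 10 = coxeterMatrix8 ^ 6 * coxeterMatrix8 ^ 4 from
      pow_add _ 6 4, h6, h4]
  decide +kernel

theorem isCuspidal_coxeterElement_eight_three :
    IsCuspidal (coxeterElement (by norm_num : 3 ≤ 8) ^ 10) 3 3 := by
  refine isCuspidal_of_matrix (Subgroup.pow_mem _ (coxeterElement_mem _) _)
    (pow_apply_mulVec coxeterElement_apply_eight 10) ?_
  simp only [Finset.sum_range_succ, Finset.sum_range_zero, zero_add, pow_zero, pow_one, pow_two,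
    coxeterMatrix8_pow_six.2]
  decide +kernel

theorem isCuspidal_coxeterElement_eight_five :
    IsCuspidal (coxeterElement (by norm_num : 3 ≤ 8) ^ 6) 5 5 := by
  refine isCuspidal_of_matrix (Subgroup.pow_mem _ (coxeterElement_mem _) _)
    (pow_apply_mulVec coxeterElement_apply_eight 6) ?_
  rw [coxeterMatrix8_pow_six.1]
  generalize hB : (!![7, 3, 2, 1, 1, 2, 2, 3, 4;
    -2, -1, -1, 0, 0, -1, 0, -1, -1;
    -3, -1, -1, -1, 0, -1, -1, -1, -2;
    -4, -2, -1, -1, -1, -1, -1, -2, -2;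
    -3, -1, -1, 0, -1, -1, -1, -1, -2;
    -2, -1, 0, 0, 0, -1, -1, -1, -1;
    -2, -1, -1, 0, 0, 0, -1, -1, -1;
    -1, 0, 0, 0, 0, 0, 0, -1, -1;
    -1, -1, 0, 0, 0, 0, 0, 0, -1] : Matrix (Fin 9) (Fin 9) ℤ) = B
  have h2 : B ^ 2 = !![15, 5, 5, 4, 5, 5, 6, 6, 6;
    -5, -2, -2, -1, -2, -1, -2, -2, -2;
    -5, -1, -2, -1, -2, -2, -2, -2, -2;
    -6, -2, -2, -2, -2, -2, -3, -2, -2;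
    -6, -2, -2, -2, -2, -2, -2, -3, -2;
    -6, -2, -2, -2, -2, -2, -2, -2, -3;
    -5, -2, -1, -1, -2, -2, -2, -2, -2;
    -5, -2, -2, -1, -1, -2, -2, -2, -2;
    -4, -1, -1, -1, -1, -1, -2, -2, -2] := by
    rw [← hB, pow_two]
    decide +kernel
  simp only [Finset.sum_range_succ, Finset.sum_range_zero, zero_add, pow_zero, pow_one,
    show B ^ 3 = B ^ 2 * B from pow_succ _ 2,
    show B ^ 4 = B ^ 2 * B ^ 2 from pow_add _ 2 2, h2]
  rw [← hB]
  decide +kernel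

/-! ### Comparison with the Coxeter element and conclusion -/

theorem IsCuspidal.isConj {n : ℕ} (hn : n ≤ 8) {f f' : Mod n} {p : ℕ} {d : ℤ}
    (hf : IsCuspidal f p d) (hf' : IsCuspidal f' p d)
    (h : (n = 4 ∧ p = 5 ∧ d = 1) ∨ (n = 6 ∧ p = 3 ∧ d = 1) ∨ (n = 8 ∧ (p = 3 ∨ p = 5))) :
    ∃ g ∈ ModPlus n, g * f * g⁻¹ = f' := by
  suffices ∃ g ∈ weylGroup n, g * f * g⁻¹ = f' by
    obtain ⟨g, hg, e⟩ := this
    exact ⟨g, weylGroup_le_ModPlus hn hg, e⟩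
  rcases h with ⟨rfl, rfl, rfl⟩ | ⟨rfl, rfl, rfl⟩ | ⟨rfl, rfl | rfl⟩
  · exact hf.isQuintic.exists_conj_four hf'.isQuintic (fun x => by rw [hf.sum, one_mul])
      (fun x => by rw [hf'.sum, one_mul])
  · have key : ∀ {g : Mod 6}, IsCuspidal g 3 1 → ∀ x, x + g.1 x + g.1 (g.1 x) =
        intersectionForm 6 x (anticanonical 6) • anticanonical 6 := by
      intro g hg x
      rw [← one_mul (intersectionForm 6 x (anticanonical 6)), ← hg.sum]
      simp only [orbitSum, Finset.sum_range_succ, Finset.sum_range_zero, zero_add]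
      rfl
    exact hf.isCubic.exists_conj_six hf'.isCubic (key hf) (key hf')
  · exact hf.isCubic.exists_conj hf'.isCubic
  · exact hf.isQuintic.exists_conj hf'.isQuintic

theorem exists_isConj_coxeterElement_pow (n : ℕ) (hn : 3 ≤ n) (hn8 : n ≤ 8) (f : ModPlus n)
    (hirr : IsIrreducible (f : Mod n))
    (p : ℕ) (hp : p.Prime) (hodd : Odd p) (hord : orderOf f = p) :
    ∃ (w : ModPlus n) (hw : (w : Mod n) ∈ weylGroup n),
      IsCoxeterElement hn ⟨(w : Mod n), hw⟩ ∧ ∃ k : ℕ, IsConj f (w ^ k) := by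
  have hfp : (f : Mod n) ^ p = 1 := by
    have h : f ^ p = 1 := hord ▸ pow_orderOf_eq_one f
    exact congrArg Subtype.val h
  obtain ⟨g, hg, hgf⟩ := exists_conj_mem_weylGroup hn hn8 f.2 hp.pos hfp hirr
  obtain ⟨d, hd, hsum⟩ := orbitSum_eq hn hn8 hodd (f := g * (f : Mod n) * g⁻¹)
    (by rw [conj_pow, hfp, mul_one, mul_inv_cancel]) hgf (fun h => hirr (h.conj g))
  have hc : IsCuspidal (g * (f : Mod n) * g⁻¹) p d := ⟨hgf, hsum⟩
  have hw := weylGroup_le_ModPlus hn8 (coxeterElement_mem hn)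
  suffices ∃ k : ℕ, ∃ h ∈ ModPlus n, h * (g * (f : Mod n) * g⁻¹) * h⁻¹ = coxeterElement hn ^ k by
    obtain ⟨k, h, hh, e⟩ := this
    refine ⟨⟨_, hw⟩, coxeterElement_mem hn, isCoxeterElement_coxeterElement hn, k,
      isConj_iff.2 ⟨⟨h * g, mul_mem hh hg⟩, Subtype.ext ?_⟩⟩
    change h * g * (f : Mod n) * (h * g)⁻¹ = coxeterElement hn ^ k
    rw [← e]
    group
  have h3 : 3 ≤ p := by
    have := hp.two_le
    obtain ⟨a, ha⟩ := hodd
    omega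
  -- `9 - n` divides the odd prime `p`. The even values 6, 4 and 2 are impossible, 5 and 3 must
  -- equal `p`, and the value 1 gives `d = p`.
  have hcases : (n = 4 ∧ p = 5 ∧ d = 1) ∨ (n = 6 ∧ p = 3 ∧ d = 1) ∨ (n = 8 ∧ d = p) := by
    have hdp : 0 ≤ d := by
      by_contra! hneg
      have := mul_neg_of_neg_of_pos hneg (show (0 : ℤ) < 9 - n by omega)
      omega
    lift d to ℕ using hdp
    obtain ⟨a, ha⟩ := hodd
    have hq : ∀ q : ℕ, q.Prime → (d : ℤ) * q = p → p = q ∧ (d : ℤ) = 1 := by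
      intro q hq h
      have h' : d * q = p := by exact_mod_cast h
      have h1 := (Nat.prime_dvd_prime_iff_eq hq hp).1 ⟨d, by rw [← h', mul_comm]⟩
      refine ⟨h1.symm, ?_⟩
      rw [h1] at h'
      exact_mod_cast Nat.eq_of_mul_eq_mul_right hp.pos (h'.trans (one_mul p).symm)
    interval_cases n
    · norm_num at hd; omega
    · exact Or.inl ⟨rfl, hq 5 Nat.prime_five hd⟩
    · norm_num at hd; omega
    · exact Or.inr (Or.inl ⟨rfl, hq 3 Nat.prime_three hd⟩)
    · norm_num at hd; omega
    · norm_num at hd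
      exact Or.inr (Or.inr ⟨rfl, congrArg Nat.cast hd⟩)
  rcases hcases with ⟨rfl, rfl, rfl⟩ | ⟨rfl, rfl, rfl⟩ | ⟨rfl, rfl⟩
  · exact ⟨1, hc.isConj hn8 isCuspidal_coxeterElement_four (by norm_num)⟩
  · exact ⟨4, hc.isConj hn8 isCuspidal_coxeterElement_six (by norm_num)⟩
  · rcases hc.eq_three_or_five hp hodd with rfl | rfl
    · exact ⟨10, hc.isConj hn8 isCuspidal_coxeterElement_eight_three (by norm_num)⟩
    · exact ⟨6, hc.isConj hn8 isCuspidal_coxeterElement_eight_five (by norm_num)⟩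

end DelPezzo

theorem theorem1p3 (n : ℕ) (hn : 3 ≤ n) (hn8 : n ≤ 8) (f : DelPezzo.ModPlus n)
    (hirr : DelPezzo.IsIrreducible (f : DelPezzo.Mod n))
    (p : ℕ) (hp : p.Prime) (hodd : Odd p) (hord : orderOf f = p) :
    ∃ (w : DelPezzo.ModPlus n) (hw : (w : DelPezzo.Mod n) ∈ DelPezzo.weylGroup n),
      DelPezzo.IsCoxeterElement hn ⟨(w : DelPezzo.Mod n), hw⟩ ∧ ∃ k : ℕ, IsConj f (w ^ k) := by
  exact DelPezzo.exists_isConj_coxeterElement_pow n hn hn8 f hirr p hp hodd hord
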